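/- **Stabilization theorem.** Let $\Gamma\rightrightarrows M$ be a Hausdorff, locally compact, second countable topological groupoid with source and target maps $s,t:\Gamma\to M$ (so $gh$ is defined when $s(g)=t(h)$) that is proper, i.e. $(s,t):\Gamma\to M\times M$ is a proper map. Let $\lambda=(\lambda^x)_{x\in M}$ be a Haar system: $\lambda^x$ is a Radon measure on $\Gamma$ with support $\Gamma^x=t^{-1}(x)$, the family is left invariant, and $x\mapsto\int f\,d\lambda^x$ is continuous for every $f\in C_c(\Gamma)$; let $\lambda_x$ be the image of $\lambda^x$ under $g\mapsto g^{-1}$, a measure on $\Gamma_x=s^{-1}(x)$. Let $E$ be an upper semicontinuous Fell bundle over $\Gamma$: an upper semicontinuous field of complex Banach spaces $(E_g)_{g\in\Gamma}$ (a topology on the total space inducing the norm topology on each fibre, with continuous open projection, continuous addition and scalar multiplication, upper semicontinuous norm, such that $\|e_i\|\to0$ and $\pi(e_i)\to g$ imply $e_i\to 0_g$, and with a continuous section through every point), with a continuous associative bilinear product $E_g\times E_h\to E_{gh}$ for $s(g)=t(h)$ and a continuous antilinear involution $E_g\to E_{g^{-1}}$ such that $\|ee'\|\le\|e\|\|e'\|$,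 $(ee')^*=e'^*e^*$, $\|e^*e\|=\|e\|^2$, $e^*e\ge0$ in the $C^*$-algebra $E_{s(g)}$, and the products span a dense subspace of $E_{gh}$. Put $A=C_0(M;E)$ (continuous sections over the units vanishing at infinity), a $C^*$-algebra with fibres $A_x=E_x$. For a right Hilbert $A$-module $\mathcal E$ put $\mathcal E_x=\mathcal E\otimes_A A_x$ and let $\xi(x)\in\mathcal E_x$ be the image of $\xi\in\mathcal E$. A $(\Gamma,E)$-equivariant Hilbert module is a right Hilbert $A$-module $\mathcal E$ with isomorphisms of Hilbert $A_{s(g)}$-modules $\mathcal E_{t(g)}\otimes_{A_{t(g)}}E_g\to\mathcal E_{s(g)}$, $z\otimes e\mapsto ze$ ($g\in\Gamma$), such that $(ze)e'=z(ee')$ for $z\in\mathcal E_{t(g)}$, $e\in E_g$, $e'\in E_h$, $s(g)=t(h)$, and such that for all $\xi\in\mathcal E$ and $\eta\in C_0(\Gamma;E)$ the section $g\mapsto\xi(t(g))\eta(g)$ of the pulled back field $s^*\mathcal E=(\mathcal E_{s(g)})_{g\in\Gamma}$ is continuous. Direct sums of equivariant modules carry the diagonal action, and an isomorphism of equivariant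 modules is an isomorphism of Hilbert $A$-modules that intertwines the actions on the fibres. Let $L^2(\Gamma;E)$ be the right Hilbert $A$-module obtained by completing $C_c(\Gamma;E)$ with the action $(\xi a)(g)=\xi(g)a(s(g))$ and the inner product $\langle\xi,\eta\rangle(x)=\int_{\Gamma_x}\xi(g)^*\eta(g)\,\lambda_x(dg)$, and let $\mathbb H=\ell^2(\mathbb N)$. Then $L^2(\Gamma;E)\otimes\mathbb H$ is a $(\Gamma,E)$-equivariant Hilbert module for the action determined by $(\xi\otimes v)e=(\xi e)\otimes v$, where for $\xi\in C_c(\Gamma;E)$ and $e\in E_g$ the element $\xi e$ of the fibre over $s(g)$ is the one given by the function $h\mapsto\xi(hg^{-1})e$ on $\Gamma_{s(g)}$. If $\mathcal E$ is a $(\Gamma,E)$-equivariant Hilbert module that is countably generated as a Hilbert $A$-module, then there is an isomorphism of $(\Gamma,E)$-equivariant Hilbert modules $$\mathcal E\oplus\bigl(L^2(\Gamma;E)\otimes\mathbb H\bigr)\;\cong\;L^2(\Gamma;E)\otimes\mathbb H .$$ -/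

import Mathlib

open Set Filter Topology MeasureTheory MulOpposite
open scoped ENNReal

/-- A topological groupoid with arrow space `Γ` and unit space `M`.  The product `mul g h` is only
meaningful for composable pairs, that is when `src g = tgt h`. -/
structure TopGroupoid (Γ M : Type*) [TopologicalSpace Γ] [TopologicalSpace M] where
  src : Γ → M
  tgt : Γ → M
  unit : M → Γ
  inv : Γ → Γ
  mul : Γ → Γ → Γ
  src_unit : ∀ x, src (unit x) = x
  tgt_unit : ∀ x, tgt (unit x) = x
  src_inv : ∀ g, src (inv g) = tgt g
  tgt_inv : ∀ g, tgt (inv g) = src g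
  src_mul : ∀ g h, src g = tgt h → src (mul g h) = src h
  tgt_mul : ∀ g h, src g = tgt h → tgt (mul g h) = tgt g
  mul_assoc : ∀ g h k, src g = tgt h → src h = tgt k → mul (mul g h) k = mul g (mul h k)
  unit_mul : ∀ g, mul (unit (tgt g)) g = g
  mul_unit : ∀ g, mul g (unit (src g)) = g
  inv_mul : ∀ g, mul (inv g) g = unit (src g)
  mul_inv : ∀ g, mul g (inv g) = unit (tgt g)
  continuous_src : Continuous src
  continuous_tgt : Continuous tgt
  continuous_unit : Continuous unit
  continuous_inv : Continuous inv
  continuous_mul : ContinuousOn (fun p : Γ × Γ => mul p.1 p.2) {p | src p.1 = tgt p.2}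

namespace TopGroupoid

variable {Γ M : Type*} [TopologicalSpace Γ] [TopologicalSpace M] (𝒢 : TopGroupoid Γ M)

/-- `𝒢.Comp g h k`: the pair `(g, h)` is composable with product `k`. -/
def Comp (g h k : Γ) : Prop := 𝒢.src g = 𝒢.tgt h ∧ 𝒢.mul g h = k

/-- The groupoid is proper: `(s, t) : Γ → M × M` is a proper map. -/
def Proper : Prop := IsProperMap fun g => (𝒢.src g, 𝒢.tgt g)

variable {𝒢}

theorem comp_unit_unit (x : M) : 𝒢.Comp (𝒢.unit x) (𝒢.unit x) (𝒢.unit x) := by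
  refine ⟨by rw [𝒢.src_unit, 𝒢.tgt_unit], ?_⟩
  have := 𝒢.mul_unit (𝒢.unit x)
  rwa [𝒢.src_unit] at this

theorem comp_unit_right {g : Γ} {x : M} (h : 𝒢.src g = x) : 𝒢.Comp g (𝒢.unit x) g := by
  subst h
  exact ⟨by rw [𝒢.tgt_unit], 𝒢.mul_unit g⟩

theorem comp_unit_left {g : Γ} {x : M} (h : 𝒢.tgt g = x) : 𝒢.Comp (𝒢.unit x) g g := by
  subst h
  exact ⟨by rw [𝒢.src_unit], 𝒢.unit_mul g⟩

theorem comp_inv_self {g : Γ} {x : M} (h : 𝒢.src g = x) :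
    𝒢.Comp (𝒢.inv g) g (𝒢.unit x) := by
  subst h
  exact ⟨by rw [𝒢.src_inv], 𝒢.inv_mul g⟩

theorem inv_unit (x : M) : 𝒢.inv (𝒢.unit x) = 𝒢.unit x := by
  have h1 := 𝒢.inv_mul (𝒢.unit x)
  have h2 := 𝒢.mul_unit (𝒢.inv (𝒢.unit x))
  rw [𝒢.src_inv, 𝒢.tgt_unit] at h2
  rw [𝒢.src_unit] at h1
  rw [← h2, h1]

theorem inv_inv (g : Γ) : 𝒢.inv (𝒢.inv g) = g := by
  have h1 := 𝒢.mul_assoc (𝒢.inv (𝒢.inv g)) (𝒢.inv g) g (by rw [𝒢.src_inv]) (by rw [𝒢.src_inv])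
  rw [𝒢.inv_mul, 𝒢.inv_mul, 𝒢.src_inv, 𝒢.unit_mul] at h1
  have h2 := 𝒢.mul_unit (𝒢.inv (𝒢.inv g))
  rw [𝒢.src_inv, 𝒢.tgt_inv] at h2
  exact h2.symm.trans h1.symm

/-- `(h g⁻¹) g = h` for arrows `g`, `h` with the same source. -/
theorem comp_mul_inv {g h : Γ} (hs : 𝒢.src h = 𝒢.src g) :
    𝒢.Comp (𝒢.mul h (𝒢.inv g)) g h := by
  have hc : 𝒢.src h = 𝒢.tgt (𝒢.inv g) := by rw [𝒢.tgt_inv, hs]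
  refine ⟨by rw [𝒢.src_mul _ _ hc, 𝒢.src_inv], ?_⟩
  rw [𝒢.mul_assoc _ _ _ hc (𝒢.src_inv g), 𝒢.inv_mul, ← hs, 𝒢.mul_unit]

end TopGroupoid

/-- A (left) Haar system `λ = (λ^x)` on a groupoid: `λ^x` is a Radon measure with support
`Γ^x = t⁻¹(x)`, the family is left invariant, and `x ↦ ∫ f dλ^x` is continuous for
`f ∈ C_c(Γ)`. -/
structure HaarSystem {Γ M : Type*} [TopologicalSpace Γ] [TopologicalSpace M]
    [MeasurableSpace Γ] (𝒢 : TopGroupoid Γ M) where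
  meas : M → Measure Γ
  finite_on_compacts : ∀ x, IsFiniteMeasureOnCompacts (meas x)
  support_eq : ∀ x, (meas x).support = {g | 𝒢.tgt g = x}
  left_invariant : ∀ (g : Γ) (f : Γ → ℝ), Continuous f → HasCompactSupport f →
    ∫ h, f (𝒢.mul g h) ∂(meas (𝒢.src g)) = ∫ h, f h ∂(meas (𝒢.tgt g))
  continuous_integral : ∀ f : Γ → ℝ, Continuous f → HasCompactSupport f →
    Continuous fun x => ∫ h, f h ∂(meas x)

/-- `λ_x`, the image of `λ^x` under inversion; it is carried by `Γ_x = s⁻¹(x)`. -/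
noncomputable def HaarSystem.rmeas {Γ M : Type*} [TopologicalSpace Γ] [TopologicalSpace M]
    [MeasurableSpace Γ] {𝒢 : TopGroupoid Γ M} (lam : HaarSystem 𝒢) (x : M) : Measure Γ :=
  (lam.meas x).map 𝒢.inv

/-- An upper semicontinuous field of Banach spaces over `X`: a family of Banach spaces with a
topology on the total space. -/
structure USCField (X : Type*) [TopologicalSpace X] where
  fiber : X → Type*
  [normed : ∀ x, NormedAddCommGroup (fiber x)]
  [normedSpace : ∀ x, NormedSpace ℂ (fiber x)]
  [complete : ∀ x, CompleteSpace (fiber x)]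
  [top : TopologicalSpace (Bundle.TotalSpace Unit fiber)]
  /-- each fibre carries its norm topology -/
  isInducing_mk : ∀ x, IsInducing fun e : fiber x => (⟨x, e⟩ : Bundle.TotalSpace Unit fiber)
  continuous_proj : Continuous fun e : Bundle.TotalSpace Unit fiber => e.proj
  isOpenMap_proj : IsOpenMap fun e : Bundle.TotalSpace Unit fiber => e.proj
  /-- addition is continuous on the fibre product of the total space with itself -/
  continuous_add : @Continuous ((x : X) × (fiber x × fiber x)) _
    (TopologicalSpace.induced (fun z => ((⟨z.1, z.2.1⟩, ⟨z.1, z.2.2⟩) :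
      Bundle.TotalSpace Unit fiber × Bundle.TotalSpace Unit fiber)) inferInstance) top
    fun z => ⟨z.1, z.2.1 + z.2.2⟩
  continuous_smul : Continuous fun p : ℂ × Bundle.TotalSpace Unit fiber =>
    (⟨p.2.proj, p.1 • p.2.snd⟩ : Bundle.TotalSpace Unit fiber)
  norm_usc : UpperSemicontinuous fun e : Bundle.TotalSpace Unit fiber => ‖e.snd‖
  /-- if `‖e_i‖ → 0` and `π(e_i) → x` then `e_i → 0_x` -/
  tendsto_zero : ∀ x, comap (fun e : Bundle.TotalSpace Unit fiber => (e.proj, ‖e.snd‖))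
    (𝓝 x ×ˢ 𝓝 0) ≤ 𝓝 ⟨x, 0⟩
  exists_section : ∀ x (e : fiber x), ∃ ξ : ∀ y, fiber y,
    Continuous (fun y => (⟨y, ξ y⟩ : Bundle.TotalSpace Unit fiber)) ∧ ξ x = e

attribute [instance] USCField.normed USCField.normedSpace USCField.complete USCField.top

/-- The total space of a field of Banach spaces. -/
abbrev USCField.Tot {X : Type*} [TopologicalSpace X] (E : USCField X) : Type _ :=
  Bundle.TotalSpace Unit E.fiber

/-- An upper semicontinuous (saturated) Fell bundle over a groupoid.  The product
`E_g × E_h → E_k` is indexed by all `k` with `gh = k` and the involution `E_g → E_k` by all `k`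
with `g⁻¹ = k`; in this way the algebraic laws need no transport between equal fibres. -/
structure FellBundle {Γ M : Type*} [TopologicalSpace Γ] [TopologicalSpace M]
    (𝒢 : TopGroupoid Γ M) extends USCField Γ where
  mul : ∀ {g h k : Γ}, 𝒢.Comp g h k → fiber g → fiber h → fiber k
  star : ∀ {g k : Γ}, 𝒢.inv g = k → fiber g → fiber k
  mul_add : ∀ {g h k : Γ} (c : 𝒢.Comp g h k) (a : fiber g) (b b' : fiber h),
    mul c a (b + b') = mul c a b + mul c a b'
  add_mul : ∀ {g h k : Γ} (c : 𝒢.Comp g h k) (a a' : fiber g) (b : fiber h),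
    mul c (a + a') b = mul c a b + mul c a' b
  mul_smul : ∀ {g h k : Γ} (c : 𝒢.Comp g h k) (z : ℂ) (a : fiber g) (b : fiber h),
    mul c a (z • b) = z • mul c a b
  smul_mul : ∀ {g h k : Γ} (c : 𝒢.Comp g h k) (z : ℂ) (a : fiber g) (b : fiber h),
    mul c (z • a) b = z • mul c a b
  mul_assoc : ∀ {g h k gh hk ghk : Γ} (c₁ : 𝒢.Comp g h gh) (c₂ : 𝒢.Comp gh k ghk)
    (c₃ : 𝒢.Comp h k hk) (c₄ : 𝒢.Comp g hk ghk) (a : fiber g) (b : fiber h) (d : fiber k),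
    mul c₂ (mul c₁ a b) d = mul c₄ a (mul c₃ b d)
  star_add : ∀ {g k : Γ} (c : 𝒢.inv g = k) (a b : fiber g),
    star c (a + b) = star c a + star c b
  star_smul : ∀ {g k : Γ} (c : 𝒢.inv g = k) (z : ℂ) (a : fiber g),
    star c (z • a) = (starRingEnd ℂ z) • star c a
  star_star : ∀ {g k : Γ} (c : 𝒢.inv g = k) (c' : 𝒢.inv k = g) (a : fiber g),
    star c' (star c a) = a
  norm_mul_le : ∀ {g h k : Γ} (c : 𝒢.Comp g h k) (a : fiber g) (b : fiber h),
    ‖mul c a b‖ ≤ ‖a‖ * ‖b‖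
  star_mul : ∀ {g h k g' h' k' : Γ} (c : 𝒢.Comp g h k) (c' : 𝒢.Comp h' g' k')
    (hg : 𝒢.inv g = g') (hh : 𝒢.inv h = h') (hk : 𝒢.inv k = k') (a : fiber g) (b : fiber h),
    star hk (mul c a b) = mul c' (star hh b) (star hg a)
  norm_star_mul_self : ∀ {g g' : Γ} (hg : 𝒢.inv g = g') (c : 𝒢.Comp g' g (𝒢.unit (𝒢.src g)))
    (a : fiber g), ‖mul c (star hg a) a‖ = ‖a‖ ^ 2
  /-- `a* a` is a positive element `b* b` of the C⋆-algebra `E_{s(g)}` -/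
  star_mul_self_nonneg : ∀ {g g' : Γ} (hg : 𝒢.inv g = g')
    (c : 𝒢.Comp g' g (𝒢.unit (𝒢.src g))) (a : fiber g), ∃ b : fiber (𝒢.unit (𝒢.src g)),
      mul c (star hg a) a = mul (TopGroupoid.comp_unit_unit (𝒢.src g))
        (star (TopGroupoid.inv_unit (𝒢.src g)) b) b
  /-- the product is continuous on the space of pairs `(a, b) ∈ E_g × E_h`, `(g, h) ∈ Γ⁽²⁾` -/
  continuous_mul : @Continuous
    ((p : {p : Γ × Γ // 𝒢.src p.1 = 𝒢.tgt p.2}) × (fiber p.1.1 × fiber p.1.2)) _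
    (TopologicalSpace.induced (fun z => ((⟨z.1.1.1, z.2.1⟩, ⟨z.1.1.2, z.2.2⟩) :
      Bundle.TotalSpace Unit fiber × Bundle.TotalSpace Unit fiber)) inferInstance) top
    fun z => ⟨𝒢.mul z.1.1.1 z.1.1.2, mul ⟨z.1.2, rfl⟩ z.2.1 z.2.2⟩
  continuous_star : Continuous fun e : Bundle.TotalSpace Unit fiber =>
    (⟨𝒢.inv e.proj, star rfl e.snd⟩ : Bundle.TotalSpace Unit fiber)
  /-- the products span a dense subspace -/
  dense_mul : ∀ {g h k : Γ} (c : 𝒢.Comp g h k),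
    Dense (Submodule.span ℂ (range fun p : fiber g × fiber h => mul c p.1 p.2) : Set (fiber k))

/-! ### Continuity of sections of a field -/

namespace USCField

variable {X : Type*} [TopologicalSpace X] (E : USCField X) {Y : Type*} [TopologicalSpace Y]

theorem continuousAt_add {f : Y → X} {a b : ∀ y, E.fiber (f y)} {y : Y}
    (ha : ContinuousAt (fun y => (⟨f y, a y⟩ : E.Tot)) y)
    (hb : ContinuousAt (fun y => (⟨f y, b y⟩ : E.Tot)) y) :
    ContinuousAt (fun y => (⟨f y, a y + b y⟩ : E.Tot)) y := by
  let _ : TopologicalSpace ((x : X) × (E.fiber x × E.fiber x)) :=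
    TopologicalSpace.induced (fun z => ((⟨z.1, z.2.1⟩, ⟨z.1, z.2.2⟩) : E.Tot × E.Tot)) inferInstance
  have h : ContinuousAt (fun y => (⟨f y, a y, b y⟩ : (x : X) × (E.fiber x × E.fiber x))) y :=
    (IsInducing.continuousAt_iff ⟨rfl⟩).2 (ha.prodMk hb)
  exact ContinuousAt.comp (f := fun y => (⟨f y, a y, b y⟩ : (x : X) × (E.fiber x × E.fiber x)))
    E.continuous_add.continuousAt h

theorem continuousAt_smul {f : Y → X} {c : Y → ℂ} {a : ∀ y, E.fiber (f y)} {y : Y}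
    (hc : ContinuousAt c y) (ha : ContinuousAt (fun y => (⟨f y, a y⟩ : E.Tot)) y) :
    ContinuousAt (fun y => (⟨f y, c y • a y⟩ : E.Tot)) y :=
  ContinuousAt.comp (f := fun y => (c y, (⟨f y, a y⟩ : E.Tot)))
    E.continuous_smul.continuousAt (hc.prodMk ha)

theorem continuousAt_sub {f : Y → X} {a b : ∀ y, E.fiber (f y)} {y : Y}
    (ha : ContinuousAt (fun y => (⟨f y, a y⟩ : E.Tot)) y)
    (hb : ContinuousAt (fun y => (⟨f y, b y⟩ : E.Tot)) y) :
    ContinuousAt (fun y => (⟨f y, a y - b y⟩ : E.Tot)) y := by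
  simpa [sub_eq_add_neg] using
    E.continuousAt_add ha (E.continuousAt_smul (c := fun _ => (-1 : ℂ)) continuousAt_const hb)

/-- A section that is small near `y` in norm is continuous at `y` with value `0`. -/
theorem tendsto_zero_of_norm {f : Y → X} {a : ∀ y, E.fiber (f y)} {l : Filter Y} {x : X}
    (hf : Tendsto f l (𝓝 x)) (ha : Tendsto (fun y => ‖a y‖) l (𝓝 0)) :
    Tendsto (fun y => (⟨f y, a y⟩ : E.Tot)) l (𝓝 ⟨x, 0⟩) := by
  refine Tendsto.mono_right ?_ (E.tendsto_zero x)
  exact tendsto_comap_iff.2 (hf.prodMk ha)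

end USCField

namespace USCField

variable {X : Type*} [TopologicalSpace X] (E : USCField X) {Y : Type*} [TopologicalSpace Y]

/-- A section that can be approximated near `y` by sections continuous at `y` is continuous
at `y`. -/
theorem continuousAt_of_approx {f : Y → X} {a : ∀ y, E.fiber (f y)} {y : Y}
    (hf : ContinuousAt f y)
    (h : ∀ ε > 0, ∃ b : ∀ y, E.fiber (f y), ContinuousAt (fun y => (⟨f y, b y⟩ : E.Tot)) y ∧
      ∀ᶠ z in 𝓝 y, ‖a z - b z‖ < ε) :
    ContinuousAt (fun y => (⟨f y, a y⟩ : E.Tot)) y := by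
  obtain ⟨σ, hσ, hσy⟩ := E.exists_section (f y) (a y)
  have hσf : ContinuousAt (fun z => (⟨f z, σ (f z)⟩ : E.Tot)) y :=
    ContinuousAt.comp (f := f) hσ.continuousAt hf
  have key : Tendsto (fun z => ‖a z - σ (f z)‖) (𝓝 y) (𝓝 0) := by
    rw [Metric.tendsto_nhds]
    intro ε hε
    obtain ⟨b, hb, hab⟩ := h (ε / 2) (half_pos hε)
    have hbs := E.continuousAt_sub hb hσf
    have hy : ‖b y - σ (f y)‖ < ε / 2 := by
      rw [hσy, norm_sub_rev]
      exact hab.self_of_nhds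
    have h2 : ∀ᶠ z in 𝓝 y, ‖b z - σ (f z)‖ < ε / 2 := hbs.eventually (E.norm_usc _ _ hy)
    filter_upwards [hab, h2] with z h1 h2
    rw [Real.dist_eq, sub_zero, abs_of_nonneg (norm_nonneg _)]
    calc ‖a z - σ (f z)‖ = ‖(a z - b z) + (b z - σ (f z))‖ := by congr 1; abel
      _ ≤ _ := norm_add_le _ _
      _ < ε := by linarith
  have h0 : ContinuousAt (fun z => (⟨f z, a z - σ (f z)⟩ : E.Tot)) y := by
    have := E.tendsto_zero_of_norm hf key
    unfold ContinuousAt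
    simpa [hσy] using this
  simpa using E.continuousAt_add h0 hσf

theorem continuousAt_zero {f : Y → X} {y : Y} (hf : ContinuousAt f y) :
    ContinuousAt (fun y => (⟨f y, 0⟩ : E.Tot)) y :=
  E.tendsto_zero_of_norm hf (by simp)

/-- The norm of a continuous section is bounded on compact sets. -/
theorem bddAbove_norm_of_isCompact {f : Y → X} {a : ∀ y, E.fiber (f y)}
    (ha : Continuous fun y => (⟨f y, a y⟩ : E.Tot)) {K : Set Y} (hK : IsCompact K) :
    ∃ C, ∀ y ∈ K, ‖a y‖ ≤ C := by
  have hu : UpperSemicontinuous fun y => ‖a y‖ := fun y r hr =>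
    ha.continuousAt.eventually (E.norm_usc ⟨f y, a y⟩ r hr)
  obtain ⟨C, hC⟩ := (hu.upperSemicontinuousOn K).bddAbove_of_isCompact hK
  exact ⟨C, fun y hy => hC (mem_image_of_mem _ hy)⟩

end USCField

namespace FellBundle

variable {Γ M : Type*} [TopologicalSpace Γ] [TopologicalSpace M] {𝒢 : TopGroupoid Γ M}
  (E : FellBundle 𝒢)

theorem continuousAt_mul {Y : Type*} [TopologicalSpace Y] {f₁ f₂ f₃ : Y → Γ}
    {a : ∀ y, E.fiber (f₁ y)} {b : ∀ y, E.fiber (f₂ y)} {y : Y}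
    (c : ∀ y, 𝒢.Comp (f₁ y) (f₂ y) (f₃ y))
    (ha : ContinuousAt (fun y => (⟨f₁ y, a y⟩ : E.Tot)) y)
    (hb : ContinuousAt (fun y => (⟨f₂ y, b y⟩ : E.Tot)) y) :
    ContinuousAt (fun y => (⟨f₃ y, E.mul (c y) (a y) (b y)⟩ : E.Tot)) y := by
  obtain rfl : f₃ = fun y => 𝒢.mul (f₁ y) (f₂ y) := funext fun y => (c y).2.symm
  let T := (p : {p : Γ × Γ // 𝒢.src p.1 = 𝒢.tgt p.2}) × (E.fiber p.1.1 × E.fiber p.1.2)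
  let _ : TopologicalSpace T :=
    TopologicalSpace.induced (fun z => ((⟨z.1.1.1, z.2.1⟩, ⟨z.1.1.2, z.2.2⟩) : E.Tot × E.Tot))
      inferInstance
  have h : ContinuousAt (fun y => (⟨⟨(f₁ y, f₂ y), (c y).1⟩, a y, b y⟩ : T)) y :=
    (IsInducing.continuousAt_iff ⟨rfl⟩).2 (ha.prodMk hb)
  exact ContinuousAt.comp (f := fun y => (⟨⟨(f₁ y, f₂ y), (c y).1⟩, a y, b y⟩ : T))
    E.continuous_mul.continuousAt h

theorem continuousAt_star {Y : Type*} [TopologicalSpace Y] {f₁ f₂ : Y → Γ}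
    {a : ∀ y, E.fiber (f₁ y)} {y : Y} (c : ∀ y, 𝒢.inv (f₁ y) = f₂ y)
    (ha : ContinuousAt (fun y => (⟨f₁ y, a y⟩ : E.Tot)) y) :
    ContinuousAt (fun y => (⟨f₂ y, E.star (c y) (a y)⟩ : E.Tot)) y := by
  obtain rfl : f₂ = fun y => 𝒢.inv (f₁ y) := funext fun y => (c y).symm
  exact ContinuousAt.comp (f := fun y => (⟨f₁ y, a y⟩ : E.Tot))
    E.continuous_star.continuousAt ha

/-- The fibre `A_x = E_x` over a unit `x ∈ M`. -/
abbrev unitFiber (x : M) : Type _ := E.fiber (𝒢.unit x)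

/-- The fibre over a unit is a C⋆-algebra. -/
noncomputable instance instCStarUnitFiber (x : M) : NonUnitalCStarAlgebra (E.unitFiber x) where
  mul a b := E.mul (TopGroupoid.comp_unit_unit x) a b
  left_distrib a b d := E.mul_add _ a b d
  right_distrib a b d := E.add_mul _ a b d
  zero_mul a := by
    have := E.smul_mul (TopGroupoid.comp_unit_unit x) 0 (0 : E.unitFiber x) a
    rwa [zero_smul, zero_smul] at this
  mul_zero a := by
    have := E.mul_smul (TopGroupoid.comp_unit_unit x) 0 a (0 : E.unitFiber x)
    rwa [zero_smul, zero_smul] at this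
  mul_assoc a b d := E.mul_assoc _ _ _ _ a b d
  dist_eq := dist_eq_norm_neg_add
  norm_mul_le a b := E.norm_mul_le _ a b
  star a := E.star (TopGroupoid.inv_unit x) a
  star_involutive a := E.star_star _ _ a
  star_mul a b := E.star_mul _ _ _ _ _ a b
  star_add a b := E.star_add _ a b
  norm_mul_self_le a := by
    have key : ∀ y (hy : y = x) (c : 𝒢.Comp (𝒢.unit x) (𝒢.unit x) (𝒢.unit y)),
        ‖E.mul c (E.star (TopGroupoid.inv_unit x) a) a‖ = ‖a‖ ^ 2 →
        ‖a‖ * ‖a‖ ≤ ‖E.mul (TopGroupoid.comp_unit_unit x)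
          (E.star (TopGroupoid.inv_unit x) a) a‖ := by
      rintro y rfl c h
      rw [h, sq]
    have hs := 𝒢.src_unit x
    exact key _ hs (by rw [hs]; exact TopGroupoid.comp_unit_unit x)
      (E.norm_star_mul_self _ _ a)
  smul_zero := smul_zero
  smul_add := smul_add
  add_smul := add_smul
  zero_smul := zero_smul ℂ
  norm_smul_le z a := (norm_smul z a).le
  smul_assoc z a b := E.smul_mul _ z a b
  smul_comm z a b := (E.mul_smul _ z a b).symm
  star_smul z a := E.star_smul _ z a

theorem unitFiber_mul_def {x : M} (a b : E.unitFiber x) :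
    a * b = E.mul (TopGroupoid.comp_unit_unit x) a b := rfl

theorem unitFiber_star_def {x : M} (a : E.unitFiber x) :
    Star.star a = E.star (TopGroupoid.inv_unit x) a := rfl

/-- The C⋆-algebra `A = C_0(M; E)` of continuous sections over the unit space vanishing at
infinity, with pointwise operations and the supremum norm. -/
noncomputable def C0 : NonUnitalStarSubalgebra ℂ (lp E.unitFiber ∞) where
  carrier := {a | Continuous (fun x => (⟨𝒢.unit x, a x⟩ : E.Tot)) ∧
    ∀ ε > 0, ∃ K : Set M, IsCompact K ∧ ∀ x ∉ K, ‖a x‖ < ε}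
  zero_mem' := by
    refine ⟨continuous_iff_continuousAt.2 fun x =>
      E.continuousAt_zero 𝒢.continuous_unit.continuousAt, fun ε hε => ⟨∅, isCompact_empty, ?_⟩⟩
    intro x _
    simpa using hε
  add_mem' := by
    rintro a b ⟨ha, ha'⟩ ⟨hb, hb'⟩
    refine ⟨continuous_iff_continuousAt.2 fun x =>
      E.continuousAt_add ha.continuousAt hb.continuousAt, fun ε hε => ?_⟩
    obtain ⟨K, hK, hK'⟩ := ha' (ε / 2) (half_pos hε)
    obtain ⟨L, hL, hL'⟩ := hb' (ε / 2) (half_pos hε)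
    refine ⟨K ∪ L, hK.union hL, fun x hx => ?_⟩
    rw [mem_union, not_or] at hx
    calc ‖a x + b x‖ ≤ ‖a x‖ + ‖b x‖ := norm_add_le _ _
      _ < ε := by linarith [hK' x hx.1, hL' x hx.2]
  mul_mem' := by
    rintro a b ⟨ha, ha'⟩ ⟨hb, hb'⟩
    refine ⟨continuous_iff_continuousAt.2 fun x =>
      E.continuousAt_mul (fun _ => TopGroupoid.comp_unit_unit _) ha.continuousAt hb.continuousAt,
      fun ε hε => ?_⟩
    obtain ⟨K, hK, hK'⟩ := ha' (ε / (‖b‖ + 1)) (by positivity)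
    refine ⟨K, hK, fun x hx => ?_⟩
    calc ‖a x * b x‖ ≤ ‖a x‖ * ‖b x‖ := _root_.norm_mul_le _ _
      _ ≤ ‖a x‖ * (‖b‖ + 1) := by
        gcongr
        exact (lp.norm_apply_le_norm ENNReal.top_ne_zero b x).trans (by linarith)
      _ < ε := by
        have := hK' x hx
        rwa [lt_div_iff₀ (by positivity)] at this
  smul_mem' := by
    rintro z a ⟨ha, ha'⟩
    refine ⟨continuous_iff_continuousAt.2 fun x =>
      E.continuousAt_smul (c := fun _ => z) continuousAt_const ha.continuousAt, fun ε hε => ?_⟩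
    obtain ⟨K, hK, hK'⟩ := ha' (ε / (‖z‖ + 1)) (by positivity)
    refine ⟨K, hK, fun x hx => ?_⟩
    calc ‖z • a x‖ = ‖z‖ * ‖a x‖ := norm_smul _ _
      _ ≤ (‖z‖ + 1) * ‖a x‖ := by gcongr; linarith
      _ < ε := by
        have := hK' x hx
        rwa [lt_div_iff₀ (by positivity), mul_comm] at this
  star_mem' := by
    rintro a ⟨ha, ha'⟩
    refine ⟨continuous_iff_continuousAt.2 fun x =>
      E.continuousAt_star (fun _ => TopGroupoid.inv_unit _) ha.continuousAt, fun ε hε => ?_⟩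
    obtain ⟨K, hK, hK'⟩ := ha' ε hε
    refine ⟨K, hK, fun x hx => ?_⟩
    calc ‖Star.star (a x)‖ = ‖a x‖ := norm_star _
      _ < ε := hK' x hx

instance isClosed_C0 : IsClosed (E.C0 : Set (lp E.unitFiber ∞)) := by
  refine isClosed_of_closure_subset fun a ha => ?_
  rw [Metric.mem_closure_iff] at ha
  have hnorm : ∀ b : lp E.unitFiber ∞, ∀ x, ‖a x - b x‖ ≤ dist a b := fun b x => by
    rw [dist_eq_norm]
    exact lp.norm_apply_le_norm ENNReal.top_ne_zero (a - b) x
  constructor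
  · refine continuous_iff_continuousAt.2 fun x =>
      E.continuousAt_of_approx 𝒢.continuous_unit.continuousAt fun ε hε => ?_
    obtain ⟨b, hb, hab⟩ := ha ε hε
    exact ⟨fun x => b x, hb.1.continuousAt, Eventually.of_forall fun z => (hnorm b z).trans_lt hab⟩
  · intro ε hε
    obtain ⟨b, hb, hab⟩ := ha (ε / 2) (half_pos hε)
    obtain ⟨K, hK, hK'⟩ := hb.2 (ε / 2) (half_pos hε)
    refine ⟨K, hK, fun x hx => ?_⟩
    calc ‖a x‖ = ‖(a x - b x) + b x‖ := by simp
      _ ≤ ‖a x - b x‖ + ‖b x‖ := norm_add_le _ _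
      _ < ε := by linarith [hnorm b x, hK' x hx]

/-- The C⋆-algebra `A = C_0(M; E)`. -/
def A : Type _ := E.C0

noncomputable instance : NonUnitalCStarAlgebra E.A := inferInstanceAs (NonUnitalCStarAlgebra E.C0)

/-- The value of `a ∈ A` at `x ∈ M`. -/
instance : CoeFun E.A fun _ => ∀ x, E.unitFiber x := ⟨fun a x => a.1 x⟩

variable {E} in
theorem A_ext {a b : E.A} (h : ∀ x, a x = b x) : a = b :=
  Subtype.ext (lp.ext (funext h))

variable {E} in
theorem A_continuous (a : E.A) : Continuous fun x => (⟨𝒢.unit x, a x⟩ : E.Tot) := a.2.1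

/-- The opposite `Aᵐᵒᵖ` of `A = C_0(M; E)`.  Mathlib's Hilbert C⋆-modules `CStarModule B X` are left
modules; right Hilbert `A`-modules are therefore given by `CStarModule Aᵐᵒᵖ X`, with
`ξ · a = op a • ξ` and `⟨ξ, η⟩ = unop (inner Aᵐᵒᵖ ξ η)`. -/
abbrev Aop : Type _ := E.Aᵐᵒᵖ

noncomputable instance : PartialOrder E.Aop := CStarAlgebra.spectralOrder E.Aop

instance : StarOrderedRing E.Aop := CStarAlgebra.spectralOrderedRing E.Aop

end FellBundle

/-- A self-adjoint element is the difference of two orthogonal positive elements. -/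
theorem exists_posPart_negPart {B : Type*} [NonUnitalCStarAlgebra B] (a : B)
    (ha : IsSelfAdjoint a) : ∃ d e : B, a = star d * d - star e * e ∧
      (star e * e) * (star d * d) = 0 := by
  let _ : PartialOrder B := CStarAlgebra.spectralOrder B
  have _ : StarOrderedRing B := CStarAlgebra.spectralOrderedRing B
  obtain ⟨d, hd⟩ := CStarAlgebra.nonneg_iff_eq_star_mul_self.1 (CFC.posPart_nonneg a)
  obtain ⟨e, he⟩ := CStarAlgebra.nonneg_iff_eq_star_mul_self.1 (CFC.negPart_nonneg a)
  refine ⟨d, e, ?_, ?_⟩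
  · rw [← hd, ← he, CFC.posPart_sub_negPart a ha]
  · rw [← hd, ← he, CFC.negPart_mul_posPart]

/-! ### Completing a module with a `B`-valued semi-inner product -/

/-- A `B`-valued semi-inner product on a complex vector space `V` with an action of the
C⋆-algebra `B` (in the conventions of `CStarModule`). -/
structure SemiInner (B V : Type*) [NonUnitalCStarAlgebra B] [PartialOrder B] [AddCommGroup V]
    [Module ℂ V] where
  act : B → V → V
  act_sub : ∀ b v w, act b (v - w) = act b v - act b w
  form : V → V → B
  form_add_right : ∀ u v w, form u (v + w) = form u v + form u w
  form_self_nonneg : ∀ v, 0 ≤ form v v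
  form_act_right : ∀ b v w, form v (act b w) = b * form v w
  form_smul_right : ∀ (z : ℂ) v w, form v (z • w) = z • form v w
  star_form : ∀ v w, star (form v w) = form w v

namespace SemiInner

variable {B V : Type*} [NonUnitalCStarAlgebra B] [PartialOrder B] [AddCommGroup V]
  [Module ℂ V] (P : SemiInner B V)

theorem form_add_left (u v w : V) : P.form (u + v) w = P.form u w + P.form v w := by
  rw [← P.star_form w (u + v), P.form_add_right, star_add, P.star_form, P.star_form]

theorem form_act_left (b : B) (v w : V) : P.form (P.act b v) w = P.form v w * star b := by
  rw [← P.star_form w (P.act b v), P.form_act_right, star_mul, P.star_form]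

theorem form_smul_left (z : ℂ) (v w : V) : P.form (z • v) w = star z • P.form v w := by
  rw [← P.star_form w (z • v), P.form_smul_right, star_smul, P.star_form]

/-- The semi-inner product as a sesquilinear map. -/
def sesq : V →ₗ⋆[ℂ] V →ₗ[ℂ] B where
  toFun v :=
    { toFun := fun w => P.form v w
      map_add' := P.form_add_right v
      map_smul' := fun z w => P.form_smul_right z v w }
  map_add' u v := by ext w; exact P.form_add_left u v w
  map_smul' z v := by ext w; exact P.form_smul_left z v w

theorem sesq_apply (v w : V) : P.sesq v w = P.form v w := rfl

theorem form_sub_right (u v w : V) : P.form u (v - w) = P.form u v - P.form u w :=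
  map_sub (P.sesq u) v w

theorem form_sub_left (u v w : V) : P.form (u - v) w = P.form u w - P.form v w := by
  simp only [← sesq_apply, map_sub, LinearMap.sub_apply]

variable [StarOrderedRing B]

theorem norm_form_sq_le (v w : V) :
    ‖P.form v w‖ ^ 2 ≤ ‖P.form v v‖ * ‖P.form w w‖ := by
  have key : ∀ c : ℝ, ‖P.form v v‖ < c → ‖P.form v w‖ ^ 2 ≤ c * ‖P.form w w‖ := by
    intro c hc
    have hc0 : 0 < c := (norm_nonneg _).trans_lt hc
    set a := P.form v w with ha
    have ha' : P.form w v = star a := (P.star_form v w).symm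
    have h := P.form_self_nonneg (P.act a v - (c : ℂ) • w)
    rw [P.form_sub_right, P.form_sub_left, P.form_sub_left, P.form_act_right,
      P.form_act_right, P.form_act_left, P.form_smul_left, P.form_act_left,
      P.form_smul_right, P.form_smul_right, P.form_smul_left, ha', ← ha] at h
    have hcc : (star (c : ℂ)) = (c : ℂ) := Complex.conj_ofReal c
    rw [hcc] at h
    have h1 : a * (P.form v v * star a) ≤ c • (a * star a) := by
      calc a * (P.form v v * star a) = a * P.form v v * star a := (_root_.mul_assoc _ _ _).symm
        _ ≤ ‖P.form v v‖ • (a * star a) := CStarAlgebra.star_right_conjugate_le_norm_smul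
              (hb := IsSelfAdjoint.of_nonneg (P.form_self_nonneg v))
        _ ≤ c • (a * star a) := by
              exact smul_le_smul_of_nonneg_right hc.le (mul_star_self_nonneg a)
    have e1 : ∀ b : B, (c : ℂ) • b = c • b := fun b => (RCLike.real_smul_eq_coe_smul c b).symm
    have h2 : 0 ≤ c • (c • P.form w w - a * star a) := by
      refine h.trans ?_
      simp only [e1, mul_smul_comm, smul_mul_assoc, smul_sub]
      have := sub_le_sub_right h1 (c • (a * star a))
      calc _ = (a * (P.form v v * star a) - c • (a * star a))
            + (c • c • P.form w w - c • (a * star a)) := by abel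
        _ ≤ (c • (a * star a) - c • (a * star a))
            + (c • c • P.form w w - c • (a * star a)) := by gcongr
        _ = _ := by abel
    have h3 : a * star a ≤ c • P.form w w := by
      rw [← sub_nonneg]
      have := smul_nonneg (inv_nonneg.2 hc0.le) h2
      rwa [smul_smul, inv_mul_cancel₀ hc0.ne', one_smul] at this
    have h4 := CStarAlgebra.norm_le_norm_of_nonneg_of_le (mul_star_self_nonneg a) h3
    rw [CStarRing.norm_self_mul_star, norm_smul, Real.norm_of_nonneg hc0.le] at h4
    rwa [sq]
  refine le_of_forall_pos_le_add fun ε hε => ?_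
  have h := key (‖P.form v v‖ + ε / (‖P.form w w‖ + 1)) (by
    have : 0 < ε / (‖P.form w w‖ + 1) := by positivity
    linarith)
  refine h.trans ?_
  rw [add_mul]
  gcongr
  rw [div_mul_eq_mul_div, div_le_iff₀ (by positivity)]
  nlinarith [norm_nonneg (P.form w w)]

/-- The seminorm `‖v‖ = ‖⟨v, v⟩‖^{1/2}`. -/
noncomputable def nrm (v : V) : ℝ := √‖P.form v v‖

theorem nrm_nonneg (v : V) : 0 ≤ P.nrm v := Real.sqrt_nonneg _

theorem nrm_sq (v : V) : P.nrm v ^ 2 = ‖P.form v v‖ := Real.sq_sqrt (norm_nonneg _)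

theorem norm_form_le (v w : V) : ‖P.form v w‖ ≤ P.nrm v * P.nrm w := by
  rw [nrm, nrm, ← Real.sqrt_mul (norm_nonneg _)]
  exact Real.le_sqrt_of_sq_le (P.norm_form_sq_le v w)

theorem nrm_smul (z : ℂ) (v : V) : P.nrm (z • v) = ‖z‖ * P.nrm v := by
  rw [nrm, nrm, P.form_smul_right, P.form_smul_left, norm_smul, norm_smul, norm_star, ← mul_assoc,
    Real.sqrt_mul (by positivity), Real.sqrt_mul_self (norm_nonneg _)]

theorem nrm_add_le (v w : V) : P.nrm (v + w) ≤ P.nrm v + P.nrm w := by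
  refine abs_le_of_sq_le_sq' ?_ (add_nonneg (P.nrm_nonneg v) (P.nrm_nonneg w)) |>.2
  rw [nrm_sq]
  have e : P.form (v + w) (v + w)
      = P.form v v + P.form v w + (P.form w v + P.form w w) := by
    rw [P.form_add_left, P.form_add_right, P.form_add_right]
  calc ‖P.form (v + w) (v + w)‖
      ≤ (‖P.form v v‖ + ‖P.form v w‖) + (‖P.form w v‖ + ‖P.form w w‖) := by
        rw [e]
        exact (norm_add_le _ _).trans (add_le_add (norm_add_le _ _) (norm_add_le _ _))
    _ ≤ (P.nrm v ^ 2 + P.nrm v * P.nrm w) + (P.nrm w * P.nrm v + P.nrm w ^ 2) := by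
        rw [nrm_sq, nrm_sq]
        gcongr
        · exact P.norm_form_le v w
        · exact P.norm_form_le w v
    _ = (P.nrm v + P.nrm w) ^ 2 := by ring

theorem nrm_act_le (b : B) (v : V) : P.nrm (P.act b v) ≤ ‖b‖ * P.nrm v := by
  refine abs_le_of_sq_le_sq' ?_ (mul_nonneg (norm_nonneg b) (P.nrm_nonneg v)) |>.2
  rw [nrm_sq, P.form_act_right, P.form_act_left, mul_pow, nrm_sq]
  calc _ ≤ ‖b‖ * (‖P.form v v‖ * ‖star b‖) := by
        refine (norm_mul_le _ _).trans ?_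
        gcongr
        exact norm_mul_le _ _
    _ = _ := by rw [norm_star]; ring

/-- The vector space `V` carrying the seminorm `‖v‖ = ‖⟨v, v⟩‖^{1/2}`. -/
def Pre (_P : SemiInner B V) : Type _ := V

instance : AddCommGroup P.Pre := inferInstanceAs (AddCommGroup V)
instance : Module ℂ P.Pre := inferInstanceAs (Module ℂ V)
instance : SMul B P.Pre := ⟨P.act⟩
instance : Inner B P.Pre := ⟨P.form⟩
noncomputable instance : Norm P.Pre := ⟨P.nrm⟩

theorem seminormedCore : SeminormedSpace.Core ℂ P.Pre where
  norm_nonneg v := P.nrm_nonneg v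
  norm_smul z v := P.nrm_smul z v
  norm_triangle v w := P.nrm_add_le v w

noncomputable instance : SeminormedAddCommGroup P.Pre := SeminormedAddCommGroup.ofCore P.seminormedCore

noncomputable instance : NormedSpace ℂ P.Pre where
  norm_smul_le z v := (P.seminormedCore.norm_smul z v).le

instance : UniformContinuousConstSMul B P.Pre where
  uniformContinuous_const_smul b := by
    refine (LipschitzWith.of_dist_le_mul (K := ‖b‖₊) fun v w => ?_).uniformContinuous
    rw [dist_eq_norm, dist_eq_norm]
    have : b • v - b • w = b • (v - w) := (P.act_sub b v w).symm
    rw [this]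
    exact P.nrm_act_le b _

theorem continuous_pre_inner : Continuous fun p : P.Pre × P.Pre => inner B p.1 p.2 := by
  let f : P.Pre →L⋆[ℂ] P.Pre →L[ℂ] B :=
    LinearMap.mkContinuous₂ (show P.Pre →ₗ⋆[ℂ] P.Pre →ₗ[ℂ] B from P.sesq) 1 fun v w =>
      (P.norm_form_le v w).trans_eq (by rw [one_mul]; rfl)
  have : Continuous fun p : P.Pre × P.Pre => f p.1 p.2 := by fun_prop
  exact this

/-- The Banach space obtained by completing `V` with respect to its semi-inner product. -/
abbrev Cpl : Type _ := UniformSpace.Completion P.Pre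

open UniformSpace Completion

theorem hilb_inner_coe (v w : P.Pre) : inner B (v : P.Cpl) (w : P.Cpl) = inner B v w :=
  (isDenseInducing_coe.prodMap isDenseInducing_coe).extend_eq P.continuous_pre_inner (v, w)

theorem hilb_continuous_inner : Continuous fun p : P.Cpl × P.Cpl => inner B p.1 p.2 := by
  let inner' : P.Pre →+ P.Pre →+ B :=
    { toFun := fun x => (P.sesq x).toAddMonoidHom
      map_zero' := by ext x; exact congrArg (fun f => f x) (map_zero P.sesq)
      map_add' := fun x y => by ext z; exact P.form_add_left x y z }
  have : Continuous fun p : P.Pre × P.Pre => inner' p.1 p.2 := P.continuous_pre_inner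
  exact (isDenseInducing_toCompl P.Pre).extend_Z_bilin (isDenseInducing_toCompl P.Pre) this

theorem hilb_continuous_inner' {Y : Type*} [TopologicalSpace Y] {f g : Y → P.Cpl}
    (hf : Continuous f) (hg : Continuous g) : Continuous fun y => inner B (f y) (g y) :=
  P.hilb_continuous_inner.comp (hf.prodMk hg)

theorem hilb_norm (x : P.Cpl) : ‖x‖ = √‖inner B x x‖ := by
  refine Completion.induction_on x (isClosed_eq continuous_norm
    (P.hilb_continuous_inner' continuous_id continuous_id).norm.sqrt) fun v => ?_
  rw [norm_coe, P.hilb_inner_coe]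
  rfl

noncomputable instance : CStarModule B P.Cpl where
  inner_add_right {x y z} := by
    refine Completion.induction_on₃ x y z (isClosed_eq ?_ ?_) fun u v w => ?_
    · exact P.hilb_continuous_inner' (by fun_prop) (by fun_prop)
    · exact (P.hilb_continuous_inner' (by fun_prop) (by fun_prop)).add
        (P.hilb_continuous_inner' (by fun_prop) (by fun_prop))
    · rw [← coe_add, P.hilb_inner_coe, P.hilb_inner_coe, P.hilb_inner_coe]
      exact P.form_add_right u v w
  inner_self_nonneg {x} := by
    refine Completion.induction_on x (isClosed_Ici.preimage
      (P.hilb_continuous_inner' continuous_id continuous_id)) fun v => ?_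
    change 0 ≤ inner B (v : P.Cpl) (v : P.Cpl)
    rw [P.hilb_inner_coe]
    exact P.form_self_nonneg v
  inner_self {x} := by
    refine ⟨fun h => ?_, fun h => ?_⟩
    · rw [← norm_eq_zero, P.hilb_norm, h, norm_zero, Real.sqrt_zero]
    · have := P.hilb_norm x
      rw [h, norm_zero, eq_comm, Real.sqrt_eq_zero (norm_nonneg _), norm_eq_zero] at this
      rw [h, this]
  inner_op_smul_right {b x y} := by
    refine Completion.induction_on₂ x y (isClosed_eq ?_ ?_) fun v w => ?_
    · exact P.hilb_continuous_inner' (by fun_prop) (continuous_snd.const_smul b)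
    · exact continuous_const.mul (P.hilb_continuous_inner' (by fun_prop) (by fun_prop))
    · rw [← coe_smul, P.hilb_inner_coe, P.hilb_inner_coe]
      exact P.form_act_right b v w
  inner_smul_right_complex {z x y} := by
    refine Completion.induction_on₂ x y (isClosed_eq ?_ ?_) fun v w => ?_
    · exact P.hilb_continuous_inner' (by fun_prop) (continuous_snd.const_smul z)
    · exact (P.hilb_continuous_inner' (by fun_prop) (by fun_prop)).const_smul z
    · rw [← coe_smul, P.hilb_inner_coe, P.hilb_inner_coe]
      exact P.form_smul_right z v w
  star_inner x y := by
    refine Completion.induction_on₂ x y (isClosed_eq ?_ ?_) fun v w => ?_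
    · exact (P.hilb_continuous_inner' (by fun_prop) (by fun_prop)).star
    · exact P.hilb_continuous_inner' (by fun_prop) (by fun_prop)
    · rw [P.hilb_inner_coe, P.hilb_inner_coe]
      exact P.star_form v w
  norm_eq_sqrt_norm_inner_self x := P.hilb_norm x

/-- The Hilbert module obtained by completing `V` with respect to its semi-inner product. -/
def Hilb : Type _ := P.Cpl

noncomputable instance : NormedAddCommGroup P.Hilb := inferInstanceAs (NormedAddCommGroup P.Cpl)
noncomputable instance : NormedSpace ℂ P.Hilb := inferInstanceAs (NormedSpace ℂ P.Cpl)
instance : CompleteSpace P.Hilb := inferInstanceAs (CompleteSpace P.Cpl)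
noncomputable instance : SMul B P.Hilb := inferInstanceAs (SMul B P.Cpl)
noncomputable instance : CStarModule B P.Hilb := inferInstanceAs (CStarModule B P.Cpl)

/-- The canonical map from `V` to its completion. -/
noncomputable def toHilb (v : V) : P.Hilb := ((show P.Pre from v) : P.Cpl)

theorem inner_toHilb (v w : V) : inner B (P.toHilb v) (P.toHilb w) = P.form v w :=
  P.hilb_inner_coe v w

theorem denseRange_toHilb : DenseRange P.toHilb :=
  denseRange_coe (α := P.Pre)

end SemiInner

/-! ### Integration of sections along the fibres of the source map -/

section Haar

variable {Γ M : Type*} [TopologicalSpace Γ] [TopologicalSpace M] {𝒢 : TopGroupoid Γ M}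
  [T2Space Γ] [LocallyCompactSpace Γ] [SecondCountableTopology Γ] [MeasurableSpace Γ]
  [BorelSpace Γ]

theorem TopGroupoid.t2Space_units (𝒢 : TopGroupoid Γ M) : T2Space M :=
  T2Space.of_injective_continuous (f := 𝒢.unit)
    (fun x y h => by rw [← 𝒢.src_unit x, ← 𝒢.src_unit y, h]) 𝒢.continuous_unit

theorem TopGroupoid.isClosed_src (𝒢 : TopGroupoid Γ M) (x : M) : IsClosed {g | 𝒢.src g = x} :=
  have := 𝒢.t2Space_units
  isClosed_singleton.preimage 𝒢.continuous_src

namespace HaarSystem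

variable (lam : HaarSystem 𝒢)

theorem rmeas_compl (x : M) : lam.rmeas x {g | 𝒢.src g = x}ᶜ = 0 := by
  rw [rmeas, Measure.map_apply 𝒢.continuous_inv.measurable (𝒢.isClosed_src x).measurableSet.compl]
  have : 𝒢.inv ⁻¹' {g | 𝒢.src g = x}ᶜ = (lam.meas x).supportᶜ := by
    rw [lam.support_eq]
    ext g
    simp [𝒢.src_inv]
  rw [this]
  exact Measure.measure_compl_support

theorem rmeas_lt_top (x : M) {K : Set Γ} (hK : IsCompact K) : lam.rmeas x K < ⊤ := by
  rw [rmeas, Measure.map_apply 𝒢.continuous_inv.measurable hK.measurableSet]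
  have : 𝒢.inv ⁻¹' K = 𝒢.inv '' K := by
    ext g
    constructor
    · intro h
      exact ⟨_, h, 𝒢.inv_inv g⟩
    · rintro ⟨h, hh, rfl⟩
      simpa [𝒢.inv_inv h] using hh
  rw [this]
  have := lam.finite_on_compacts x
  exact (hK.image 𝒢.continuous_inv).measure_lt_top

theorem continuous_integral_rmeas {f : Γ → ℝ} (hf : Continuous f) (hc : HasCompactSupport f) :
    Continuous fun x => ∫ g, f g ∂(lam.rmeas x) := by
  have h : ∀ x, ∫ g, f g ∂(lam.rmeas x) = ∫ g, f (𝒢.inv g) ∂(lam.meas x) := fun x =>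
    integral_map 𝒢.continuous_inv.aemeasurable hf.aestronglyMeasurable
  simp_rw [h]
  let e : Γ ≃ₜ Γ :=
    { toFun := 𝒢.inv, invFun := 𝒢.inv, left_inv := 𝒢.inv_inv, right_inv := 𝒢.inv_inv
      continuous_toFun := 𝒢.continuous_inv, continuous_invFun := 𝒢.continuous_inv }
  exact lam.continuous_integral _ (hf.comp 𝒢.continuous_inv) (hc.comp_homeomorph e)

theorem integrable_rmeas {f : Γ → ℝ} (hf : Continuous f) (hc : HasCompactSupport f) (x : M) :
    Integrable f (lam.rmeas x) := by
  have : IsFiniteMeasureOnCompacts (lam.rmeas x) := ⟨fun _ hK => lam.rmeas_lt_top x hK⟩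
  exact hf.integrable_of_hasCompactSupport hc

end HaarSystem

namespace FellBundle

variable (E : FellBundle 𝒢) (lam : HaarSystem 𝒢)

open Classical in
/-- The function on `Γ` equal to `k` on `Γ_x = s⁻¹(x)` and to `0` elsewhere. -/
noncomputable def extend (x : M) (k : ∀ g, 𝒢.src g = x → E.unitFiber x) (g : Γ) : E.unitFiber x :=
  if h : 𝒢.src g = x then k g h else 0

/-- The integral `∫_{Γ_x} k(g) λ_x(dg)` of an `A_x`-valued function on `Γ_x`. -/
noncomputable def sliceIntegral (x : M) (k : ∀ g, 𝒢.src g = x → E.unitFiber x) : E.unitFiber x :=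
  ∫ g, E.extend x k g ∂(lam.rmeas x)

/-- A family `k` of functions on the `Γ_x` that forms a compactly supported continuous section
of `s^* A` over `Γ`. -/
structure IsCcFamily (k : ∀ x g, 𝒢.src g = x → E.unitFiber x) (K : Set Γ) : Prop where
  isCompact : IsCompact K
  eq_zero : ∀ x g h, g ∉ K → k x g h = 0
  continuous : Continuous fun g => (⟨𝒢.unit (𝒢.src g), k (𝒢.src g) g rfl⟩ : E.Tot)

variable {E} {k : ∀ x g, 𝒢.src g = x → E.unitFiber x} {K : Set Γ}

theorem IsCcFamily.integrable (hk : E.IsCcFamily k K) (x : M) :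
    Integrable (E.extend x (k x)) (lam.rmeas x) := by
  have hcl := 𝒢.isClosed_src x
  have hcont : ContinuousOn (E.extend x (k x)) {g | 𝒢.src g = x} := by
    rw [continuousOn_iff_continuous_domRestrict, (E.isInducing_mk (𝒢.unit x)).continuous_iff]
    have e : ((fun e : E.unitFiber x => (⟨𝒢.unit x, e⟩ : E.Tot)) ∘
        ({g | 𝒢.src g = x}.domRestrict (E.extend x (k x))))
        = fun g : {g | 𝒢.src g = x} =>
          (⟨𝒢.unit (𝒢.src g.1), k (𝒢.src g.1) g.1 rfl⟩ : E.Tot) := by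
      funext ⟨g, hg⟩
      obtain rfl : 𝒢.src g = x := hg
      simp [extend, Set.domRestrict]
    rw [e]
    exact hk.continuous.comp continuous_subtype_val
  have hm : AEStronglyMeasurable (E.extend x (k x)) (lam.rmeas x) := by
    have := hcont.aestronglyMeasurable (μ := lam.rmeas x) hcl.measurableSet
    rwa [Measure.restrict_eq_self_of_ae_mem] at this
    exact lam.rmeas_compl x
  obtain ⟨C, hC⟩ := E.bddAbove_norm_of_isCompact hk.continuous hk.isCompact
  have hsupp : Function.support (E.extend x (k x)) ⊆ K := by
    intro g hg
    by_contra hgK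
    refine hg ?_
    unfold extend
    split_ifs with h
    · exact hk.eq_zero x g h hgK
    · rfl
  rw [← integrableOn_iff_integrable_of_support_subset hsupp]
  refine Measure.integrableOn_of_bounded (M := max C 0) (lam.rmeas_lt_top x hk.isCompact).ne hm ?_
  refine (ae_restrict_iff' hk.isCompact.measurableSet).2 (Eventually.of_forall fun g hg => ?_)
  unfold extend
  split_ifs with h
  · subst h
    exact (hC g hg).trans (le_max_left _ _)
  · simp

/-- Approximation of a compactly supported continuous section of `s^* A` by finite sums of
products of scalar functions on `Γ` and sections of `A`. -/
theorem IsCcFamily.exists_approx (hk : E.IsCcFamily k K) :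
    ∃ χ : Γ → ℝ, Continuous χ ∧ HasCompactSupport χ ∧ (∀ g, 0 ≤ χ g) ∧
    ∀ ε > 0, ∃ (n : ℕ) (f : Fin n → Γ → ℝ) (a : Fin n → ∀ x, E.unitFiber x),
      (∀ i, Continuous (f i)) ∧ (∀ i, HasCompactSupport (f i)) ∧
      (∀ i, Continuous fun x => (⟨𝒢.unit x, a i x⟩ : E.Tot)) ∧
      ∀ x g h, ‖k x g h - ∑ i, (f i g : ℂ) • a i x‖ ≤ ε * χ g := by
  obtain ⟨χ, hχ1, hχc, hχ01⟩ : ∃ χ : C(Γ, ℝ), EqOn χ 1 K ∧ HasCompactSupport χ ∧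
      ∀ g, χ g ∈ Icc (0 : ℝ) 1 := by
    obtain ⟨χ, h1, _, h3, h4⟩ := exists_continuous_one_zero_of_isCompact hk.isCompact
      (isClosed_empty (X := Γ)) (disjoint_empty K)
    exact ⟨χ, h1, h3, h4⟩
  refine ⟨χ, χ.continuous, hχc, fun g => (hχ01 g).1, fun ε hε => ?_⟩
  have hloc : ∀ g₀ : Γ, ∃ a : ∀ x, E.unitFiber x,
      (Continuous fun x => (⟨𝒢.unit x, a x⟩ : E.Tot)) ∧
      ∃ U : Set Γ, IsOpen U ∧ g₀ ∈ U ∧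
        ∀ g ∈ U, ‖k (𝒢.src g) g rfl - a (𝒢.src g)‖ < ε := by
    intro g₀
    obtain ⟨σ, hσ, hσ0⟩ := E.exists_section (𝒢.unit (𝒢.src g₀)) (k (𝒢.src g₀) g₀ rfl)
    refine ⟨fun x => σ (𝒢.unit x), hσ.comp 𝒢.continuous_unit, ?_⟩
    have hc : ContinuousAt (fun g => (⟨𝒢.unit (𝒢.src g),
        k (𝒢.src g) g rfl - σ (𝒢.unit (𝒢.src g))⟩ : E.Tot)) g₀ :=
      E.continuousAt_sub (f := fun g => 𝒢.unit (𝒢.src g)) hk.continuous.continuousAt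
        (hσ.comp (𝒢.continuous_unit.comp 𝒢.continuous_src)).continuousAt
    have h0 : ‖k (𝒢.src g₀) g₀ rfl - σ (𝒢.unit (𝒢.src g₀))‖ < ε := by
      rw [hσ0, sub_self, norm_zero]; exact hε
    have := hc.eventually (E.norm_usc _ _ h0)
    obtain ⟨U, hU, hUo, hgU⟩ := eventually_nhds_iff.1 this
    exact ⟨U, hUo, hgU, fun g hg => hU g hg⟩
  choose a ha U hUo hgU hU using hloc
  obtain ⟨t, ht⟩ := hk.isCompact.elim_finite_subcover U hUo
    fun g _ => mem_iUnion.2 ⟨g, hgU g⟩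
  let e := t.equivFin.symm
  have hcov : K ⊆ ⋃ i : Fin t.card, U (e i) := by
    intro g hg
    obtain ⟨g₀, hg₀, hgU⟩ := mem_iUnion₂.1 (ht hg)
    exact mem_iUnion.2 ⟨t.equivFin ⟨g₀, hg₀⟩, by simpa [e] using hgU⟩
  obtain ⟨f, hfs, hf1, hf01, hfc⟩ := exists_continuous_sum_one_of_isOpen_isCompact
    (fun i : Fin t.card => hUo (e i)) hk.isCompact hcov
  let S : Γ → ℝ := fun g => max 1 (∑ i, f i g)
  have hS : Continuous S := by fun_prop
  have hS1 : ∀ g, 1 ≤ S g := fun g => le_max_left _ _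
  let φ : Fin t.card → Γ → ℝ := fun i g => f i g / S g * χ g
  have hφ0 : ∀ i g, 0 ≤ φ i g := fun i g =>
    mul_nonneg (div_nonneg (hf01 i g).1 (zero_le_one.trans (hS1 g))) (hχ01 g).1
  refine ⟨t.card, φ, fun i => a (e i), fun i => ?_, fun i => ?_, fun i => ha _, ?_⟩
  · exact ((f i).continuous.div hS fun g => (zero_lt_one.trans_le (hS1 g)).ne').mul χ.continuous
  · exact hχc.mul_left
  rintro x g rfl
  have hsum : ∑ i, φ i g ≤ χ g := by
    have : ∑ i, φ i g = (∑ i, f i g) / S g * χ g := by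
      simp only [φ, Finset.sum_div, Finset.sum_mul]
    rw [this]
    refine mul_le_of_le_one_left (hχ01 g).1 ?_
    exact div_le_one_of_le₀ (le_max_right _ _) (zero_le_one.trans (hS1 g))
  have hK : k (𝒢.src g) g rfl = ∑ i, (φ i g : ℂ) • k (𝒢.src g) g rfl := by
    by_cases hg : g ∈ K
    · rw [← Finset.sum_smul]
      have h1 : ∑ i, f i g = 1 := by simpa using hf1 hg
      have : ∑ i, φ i g = 1 := by
        have h2 : ∑ i, φ i g = (∑ i, f i g) / S g * χ g := by
          simp only [φ, Finset.sum_div, Finset.sum_mul]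
        rw [h2, h1, hχ1 hg]
        simp [S, h1]
      rw [← Complex.ofReal_sum, this]
      simp
    · rw [hk.eq_zero _ g rfl hg]
      simp
  calc ‖k (𝒢.src g) g rfl - ∑ i, (φ i g : ℂ) • a (e i) (𝒢.src g)‖
      = ‖∑ i, (φ i g : ℂ) • (k (𝒢.src g) g rfl - a (e i) (𝒢.src g))‖ := by
        simp only [smul_sub, Finset.sum_sub_distrib]
        rw [← hK]
    _ ≤ ∑ i, φ i g * ε := by
        refine (norm_sum_le _ _).trans (Finset.sum_le_sum fun i _ => ?_)
        rw [norm_smul, Complex.norm_real, Real.norm_of_nonneg (hφ0 i g)]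
        by_cases hi : g ∈ U (e i)
        · exact mul_le_mul_of_nonneg_left (hU (e i) g hi).le (hφ0 i g)
        · have : f i g = 0 := by
            by_contra h
            exact hi (hfs i (subset_tsupport _ h))
          simp [φ, this]
    _ = ε * ∑ i, φ i g := by rw [← Finset.sum_mul, mul_comm]
    _ ≤ ε * χ g := by gcongr

/-- Integration of a compactly supported continuous section along `Γ_x` gives a continuous
section over the unit space. -/
theorem IsCcFamily.continuous_sliceIntegral (hk : E.IsCcFamily k K) :
    Continuous fun x => (⟨𝒢.unit x, E.sliceIntegral lam x (k x)⟩ : E.Tot) := by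
  obtain ⟨χ, hχ, hχc, hχ0, happ⟩ := hk.exists_approx
  refine continuous_iff_continuousAt.2 fun x₀ =>
    E.continuousAt_of_approx 𝒢.continuous_unit.continuousAt fun ε hε => ?_
  set C : ℝ := ∫ g, χ g ∂(lam.rmeas x₀) with hC
  have hC0 : 0 ≤ C := integral_nonneg hχ0
  obtain ⟨n, f, a, hf, hfc, ha, hfa⟩ := happ (ε / (C + 1)) (by positivity)
  refine ⟨fun x => ∑ i, ((∫ g, f i g ∂(lam.rmeas x) : ℝ) : ℂ) • a i x, ?_, ?_⟩
  · have : ∀ s : Finset (Fin n), ContinuousAt (fun x => (⟨𝒢.unit x,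
        ∑ i ∈ s, ((∫ g, f i g ∂(lam.rmeas x) : ℝ) : ℂ) • a i x⟩ : E.Tot)) x₀ := by
      intro s
      induction s using Finset.induction_on with
      | empty => simpa using E.continuousAt_zero 𝒢.continuous_unit.continuousAt
      | insert i s his ih =>
        simp only [Finset.sum_insert his]
        refine E.continuousAt_add (E.continuousAt_smul ?_ (ha i).continuousAt) ih
        exact (Complex.continuous_ofReal.comp
          (lam.continuous_integral_rmeas (hf i) (hfc i))).continuousAt
    exact this Finset.univ
  · have hlt : ∀ᶠ x in 𝓝 x₀, ∫ g, χ g ∂(lam.rmeas x) < C + 1 :=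
      (lam.continuous_integral_rmeas hχ hχc).continuousAt.eventually_lt continuousAt_const
        (by rw [← hC]; linarith)
    filter_upwards [hlt] with x hx
    have hint : ∀ i, Integrable (fun g => (f i g : ℂ) • a i x) (lam.rmeas x) := fun i =>
      ((lam.integrable_rmeas (hf i) (hfc i) x).ofReal (𝕜 := ℂ)).smul_const (a i x)
    have e1 : ∑ i, ((∫ g, f i g ∂(lam.rmeas x) : ℝ) : ℂ) • a i x
        = ∫ g, ∑ i, (f i g : ℂ) • a i x ∂(lam.rmeas x) := by
      rw [integral_finsetSum _ fun i _ => hint i]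
      refine Finset.sum_congr rfl fun i _ => ?_
      rw [integral_smul_const]
      congr 1
      exact (integral_ofReal (𝕜 := ℂ)).symm
    rw [e1, sliceIntegral, ← integral_sub (hk.integrable lam x)
      (integrable_finsetSum _ fun i _ => hint i)]
    have hb : ‖∫ g, (E.extend x (k x) g - ∑ i, (f i g : ℂ) • a i x) ∂(lam.rmeas x)‖
        ≤ ∫ g, ε / (C + 1) * χ g ∂(lam.rmeas x) := by
      refine norm_integral_le_of_norm_le ((lam.integrable_rmeas hχ hχc x).const_mul _) ?_
      have : ∀ᵐ g ∂(lam.rmeas x), 𝒢.src g = x := lam.rmeas_compl x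
      filter_upwards [this] with g hg
      rw [extend, dif_pos hg]
      exact hfa x g hg
    refine hb.trans_lt ?_
    rw [integral_const_mul]
    calc ε / (C + 1) * ∫ g, χ g ∂(lam.rmeas x) < ε / (C + 1) * (C + 1) := by gcongr
      _ = ε := by field_simp

theorem IsCcFamily.sliceIntegral_eq_zero (hk : E.IsCcFamily k K) {x : M}
    (hx : x ∉ 𝒢.src '' K) : E.sliceIntegral lam x (k x) = 0 := by
  have : ∀ g, E.extend x (k x) g = 0 := by
    intro g
    unfold extend
    split_ifs with h
    · exact hk.eq_zero x g h fun hg => hx ⟨g, hg, h⟩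
    · rfl
  simp [sliceIntegral, this]

/-- The element `x ↦ ∫_{Γ_x} k dλ_x` of `A = C_0(M; E)`. -/
noncomputable def IsCcFamily.toA (hk : E.IsCcFamily k K) : E.A :=
  ⟨⟨fun x => E.sliceIntegral lam x (k x), memℓp_infty (by
      obtain ⟨C, hC⟩ := E.bddAbove_norm_of_isCompact (hk.continuous_sliceIntegral lam)
        (hk.isCompact.image 𝒢.continuous_src)
      refine ⟨max C 0, ?_⟩
      rintro _ ⟨x, rfl⟩
      by_cases hx : x ∈ 𝒢.src '' K
      · exact (hC x hx).trans (le_max_left _ _)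
      · simp [hk.sliceIntegral_eq_zero lam hx])⟩,
    hk.continuous_sliceIntegral lam, fun ε hε =>
      ⟨𝒢.src '' K, hk.isCompact.image 𝒢.continuous_src, fun x hx => by
        change ‖E.sliceIntegral lam x (k x)‖ < ε
        rwa [hk.sliceIntegral_eq_zero lam hx, norm_zero]⟩⟩

end FellBundle

end Haar

/-! ### The Hilbert module `L²(Γ; E)` -/

section LTwo

variable {Γ M : Type*} [TopologicalSpace Γ] [TopologicalSpace M] {𝒢 : TopGroupoid Γ M}

namespace FellBundle

variable (E : FellBundle 𝒢)

/-- The space `C_c(Γ; E)` of compactly supported continuous sections. -/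
def Cc : Submodule ℂ (∀ g, E.fiber g) where
  carrier := {ξ | Continuous (fun g => (⟨g, ξ g⟩ : E.Tot)) ∧
    ∃ K : Set Γ, IsCompact K ∧ ∀ g ∉ K, ξ g = 0}
  zero_mem' := ⟨continuous_iff_continuousAt.2 fun _ => E.continuousAt_zero continuousAt_id,
    ∅, isCompact_empty, fun _ _ => rfl⟩
  add_mem' := by
    rintro ξ η ⟨hξ, K, hK, hξK⟩ ⟨hη, L, hL, hηL⟩
    refine ⟨continuous_iff_continuousAt.2 fun g =>
      E.continuousAt_add hξ.continuousAt hη.continuousAt, K ∪ L, hK.union hL, fun g hg => ?_⟩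
    rw [mem_union, not_or] at hg
    simp [hξK g hg.1, hηL g hg.2]
  smul_mem' := by
    rintro z ξ ⟨hξ, K, hK, hξK⟩
    refine ⟨continuous_iff_continuousAt.2 fun g =>
      E.continuousAt_smul (c := fun _ => z) continuousAt_const hξ.continuousAt, K, hK,
      fun g hg => ?_⟩
    simp [hξK g hg]

theorem mul_zero_right {g h k : Γ} (c : 𝒢.Comp g h k) (a : E.fiber g) : E.mul c a 0 = 0 := by
  have := E.mul_smul c 0 a 0
  rwa [zero_smul, zero_smul] at this

theorem mul_zero_left {g h k : Γ} (c : 𝒢.Comp g h k) (b : E.fiber h) : E.mul c 0 b = 0 := by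
  have := E.smul_mul c 0 0 b
  rwa [zero_smul, zero_smul] at this

theorem sub_mul' {g h k : Γ} (c : 𝒢.Comp g h k) (a a' : E.fiber g) (b : E.fiber h) :
    E.mul c (a - a') b = E.mul c a b - E.mul c a' b := by
  have := E.smul_mul c (-1) a' b
  rw [neg_one_smul, neg_one_smul] at this
  rw [sub_eq_add_neg, E.add_mul, this, sub_eq_add_neg]

/-- The right action `(ξ a)(g) = ξ(g) a(s(g))` of `A` on `C_c(Γ; E)`. -/
def ccAct (a : E.A) (ξ : E.Cc) : E.Cc :=
  ⟨fun g => E.mul (TopGroupoid.comp_unit_right rfl) (ξ.1 g) (a (𝒢.src g)), by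
    obtain ⟨ξ, hξ, K, hK, hξK⟩ := ξ
    refine ⟨continuous_iff_continuousAt.2 fun g =>
      E.continuousAt_mul (fun _ => TopGroupoid.comp_unit_right rfl) hξ.continuousAt
        ((A_continuous a).comp 𝒢.continuous_src).continuousAt, K, hK, fun g hg => ?_⟩
    simp only [hξK g hg, E.mul_zero_left]⟩

/-- The integrand `ξ(g)* η(g) ∈ A_x`, `g ∈ Γ_x`, of the inner product of `C_c(Γ; E)`. -/
def ccKernel (ξ η : ∀ g, E.fiber g) (x : M) (g : Γ) (h : 𝒢.src g = x) : E.unitFiber x :=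
  E.mul (TopGroupoid.comp_inv_self h) (E.star rfl (ξ g)) (η g)

variable {E}

theorem isCcFamily_ccKernel (ξ η : E.Cc) : ∃ K, E.IsCcFamily (E.ccKernel ξ.1 η.1) K := by
  obtain ⟨ξ, hξ, -⟩ := ξ
  obtain ⟨η, hη, K, hK, hηK⟩ := η
  refine ⟨K, hK, fun x g h hg => ?_, continuous_iff_continuousAt.2 fun g => ?_⟩
  · simp only [ccKernel, hηK g hg, E.mul_zero_right]
  · exact E.continuousAt_mul (fun _ => TopGroupoid.comp_inv_self rfl)
      (E.continuousAt_star (fun _ => rfl) hξ.continuousAt) hη.continuousAt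

theorem star_ccKernel (ξ η : ∀ g, E.fiber g) (x : M) (g : Γ) (h : 𝒢.src g = x) :
    Star.star (E.ccKernel ξ η x g h) = E.ccKernel η ξ x g h := by
  have := E.star_mul (TopGroupoid.comp_inv_self h) (TopGroupoid.comp_inv_self h)
    (𝒢.inv_inv g) rfl (TopGroupoid.inv_unit x) (E.star rfl (ξ g)) (η g)
  rw [E.star_star] at this
  exact this

theorem exists_ccKernel_self (ξ : ∀ g, E.fiber g) (x : M) (g : Γ) (h : 𝒢.src g = x) :
    ∃ b : E.unitFiber x, E.ccKernel ξ ξ x g h = Star.star b * b := by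
  subst h
  exact E.star_mul_self_nonneg rfl _ (ξ g)

/-- An element of `A` that is pointwise of the form `b* b` is of this form. -/
theorem exists_star_mul_self_of_pointwise (a : E.A)
    (h : ∀ x, ∃ b : E.unitFiber x, a x = Star.star b * b) : ∃ b : E.A, a = Star.star b * b := by
  have hsa : IsSelfAdjoint a := A_ext fun x => by
    change Star.star (a x) = a x
    obtain ⟨b, hb⟩ := h x
    rw [hb, StarMul.star_mul, _root_.star_star]
  obtain ⟨d, e, hde, h0⟩ := exists_posPart_negPart a hsa
  have he : Star.star e * e = 0 := by
    refine A_ext fun x => ?_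
    let _ : PartialOrder (E.unitFiber x) := CStarAlgebra.spectralOrder _
    have _ : StarOrderedRing (E.unitFiber x) := CStarAlgebra.spectralOrderedRing _
    change Star.star (e x) * e x = 0
    have e1 : a x = Star.star (d x) * d x - Star.star (e x) * e x := congrArg (fun c : E.A => c x) hde
    have e2 : (Star.star (e x) * e x) * (Star.star (d x) * d x) = 0 :=
      congrArg (fun c : E.A => c x) h0
    have ha0 : 0 ≤ a x := by
      obtain ⟨b, hb⟩ := h x
      rw [hb]
      exact _root_.star_mul_self_nonneg _
    have hn0 : 0 ≤ Star.star (e x) * e x := _root_.star_mul_self_nonneg _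
    set n := Star.star (e x) * e x with hn
    have hnsa : Star.star n = n := IsSelfAdjoint.of_nonneg hn0
    have h1 : 0 ≤ n * a x * n := by
      have := star_left_conjugate_nonneg ha0 n
      rwa [hnsa] at this
    have h2 : 0 ≤ n * n * n := by
      have := star_left_conjugate_nonneg hn0 n
      rwa [hnsa] at this
    rw [e1, _root_.mul_sub, e2, zero_sub, _root_.neg_mul] at h1
    have h3 : n * n * n = 0 := le_antisymm (neg_nonneg.1 h1) h2
    have h4 : n * n = 0 := by
      rw [← CStarRing.star_mul_self_eq_zero_iff, StarMul.star_mul, hnsa, ← _root_.mul_assoc, h3,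
        zero_mul]
    rw [← CStarRing.star_mul_self_eq_zero_iff, hnsa, h4]
  exact ⟨d, by rw [hde, he, sub_zero]⟩

section

variable [T2Space Γ] [LocallyCompactSpace Γ] [SecondCountableTopology Γ] [MeasurableSpace Γ]
  [BorelSpace Γ] (lam : HaarSystem 𝒢)

/-- The inner product `⟨ξ, η⟩(x) = ∫_{Γ_x} ξ(g)* η(g) λ_x(dg)` of `C_c(Γ; E)`. -/
noncomputable def ccInner (ξ η : E.Cc) : E.A := (isCcFamily_ccKernel ξ η).choose_spec.toA lam

theorem ccInner_apply (ξ η : E.Cc) (x : M) :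
    ccInner lam ξ η x = E.sliceIntegral lam x (E.ccKernel ξ.1 η.1 x) := rfl

theorem integrable_ccKernel (ξ η : E.Cc) (x : M) :
    Integrable (E.extend x (E.ccKernel ξ.1 η.1 x)) (lam.rmeas x) :=
  (isCcFamily_ccKernel ξ η).choose_spec.integrable lam x

theorem ccInner_add_right (ξ η ζ : E.Cc) :
    ccInner lam ξ (η + ζ) = ccInner lam ξ η + ccInner lam ξ ζ := by
  refine A_ext fun x => ?_
  change E.sliceIntegral lam x _ = E.sliceIntegral lam x _ + E.sliceIntegral lam x _
  rw [sliceIntegral, sliceIntegral, sliceIntegral,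
    ← integral_add (integrable_ccKernel lam ξ η x) (integrable_ccKernel lam ξ ζ x)]
  refine integral_congr_ae (Eventually.of_forall fun g => ?_)
  simp only [extend]
  split_ifs
  · exact E.mul_add _ _ _ _
  · simp

theorem ccInner_smul_right (z : ℂ) (ξ η : E.Cc) :
    ccInner lam ξ (z • η) = z • ccInner lam ξ η := by
  refine A_ext fun x => ?_
  change E.sliceIntegral lam x _ = z • E.sliceIntegral lam x _
  rw [sliceIntegral, sliceIntegral, ← integral_smul]
  refine integral_congr_ae (Eventually.of_forall fun g => ?_)
  simp only [extend]
  split_ifs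
  · exact E.mul_smul _ _ _ _
  · simp

theorem star_ccInner (ξ η : E.Cc) : Star.star (ccInner lam ξ η) = ccInner lam η ξ := by
  refine A_ext fun x => ?_
  change Star.star (E.sliceIntegral lam x _) = E.sliceIntegral lam x _
  rw [sliceIntegral, sliceIntegral]
  have := (starL' ℝ : E.unitFiber x ≃L[ℝ] E.unitFiber x).integral_comp_comm (μ := lam.rmeas x)
    (E.extend x (E.ccKernel ξ.1 η.1 x))
  refine Eq.trans this.symm ?_
  refine integral_congr_ae (Eventually.of_forall fun g => ?_)
  change Star.star (E.extend x (E.ccKernel ξ.1 η.1 x) g) = _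
  simp only [extend]
  split_ifs
  · exact star_ccKernel _ _ _ _ _
  · simp

theorem ccInner_act_right (a : E.A) (ξ η : E.Cc) :
    ccInner lam ξ (E.ccAct a η) = ccInner lam ξ η * a := by
  refine A_ext fun x => ?_
  change E.sliceIntegral lam x _ = E.sliceIntegral lam x _ * a x
  rw [sliceIntegral, sliceIntegral,
    ← integral_mul_const_of_integrable (integrable_ccKernel lam ξ η x)]
  refine integral_congr_ae (Eventually.of_forall fun g => ?_)
  simp only [extend]
  split_ifs with h
  · subst h
    exact (E.mul_assoc _ _ _ _ _ _ _).symm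
  · simp

theorem exists_ccInner_self (ξ : E.Cc) : ∃ b : E.A, ccInner lam ξ ξ = Star.star b * b := by
  refine exists_star_mul_self_of_pointwise _ fun x => ?_
  let : PartialOrder (E.unitFiber x) := CStarAlgebra.spectralOrder _
  have : StarOrderedRing (E.unitFiber x) := CStarAlgebra.spectralOrderedRing _
  rw [← CStarAlgebra.nonneg_iff_eq_star_mul_self]
  refine integral_nonneg_of_ae (Eventually.of_forall fun g => ?_)
  simp only [extend, Pi.zero_apply]
  split_ifs with h
  · exact CStarAlgebra.nonneg_iff_eq_star_mul_self.2 (exists_ccKernel_self _ x g h)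
  · exact le_rfl

variable (E) in
/-- The `A`-valued inner product on `C_c(Γ; E)`. -/
noncomputable def ccSemiInner : SemiInner E.Aop E.Cc where
  act a ξ := E.ccAct a.unop ξ
  act_sub a ξ η := Subtype.ext (funext fun _ => E.sub_mul' _ _ _ _)
  form ξ η := op (ccInner lam ξ η)
  form_add_right ξ η ζ := congrArg op (ccInner_add_right lam ξ η ζ)
  form_self_nonneg ξ := by
    obtain ⟨b, hb⟩ := exists_ccInner_self lam ξ
    rw [hb]
    exact mul_star_self_nonneg (op b)
  form_act_right a ξ η := congrArg op (ccInner_act_right lam a.unop ξ η)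
  form_smul_right z ξ η := congrArg op (ccInner_smul_right lam z ξ η)
  star_form ξ η := congrArg op (star_ccInner lam ξ η)

variable (E) in
/-- The right Hilbert `A`-module `L²(Γ; E)`, the completion of `C_c(Γ; E)`. -/
abbrev L2 : Type _ := (E.ccSemiInner lam).Hilb

/-- The canonical map `C_c(Γ; E) → L²(Γ; E)`. -/
noncomputable def toL2 (ξ : E.Cc) : E.L2 lam := (E.ccSemiInner lam).toHilb ξ

end

end FellBundle

end LTwo

/-! ### Tensor product with the separable Hilbert space -/

section Amplification

variable (B X : Type*) [NonUnitalCStarAlgebra B] [PartialOrder B] [StarOrderedRing B]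
  [NormedAddCommGroup X] [NormedSpace ℂ X] [SMul B X] [CStarModule B X]

variable {B X} in
theorem CStarModule.act_sub' (b : B) (v w : X) : b • (v - w) = b • v - b • w := by
  rw [← sub_eq_zero, ← CStarModule.inner_self (A := B)]
  simp only [CStarModule.inner_sub_right, CStarModule.inner_op_smul_right, mul_sub, sub_self]

variable {B X} in
theorem CStarModule.act_zero' (b : B) : b • (0 : X) = 0 := by
  have := CStarModule.act_sub' b (0 : X) 0
  rwa [sub_self, sub_self] at this

/-- The inner product `⟨ξ, η⟩ = ∑ n, ⟨ξ n, η n⟩` on finitely supported sequences in `X`. -/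
noncomputable def ampSemiInner : SemiInner B (ℕ →₀ X) where
  act b ξ := ξ.mapRange (fun v => b • v) (CStarModule.act_zero' b)
  act_sub b ξ η := by
    ext n
    simp [CStarModule.act_sub']
  form ξ η := η.sum fun n w => inner B (ξ n) w
  form_add_right ξ η ζ := Finsupp.sum_add_index' (by simp) (by simp)
  form_self_nonneg ξ := Finset.sum_nonneg fun n _ => CStarModule.inner_self_nonneg
  form_act_right b ξ η := by
    rw [Finsupp.sum_mapRange_index (by simp)]
    simp [Finsupp.sum, Finset.mul_sum]
  form_smul_right z ξ η := by
    rw [Finsupp.sum_smul_index' (by simp)]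
    simp [Finsupp.sum, Finset.smul_sum]
  star_form ξ η := by
    classical
    rw [Finsupp.sum_of_support_subset η (Finset.subset_union_right (s₁ := ξ.support)) _ (by simp),
      Finsupp.sum_of_support_subset ξ (Finset.subset_union_left (s₂ := η.support)) _ (by simp)]
    simp [star_sum]

/-- The Hilbert module `X ⊗ H`, `H = ℓ²(ℕ)` the separable infinite-dimensional Hilbert space:
the completion of the space of finitely supported sequences in `X`. -/
abbrev TensorH : Type _ := (ampSemiInner B X).Hilb

variable {X} in
/-- The element `ξ ⊗ δ_n` of `X ⊗ H`. -/
noncomputable def tmulDelta (ξ : X) (n : ℕ) : TensorH B X :=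
  (ampSemiInner B X).toHilb (Finsupp.single n ξ)

end Amplification

/-! ### Fibres of Hilbert modules and equivariant structures -/

section Equivariant

variable {Γ M : Type*} [TopologicalSpace Γ] [TopologicalSpace M] {𝒢 : TopGroupoid Γ M}

namespace FellBundle

variable (E : FellBundle 𝒢)

section Fib

variable {X : Type*} [NormedAddCommGroup X] [NormedSpace ℂ X] [SMul E.Aop X] [CStarModule E.Aop X]

/-- The value `⟨ξ, η⟩(x) ∈ A_x` of the inner product of a right Hilbert `A`-module. -/
noncomputable def ip (x : M) (ξ η : X) : E.unitFiber x := (inner E.Aop ξ η).unop x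

theorem star_ip (x : M) (ξ η : X) : Star.star (E.ip x ξ η) = E.ip x η ξ :=
  congrArg (fun a : E.Aop => a.unop x) (CStarModule.star_inner (A := E.Aop) ξ η)

/-- The map `(ξ, η) ↦ ⟨ξ, η⟩(x)` as a sesquilinear map. -/
noncomputable def ipL (x : M) : X →ₗ⋆[ℂ] X →ₗ[ℂ] E.unitFiber x where
  toFun ξ :=
    { toFun := fun η => E.ip x ξ η
      map_add' := fun η ζ =>
        congrArg (fun a : E.Aop => a.unop x) (CStarModule.inner_add_right (A := E.Aop))
      map_smul' := fun z η =>
        congrArg (fun a : E.Aop => a.unop x) (CStarModule.inner_smul_right_complex (A := E.Aop)) }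
  map_add' ξ η := by
    ext ζ
    exact congrArg (fun a : E.Aop => a.unop x) (CStarModule.inner_add_left (A := E.Aop))
  map_smul' z ξ := by
    ext ζ
    exact congrArg (fun a : E.Aop => a.unop x) (CStarModule.inner_smul_left_complex (A := E.Aop))

variable (X) in
/-- The null space of the semi-inner product `⟨·, ·⟩(x)`. -/
def nullAt (x : M) : Submodule ℂ X where
  carrier := {ξ | ∀ η : X, E.ip x η ξ = 0}
  zero_mem' η := map_zero (E.ipL x η)
  add_mem' {ξ ζ} h h' η := by
    have := map_add (E.ipL x η) ξ ζ
    exact this.trans (by rw [show E.ipL x η ξ = 0 from h η, show E.ipL x η ζ = 0 from h' η, add_zero])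
  smul_mem' z ξ h η := by
    have := map_smul (E.ipL x η) z ξ
    exact this.trans (by rw [show E.ipL x η ξ = 0 from h η, smul_zero])

variable (X) in
/-- The fibre `X_x = X ⊗_A A_x` of a right Hilbert `A`-module `X` at `x ∈ M`.  Since `A → A_x` is
onto, it is the quotient of `X` by the null space of `⟨·, ·⟩(x)`. -/
def Fib (x : M) : Type _ := X ⧸ E.nullAt X x

instance (x : M) : AddCommGroup (E.Fib X x) := inferInstanceAs (AddCommGroup (X ⧸ E.nullAt X x))

instance (x : M) : Module ℂ (E.Fib X x) := inferInstanceAs (Module ℂ (X ⧸ E.nullAt X x))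

/-- The value `ξ(x) ∈ X_x` of `ξ ∈ X`. -/
def val (x : M) : X →ₗ[ℂ] E.Fib X x := (E.nullAt X x).mkQ

theorem val_surjective (x : M) : Function.Surjective (E.val (X := X) x) :=
  Submodule.mkQ_surjective _

/-- The `A_x`-valued inner product of the fibre `X_x`. -/
noncomputable def fibInner (x : M) : E.Fib X x →ₗ⋆[ℂ] E.Fib X x →ₗ[ℂ] E.unitFiber x :=
  (E.nullAt X x).liftQ
    { toFun := fun ξ => (E.nullAt X x).liftQ (E.ipL x ξ) fun _ h => h ξ
      map_add' := fun ξ ζ => LinearMap.ext fun z => by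
        obtain ⟨η, rfl⟩ := E.val_surjective x z
        exact congrArg (fun f => f η) (map_add (E.ipL x) ξ ζ)
      map_smul' := fun c ξ => LinearMap.ext fun z => by
        obtain ⟨η, rfl⟩ := E.val_surjective x z
        exact congrArg (fun f => f η) (map_smulₛₗ (E.ipL x) c ξ) }
    fun ξ h => LinearMap.ext fun z => by
      obtain ⟨η, rfl⟩ := E.val_surjective x z
      have : E.ip x ξ η = 0 := by rw [← E.star_ip, h η, star_zero]
      exact this

theorem fibInner_val (x : M) (ξ η : X) :
    E.fibInner x (E.val x ξ) (E.val x η) = E.ip x ξ η := rfl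

/-- The norm `‖z‖ = ‖⟨z, z⟩‖^{1/2}` of the fibre `X_x`. -/
noncomputable def fibNorm {x : M} (z : E.Fib X x) : ℝ := √‖E.fibInner x z z‖

end Fib

section Maps

variable {X Y : Type*} [NormedAddCommGroup X] [NormedSpace ℂ X] [SMul E.Aop X]
  [CStarModule E.Aop X] [NormedAddCommGroup Y] [NormedSpace ℂ Y] [SMul E.Aop Y]
  [CStarModule E.Aop Y]

/-- `T` has an adjoint. -/
def IsAdjointable (T : X →ₗ[ℂ] Y) : Prop :=
  ∃ S : Y → X, ∀ ξ η, inner E.Aop η (T ξ) = inner E.Aop (S η) ξ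

variable {E}

/-- The map `X_x → Y_x` induced by an adjointable map `X → Y`. -/
def fibMap {T : X →ₗ[ℂ] Y} (hT : E.IsAdjointable T) (x : M) : E.Fib X x →ₗ[ℂ] E.Fib Y x :=
  (E.nullAt X x).mapQ (E.nullAt Y x) T fun ξ h η => by
    obtain ⟨S, hS⟩ := hT
    have : E.ip x η (T ξ) = E.ip x (S η) ξ := congrArg (fun a : E.Aop => a.unop x) (hS ξ η)
    rw [this]
    exact h _

theorem fibMap_val {T : X →ₗ[ℂ] Y} (hT : E.IsAdjointable T) (x : M) (ξ : X) :
    fibMap hT x (E.val x ξ) = E.val x (T ξ) := rfl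

end Maps

end FellBundle

/-- A `(Γ, E)`-equivariant structure on a right Hilbert `A`-module `X`, `A = C_0(M; E)`:
isomorphisms `X_{t(g)} ⊗_{A_{t(g)}} E_g ≅ X_{s(g)}` of Hilbert modules, that is, bilinear maps
`X_{t(g)} × E_g → X_{s(g)}`, `(z, e) ↦ z e`, with `⟨z e, z' e'⟩ = e* ⟨z, z'⟩ e'` and total range,
which are associative, and continuous in the sense that for `ξ ∈ X`, `η ∈ C_0(Γ; E)` the section
`g ↦ ξ(t(g)) η(g)` of the field `(X_{s(g)})_g` is locally a uniform limit of the sections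
`g ↦ ζ(s(g))`, `ζ ∈ X`. -/
structure EquivariantStructure (E : FellBundle 𝒢) (X : Type*) [NormedAddCommGroup X]
    [NormedSpace ℂ X] [SMul E.Aop X] [CStarModule E.Aop X] where
  act : ∀ {g : Γ} {x y : M}, 𝒢.tgt g = y → 𝒢.src g = x →
    E.Fib X y →ₗ[ℂ] E.fiber g →ₗ[ℂ] E.Fib X x
  inner_act : ∀ {g : Γ} {x y : M} (ht : 𝒢.tgt g = y) (hs : 𝒢.src g = x) (z z' : E.Fib X y)
    (e e' : E.fiber g), E.fibInner x (act ht hs z e) (act ht hs z' e') =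
      E.mul (TopGroupoid.comp_inv_self hs) (E.star rfl e)
        (E.mul (TopGroupoid.comp_unit_left ht) (E.fibInner y z z') e')
  dense_act : ∀ {g : Γ} {x y : M} (ht : 𝒢.tgt g = y) (hs : 𝒢.src g = x) (w : E.Fib X x),
    ∀ ε > 0, ∃ w' ∈ Submodule.span ℂ (range fun p : E.Fib X y × E.fiber g => act ht hs p.1 p.2),
      E.fibNorm (w - w') < ε
  act_act : ∀ {g h k : Γ} {x y z : M} (c : 𝒢.Comp g h k) (htg : 𝒢.tgt g = z) (hsg : 𝒢.src g = y)
    (hth : 𝒢.tgt h = y) (hsh : 𝒢.src h = x) (htk : 𝒢.tgt k = z) (hsk : 𝒢.src k = x)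
    (w : E.Fib X z) (a : E.fiber g) (b : E.fiber h),
    act hth hsh (act htg hsg w a) b = act htk hsk w (E.mul c a b)
  continuous_act : ∀ (ξ : X) (η : ∀ g, E.fiber g),
    Continuous (fun g => (⟨g, η g⟩ : E.Tot)) →
    (∀ ε > 0, ∃ K : Set Γ, IsCompact K ∧ ∀ g ∉ K, ‖η g‖ < ε) →
    ∀ (g₀ : Γ), ∀ ε > 0, ∃ ζ : X, ∀ᶠ g in 𝓝 g₀,
      E.fibNorm (act rfl rfl (E.val (𝒢.tgt g) ξ) (η g) - E.val (𝒢.src g) ζ) < ε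

/-! ### Direct sums -/

namespace FellBundle

variable {E : FellBundle 𝒢} {X Y : Type*} [NormedAddCommGroup X] [NormedSpace ℂ X] [SMul E.Aop X]
  [CStarModule E.Aop X] [NormedAddCommGroup Y] [NormedSpace ℂ Y] [SMul E.Aop Y]
  [CStarModule E.Aop Y]

variable (E X Y) in
/-- The direct sum of two Hilbert modules. -/
abbrev Sum : Type _ := WithCStarModule E.Aop (X × Y)

variable (E X Y) in
/-- The first projection. -/
def sumFst : E.Sum X Y →ₗ[ℂ] X where
  toFun w := w.1
  map_add' _ _ := rfl
  map_smul' _ _ := rfl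

variable (E X Y) in
/-- The second projection. -/
def sumSnd : E.Sum X Y →ₗ[ℂ] Y where
  toFun w := w.2
  map_add' _ _ := rfl
  map_smul' _ _ := rfl

variable (E X Y) in
/-- The first inclusion. -/
def sumInl : X →ₗ[ℂ] E.Sum X Y where
  toFun ξ := (WithCStarModule.equiv E.Aop (X × Y)).symm (ξ, 0)
  map_add' ξ ξ' := by
    apply (WithCStarModule.equiv E.Aop (X × Y)).injective
    simp
  map_smul' z ξ := by
    apply (WithCStarModule.equiv E.Aop (X × Y)).injective
    simp

variable (E X Y) in
/-- The second inclusion. -/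
def sumInr : Y →ₗ[ℂ] E.Sum X Y where
  toFun ξ := (WithCStarModule.equiv E.Aop (X × Y)).symm (0, ξ)
  map_add' ξ ξ' := by
    apply (WithCStarModule.equiv E.Aop (X × Y)).injective
    simp
  map_smul' z ξ := by
    apply (WithCStarModule.equiv E.Aop (X × Y)).injective
    simp

theorem isAdjointable_sumFst : E.IsAdjointable (sumFst E X Y) :=
  ⟨sumInl E X Y, fun w ξ => by simp [WithCStarModule.prod_inner, sumInl, sumFst]⟩

theorem isAdjointable_sumSnd : E.IsAdjointable (sumSnd E X Y) :=
  ⟨sumInr E X Y, fun w ξ => by simp [WithCStarModule.prod_inner, sumInr, sumSnd]⟩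

theorem isAdjointable_sumInl : E.IsAdjointable (sumInl E X Y) :=
  ⟨sumFst E X Y, fun w ξ => by simp [WithCStarModule.prod_inner, sumInl, sumFst]⟩

theorem isAdjointable_sumInr : E.IsAdjointable (sumInr E X Y) :=
  ⟨sumSnd E X Y, fun w ξ => by simp [WithCStarModule.prod_inner, sumInr, sumSnd]⟩

variable (E X Y) in
/-- The projection `(X ⊕ Y)_x → X_x`. -/
noncomputable def fibFst (x : M) : E.Fib (E.Sum X Y) x →ₗ[ℂ] E.Fib X x := fibMap isAdjointable_sumFst x

variable (E X Y) in
/-- The projection `(X ⊕ Y)_x → Y_x`. -/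
noncomputable def fibSnd (x : M) : E.Fib (E.Sum X Y) x →ₗ[ℂ] E.Fib Y x := fibMap isAdjointable_sumSnd x

variable (E X Y) in
/-- The inclusion `X_x → (X ⊕ Y)_x`. -/
noncomputable def fibInl (x : M) : E.Fib X x →ₗ[ℂ] E.Fib (E.Sum X Y) x := fibMap isAdjointable_sumInl x

variable (E X Y) in
/-- The inclusion `Y_x → (X ⊕ Y)_x`. -/
noncomputable def fibInr (x : M) : E.Fib Y x →ₗ[ℂ] E.Fib (E.Sum X Y) x := fibMap isAdjointable_sumInr x

theorem fibFst_inl (x : M) (z : E.Fib X x) : fibFst E X Y x (fibInl E X Y x z) = z := by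
  obtain ⟨ξ, rfl⟩ := E.val_surjective x z
  rfl

theorem fibSnd_inl (x : M) (z : E.Fib X x) : fibSnd E X Y x (fibInl E X Y x z) = 0 := by
  obtain ⟨ξ, rfl⟩ := E.val_surjective x z
  rfl

theorem fibFst_inr (x : M) (z : E.Fib Y x) : fibFst E X Y x (fibInr E X Y x z) = 0 := by
  obtain ⟨ξ, rfl⟩ := E.val_surjective x z
  rfl

theorem fibSnd_inr (x : M) (z : E.Fib Y x) : fibSnd E X Y x (fibInr E X Y x z) = z := by
  obtain ⟨ξ, rfl⟩ := E.val_surjective x z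
  rfl

theorem fibInner_sum (x : M) (w w' : E.Fib (E.Sum X Y) x) :
    E.fibInner x w w' = E.fibInner x (fibFst E X Y x w) (fibFst E X Y x w')
      + E.fibInner x (fibSnd E X Y x w) (fibSnd E X Y x w') := by
  obtain ⟨ξ, rfl⟩ := E.val_surjective x w
  obtain ⟨ξ', rfl⟩ := E.val_surjective x w'
  rfl

theorem fibNorm_sum_le {x : M} (w : E.Fib (E.Sum X Y) x) :
    E.fibNorm w ≤ E.fibNorm (fibFst E X Y x w) + E.fibNorm (fibSnd E X Y x w) := by
  unfold fibNorm
  rw [fibInner_sum]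
  refine Real.sqrt_le_iff.2 ⟨by positivity, (norm_add_le _ _).trans ?_⟩
  have h1 := Real.sq_sqrt (norm_nonneg (E.fibInner x (fibFst E X Y x w) (fibFst E X Y x w)))
  have h2 := Real.sq_sqrt (norm_nonneg (E.fibInner x (fibSnd E X Y x w) (fibSnd E X Y x w)))
  nlinarith [Real.sqrt_nonneg ‖E.fibInner x (fibFst E X Y x w) (fibFst E X Y x w)‖,
    Real.sqrt_nonneg ‖E.fibInner x (fibSnd E X Y x w) (fibSnd E X Y x w)‖]

end FellBundle

namespace EquivariantStructure

open FellBundle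

variable {E : FellBundle 𝒢} {X Y : Type*} [NormedAddCommGroup X] [NormedSpace ℂ X] [SMul E.Aop X]
  [CStarModule E.Aop X] [NormedAddCommGroup Y] [NormedSpace ℂ Y] [SMul E.Aop Y]
  [CStarModule E.Aop Y]

/-- The action `(z, w) e = (z e, w e)` on a direct sum. -/
noncomputable def sumAct (α : EquivariantStructure E X) (β : EquivariantStructure E Y) {g : Γ} {x y : M}
    (ht : 𝒢.tgt g = y) (hs : 𝒢.src g = x) :
    E.Fib (E.Sum X Y) y →ₗ[ℂ] E.fiber g →ₗ[ℂ] E.Fib (E.Sum X Y) x :=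
  LinearMap.mk₂ ℂ (fun w e => fibInl E X Y x (α.act ht hs (fibFst E X Y y w) e)
      + fibInr E X Y x (β.act ht hs (fibSnd E X Y y w) e))
    (fun w w' e => by simp only [map_add, LinearMap.add_apply]; abel)
    (fun c w e => by simp only [map_smul, LinearMap.smul_apply, smul_add])
    (fun w e e' => by simp only [map_add]; abel)
    (fun c w e => by simp only [map_smul, smul_add])

section

variable (α : EquivariantStructure E X) (β : EquivariantStructure E Y) {g : Γ} {x y : M}
    (ht : 𝒢.tgt g = y) (hs : 𝒢.src g = x)

theorem sumAct_apply (w : E.Fib (E.Sum X Y) y) (e : E.fiber g) :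
    α.sumAct β ht hs w e = fibInl E X Y x (α.act ht hs (fibFst E X Y y w) e)
      + fibInr E X Y x (β.act ht hs (fibSnd E X Y y w) e) := rfl

theorem fibFst_sumAct (w : E.Fib (E.Sum X Y) y) (e : E.fiber g) :
    fibFst E X Y x (α.sumAct β ht hs w e) = α.act ht hs (fibFst E X Y y w) e := by
  rw [sumAct_apply, map_add, fibFst_inl, fibFst_inr, add_zero]

theorem fibSnd_sumAct (w : E.Fib (E.Sum X Y) y) (e : E.fiber g) :
    fibSnd E X Y x (α.sumAct β ht hs w e) = β.act ht hs (fibSnd E X Y y w) e := by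
  rw [sumAct_apply, map_add, fibSnd_inl, fibSnd_inr, zero_add]

end

/-- The direct sum of two equivariant Hilbert modules. -/
noncomputable def sum (α : EquivariantStructure E X) (β : EquivariantStructure E Y) :
    EquivariantStructure E (E.Sum X Y) where
  act ht hs := α.sumAct β ht hs
  inner_act {g x y} ht hs w w' e e' := by
    rw [fibInner_sum, fibFst_sumAct, fibFst_sumAct, fibSnd_sumAct, fibSnd_sumAct, α.inner_act,
      β.inner_act, fibInner_sum, E.add_mul, E.mul_add]
  dense_act {g x y} ht hs w ε hε := by
    obtain ⟨u, hu, hu'⟩ := α.dense_act ht hs (fibFst E X Y x w) (ε / 2) (half_pos hε)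
    obtain ⟨v, hv, hv'⟩ := β.dense_act ht hs (fibSnd E X Y x w) (ε / 2) (half_pos hε)
    refine ⟨fibInl E X Y x u + fibInr E X Y x v, Submodule.add_mem _ ?_ ?_, ?_⟩
    · refine (Submodule.span_le (p := (Submodule.span ℂ _).comap (fibInl E X Y x))).2 ?_ hu
      rintro _ ⟨⟨z, e⟩, rfl⟩
      refine Submodule.subset_span ⟨(fibInl E X Y y z, e), ?_⟩
      simp [sumAct_apply, fibFst_inl, fibSnd_inl]
    · refine (Submodule.span_le (p := (Submodule.span ℂ _).comap (fibInr E X Y x))).2 ?_ hv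
      rintro _ ⟨⟨z, e⟩, rfl⟩
      refine Submodule.subset_span ⟨(fibInr E X Y y z, e), ?_⟩
      simp [sumAct_apply, fibFst_inr, fibSnd_inr]
    · refine (fibNorm_sum_le _).trans_lt ?_
      simp only [map_sub, map_add, fibFst_inl, fibFst_inr, fibSnd_inl, fibSnd_inr, add_zero,
        zero_add]
      linarith
  act_act {g h k x y z} c htg hsg hth hsh htk hsk w a b := by
    rw [sumAct_apply α β hth hsh, fibFst_sumAct, fibSnd_sumAct,
      α.act_act c htg hsg hth hsh htk hsk, β.act_act c htg hsg hth hsh htk hsk, sumAct_apply]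
  continuous_act ξ η hη hη0 g₀ ε hε := by
    obtain ⟨ζ, hζ⟩ := α.continuous_act (sumFst E X Y ξ) η hη hη0 g₀ (ε / 2) (half_pos hε)
    obtain ⟨ζ', hζ'⟩ := β.continuous_act (sumSnd E X Y ξ) η hη hη0 g₀ (ε / 2) (half_pos hε)
    refine ⟨sumInl E X Y ζ + sumInr E X Y ζ', ?_⟩
    filter_upwards [hζ, hζ'] with g h h'
    refine (fibNorm_sum_le _).trans_lt ?_
    have e1 : fibFst E X Y (𝒢.src g) (E.val (𝒢.src g) (sumInl E X Y ζ + sumInr E X Y ζ'))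
        = E.val (𝒢.src g) ζ := by
      exact congrArg (E.val (𝒢.src g)) (add_zero ζ)
    have e2 : fibSnd E X Y (𝒢.src g) (E.val (𝒢.src g) (sumInl E X Y ζ + sumInr E X Y ζ'))
        = E.val (𝒢.src g) ζ' := by
      exact congrArg (E.val (𝒢.src g)) (zero_add ζ')
    rw [map_sub, map_sub, fibFst_sumAct, fibSnd_sumAct, e1, e2]
    exact (add_lt_add h h').trans_eq (add_halves ε)

end EquivariantStructure

/-! ### Equivariant isomorphisms, countable generation, the action on `L²(Γ; E) ⊗ H` -/

namespace FellBundle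

variable (E : FellBundle 𝒢) (X Y : Type*) [NormedAddCommGroup X] [NormedSpace ℂ X] [SMul E.Aop X]
  [CStarModule E.Aop X] [NormedAddCommGroup Y] [NormedSpace ℂ Y] [SMul E.Aop Y]
  [CStarModule E.Aop Y]

/-- `X` is countably generated as a Hilbert `A`-module. -/
def CountablyGenerated : Prop :=
  ∃ S : Set X, S.Countable ∧
    Dense (Submodule.span ℂ {v | ∃ a : E.Aop, ∃ ξ ∈ S, v = a • ξ} : Set X)

/-- An isomorphism of right Hilbert `A`-modules. -/
structure HilbertModuleIso extends X ≃ₗ[ℂ] Y where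
  map_act : ∀ (a : E.Aop) (ξ : X), toFun (a • ξ) = a • toFun ξ
  inner_map : ∀ ξ η : X, inner E.Aop (toFun ξ) (toFun η) = inner E.Aop ξ η

variable {E X Y}

theorem HilbertModuleIso.isAdjointable (U : E.HilbertModuleIso X Y) :
    E.IsAdjointable (U.toLinearEquiv : X →ₗ[ℂ] Y) :=
  ⟨U.toLinearEquiv.symm, fun ξ η => by
    have := U.inner_map (U.toLinearEquiv.symm η) ξ
    rw [← this]
    congr 1
    exact (U.toLinearEquiv.apply_symm_apply η).symm⟩

/-- The isomorphism `X_x ≅ Y_x` induced by an isomorphism `X ≅ Y`. -/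
def HilbertModuleIso.fib (U : E.HilbertModuleIso X Y) (x : M) : E.Fib X x →ₗ[ℂ] E.Fib Y x :=
  fibMap U.isAdjointable x

end FellBundle

/-- An isomorphism of `(Γ, E)`-equivariant Hilbert modules. -/
structure EquivariantIso {E : FellBundle 𝒢} {X Y : Type*} [NormedAddCommGroup X]
    [NormedSpace ℂ X] [SMul E.Aop X] [CStarModule E.Aop X] [NormedAddCommGroup Y]
    [NormedSpace ℂ Y] [SMul E.Aop Y] [CStarModule E.Aop Y]
    (α : EquivariantStructure E X) (β : EquivariantStructure E Y)
    extends E.HilbertModuleIso X Y where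
  equivariant : ∀ {g : Γ} {x y : M} (ht : 𝒢.tgt g = y) (hs : 𝒢.src g = x) (z : E.Fib X y)
    (e : E.fiber g), toHilbertModuleIso.fib x (α.act ht hs z e) =
      β.act ht hs (toHilbertModuleIso.fib y z) e

variable [T2Space Γ] [LocallyCompactSpace Γ] [SecondCountableTopology Γ] [MeasurableSpace Γ]
  [BorelSpace Γ] (lam : HaarSystem 𝒢) (E : FellBundle 𝒢)

/-- The right Hilbert `A`-module `L²(Γ; E) ⊗ H`, `H` the separable infinite-dimensional Hilbert
space. -/
abbrev FellBundle.L2H : Type _ := TensorH E.Aop (E.L2 lam)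

variable {lam E} in
/-- `ρ` is the action `(ξ ⊗ v) e = (ξ e) ⊗ v` on `L²(Γ; E) ⊗ H` where, for `e ∈ E_g`,
`ξ e ∈ L²(Γ; E)_{s(g)}` is given by the function `(ξ e)(h) = ξ(h g⁻¹) e` on `Γ_{s(g)}`.  This is
expressed through the inner products with the sections `ζ ∈ C_c(Γ; E)`. -/
def EquivariantStructure.IsTranslation (ρ : EquivariantStructure E (E.L2H lam)) : Prop :=
  ∀ {g : Γ} {x y : M} (ht : 𝒢.tgt g = y) (hs : 𝒢.src g = x) (e : E.fiber g) (ξ ζ : E.Cc)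
    (m n : ℕ),
    E.fibInner x (E.val x (tmulDelta E.Aop (FellBundle.toL2 lam ζ) m))
      (ρ.act ht hs (E.val y (tmulDelta E.Aop (FellBundle.toL2 lam ξ) n)) e) =
    if m = n then
      E.sliceIntegral lam x fun h hh =>
        E.mul (TopGroupoid.comp_inv_self hh) (E.star rfl (ζ.1 h))
          (E.mul (TopGroupoid.comp_mul_inv (hh.trans hs.symm)) (ξ.1 (𝒢.mul h (𝒢.inv g))) e)
    else 0

end Equivariant

set_option linter.unusedSectionVars false

/-! ### The unit space -/

namespace TopGroupoid

variable {Γ M : Type*} [TopologicalSpace Γ] [TopologicalSpace M] [T2Space Γ]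
  (𝒢 : TopGroupoid Γ M)

/-! Write X for the given module and Y = L²(Γ; E). The argument is the Mingo–Phillips proof of
Kasparov's stabilization theorem, carried out with equivariant operators.

Suppose that equivariant adjointable operators S_k : Y → X have ranges that together span a dense
subspace. Choose m(n) so that it takes each value k infinitely often, and let T : Y ⊗ H → X ⊕ (Y ⊗
H) send η ⊗ δ_n to (c_n S_{m(n)} η, d_n η ⊗ δ_n) with small positive weights. Since T* (0, η ⊗ δ_n)
= d_n η ⊗ δ_n, the adjoint has dense range. If d_n / c_n tends to 0 along the n with m(n) = k,
division by c_n shows that the closure of the range of T contains (S_k η, 0), hence X ⊕ 0, hence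
everything. An adjointable operator which, like its adjoint, has dense range has a unitary polar
part. This part is equivariant because the modulus lies in the C⋆-algebra of equivariant adjointable
operators. Applied to T*, this gives the isomorphism (`nonempty_absorption`,
`IsEquivariantAdjoint.nonempty_equivariantIso`, `equivariantAlgebra.exists_sqrt`).

The operators S_k are integrals: for ξ ∈ X and f ∈ C_c(M), the value of S η at x is ∫ f(t(g))
ξ(t(g)) η(g) λ_x(dg). Equivariance is the right invariance of (λ_x) (`HaarSystem.map_mul_right`).
The adjoint sends ζ to g ↦ f(t(g)) ⟨ξ(t(g)), ζ(s(g))⟩, where the pairing X_{t(g)} × X_{s(g)} → E_g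
is determined by ⟨w, z e⟩ = ⟨w, z⟩ e. Properness enters here twice: it makes this section compactly
supported when ζ is, and it bounds ∫ f(t(g))² λ_x(dg) uniformly in x, so that the adjoint is bounded
(`exists_integral_tgt_le`, `exists_convOperator`). If η is a bump of integral one near the units
times an extension of a ∈ A, the integral of ξ(t(g)) η(g) is close to ξ a (`exists_conv_near`).
Countably many generators ξ and the cutoffs f of an exhaustion of M therefore yield countably many
operators with total range (`exists_operators`).

The translation action on Y itself rests on a Tietze theorem for sections (`exists_Cc_extension`): h
↦ ξ(h g⁻¹) e lives on one fibre of s only, and is extended to an element of C_c(Γ; E). -/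

theorem isClosedEmbedding_unit : IsClosedEmbedding 𝒢.unit := by
  refine ⟨IsEmbedding.of_leftInverse (f := 𝒢.src) 𝒢.src_unit 𝒢.continuous_src 𝒢.continuous_unit, ?_⟩
  -- The units are the fixed points of g ↦ unit (s(g)), a closed set since Γ is Hausdorff. In this
  -- way M inherits the topological properties of Γ.
  have : range 𝒢.unit = {g | 𝒢.unit (𝒢.src g) = g} := by
    ext g
    constructor
    · rintro ⟨x, rfl⟩
      simp [𝒢.src_unit]
    · intro h
      exact ⟨_, h⟩
  rw [this]
  exact isClosed_eq (𝒢.continuous_unit.comp 𝒢.continuous_src) continuous_id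

theorem t2Space_base (𝒢 : TopGroupoid Γ M) : T2Space M := 𝒢.isClosedEmbedding_unit.isEmbedding.t2Space

theorem locallyCompactSpace_base [LocallyCompactSpace Γ] (𝒢 : TopGroupoid Γ M) :
    LocallyCompactSpace M :=
  𝒢.isClosedEmbedding_unit.locallyCompactSpace

theorem secondCountableTopology_base [SecondCountableTopology Γ] (𝒢 : TopGroupoid Γ M) :
    SecondCountableTopology M :=
  𝒢.isClosedEmbedding_unit.isEmbedding.secondCountableTopology

/-- Bump functions on the unit space. -/
theorem exists_bump [LocallyCompactSpace Γ] (𝒢 : TopGroupoid Γ M) {K U : Set M} (hK : IsCompact K)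
    (hU : IsOpen U) (hKU : K ⊆ U) : ∃ f : C(M, ℝ), EqOn f 1 K ∧ (∀ x ∉ U, f x = 0) ∧
      HasCompactSupport f ∧ ∀ x, f x ∈ Icc (0 : ℝ) 1 := by
  have := 𝒢.t2Space_base
  have := 𝒢.locallyCompactSpace_base
  obtain ⟨f, h1, h2, h3, h4⟩ := exists_continuous_one_zero_of_isCompact hK hU.isClosed_compl
    (disjoint_compl_right_iff_subset.2 hKU)
  exact ⟨f, h1, fun x hx => h2 hx, h3, h4⟩

end TopGroupoid

/-! ### Approximate units -/

/-- With c = ⟨ξ, ξ⟩, the inner square of ξ - b ξ is (c - bc) - (c - bc) b*, of norm at most 2‖c -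
bc‖ when ‖b‖ ≤ 1. An approximate unit makes this small. -/
theorem CStarModule.exists_norm_sub_smul_lt {B X : Type*} [NonUnitalCStarAlgebra B]
    [PartialOrder B] [StarOrderedRing B] [NormedAddCommGroup X] [NormedSpace ℂ X] [SMul B X]
    [CStarModule B X] (ξ : X) {ε : ℝ} (hε : 0 < ε) : ∃ b : B, ‖ξ - b • ξ‖ < ε := by
  have h := CStarAlgebra.increasingApproximateUnit B
  have := h.neBot
  set c : B := inner B ξ ξ
  have h1 : Tendsto (fun b : B => ‖c - b * c‖) (CStarAlgebra.approximateUnit B) (𝓝 0) := by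
    have := (tendsto_const_nhds (x := c)).sub (h.tendsto_mul_right c)
    simpa using this.norm
  obtain ⟨b, hb, hb1⟩ := ((h1.eventually_lt_const (show 0 < ε ^ 2 / 2 by positivity)).and
    h.eventually_norm).exists
  refine ⟨b, ?_⟩
  have e : inner B (ξ - b • ξ) (ξ - b • ξ) = (c - b * c) - (c - b * c) * star b := by
    simp only [CStarModule.inner_sub_left, CStarModule.inner_sub_right,
      CStarModule.inner_op_smul_left, CStarModule.inner_op_smul_right, sub_mul, mul_sub, c,
      mul_assoc]
    abel
  refine lt_of_pow_lt_pow_left₀ 2 hε.le ?_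
  rw [CStarModule.norm_sq_eq B, e]
  calc _ ≤ ‖c - b * c‖ + ‖(c - b * c) * star b‖ := norm_sub_le _ _
    _ ≤ ‖c - b * c‖ + ‖c - b * c‖ * 1 := by
      gcongr
      refine (norm_mul_le _ _).trans ?_
      rw [norm_star]
      gcongr
    _ < ε ^ 2 := by linarith

namespace FellBundle

variable {Γ M : Type*} [TopologicalSpace Γ] [TopologicalSpace M] {𝒢 : TopGroupoid Γ M}
  {E : FellBundle 𝒢}

/-! ### Multiplication of elements of `A` and of Hilbert modules by functions -/

/-- The product of a bounded continuous function on `M` and an element of `A`. -/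
noncomputable def mulFun (f : C(M, ℝ)) {C : ℝ} (hf : ∀ x, |f x| ≤ C) (a : E.A) : E.A :=
  ⟨⟨fun x => (f x : ℂ) • a x, memℓp_infty (by
      refine ⟨C * ‖a‖, ?_⟩
      rintro _ ⟨x, rfl⟩
      change ‖(f x : ℂ) • a x‖ ≤ C * ‖a‖
      rw [norm_smul, Complex.norm_real]
      exact mul_le_mul (hf x) (lp.norm_apply_le_norm ENNReal.top_ne_zero a.1 x) (norm_nonneg _)
        ((abs_nonneg _).trans (hf x)))⟩,
    continuous_iff_continuousAt.2 fun x => E.continuousAt_smul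
      (Complex.continuous_ofReal.comp f.continuous).continuousAt (A_continuous a).continuousAt,
    fun ε hε => by
      obtain ⟨K, hK, hK'⟩ := a.2.2 (ε / (|C| + 1)) (by positivity)
      refine ⟨K, hK, fun x hx => ?_⟩
      change ‖(f x : ℂ) • a x‖ < ε
      have h1 := hK' x hx
      rw [lt_div_iff₀ (by positivity)] at h1
      rw [norm_smul, Complex.norm_real]
      calc ‖f x‖ * ‖a x‖ ≤ (|C| + 1) * ‖a x‖ := by
            gcongr
            exact (hf x).trans ((le_abs_self C).trans (by linarith))
        _ < ε := by rw [mul_comm]; exact h1⟩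

theorem mulFun_apply (f : C(M, ℝ)) {C : ℝ} (hf : ∀ x, |f x| ≤ C) (a : E.A) (x : M) :
    mulFun f hf a x = (f x : ℂ) • a x := rfl

theorem norm_A_apply_le (a : E.A) (x : M) : ‖a x‖ ≤ ‖a‖ :=
  lp.norm_apply_le_norm ENNReal.top_ne_zero a.1 x

theorem norm_A_le {a : E.A} {C : ℝ} (hC : 0 ≤ C) (h : ∀ x, ‖a x‖ ≤ C) : ‖a‖ ≤ C :=
  lp.norm_le_of_forall_le hC h

theorem A_sub_apply (a b : E.A) (x : M) : (a - b) x = a x - b x := rfl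

section Module

variable {X : Type*} [NormedAddCommGroup X] [NormedSpace ℂ X] [SMul E.Aop X] [CStarModule E.Aop X]

theorem ip_act_right (x : M) (ζ ξ : X) (a : E.A) :
    E.ip x ζ (op a • ξ) = E.ip x ζ ξ * a x :=
  congrArg (fun a : E.Aop => a.unop x) (CStarModule.inner_op_smul_right (A := E.Aop))

theorem norm_ip_le (x : M) (ζ ξ : X) : ‖E.ip x ζ ξ‖ ≤ ‖ζ‖ * ‖ξ‖ :=
  (norm_A_apply_le _ x).trans (CStarModule.norm_inner_le (A := E.Aop) X)

theorem ip_sub_right (x : M) (ζ ξ η : X) : E.ip x ζ (ξ - η) = E.ip x ζ ξ - E.ip x ζ η :=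
  map_sub (E.ipL x ζ) ξ η

theorem ip_smul_right (x : M) (z : ℂ) (ζ ξ : X) : E.ip x ζ (z • ξ) = z • E.ip x ζ ξ :=
  map_smul (E.ipL x ζ) z ξ

/-- `A` carries the supremum norm, so norms in a Hilbert `A`-module can be estimated one fibre at a
time. Most norm bounds below rest on this. -/
theorem norm_sq_le_of_ip {ξ : X} {C : ℝ} (hC : 0 ≤ C) (h : ∀ x, ‖E.ip x ξ ξ‖ ≤ C) :
    ‖ξ‖ ^ 2 ≤ C := by
  rw [CStarModule.norm_sq_eq E.Aop]
  exact norm_A_le hC h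

theorem eq_zero_of_ip {ξ : X} (h : ∀ x, E.ip x ξ ξ = 0) : ξ = 0 := by
  have := norm_sq_le_of_ip (E := E) (ξ := ξ) le_rfl fun x => by simp [h x]
  rw [← norm_eq_zero]
  exact pow_eq_zero_iff two_ne_zero |>.1 (le_antisymm this (sq_nonneg _))

theorem eq_of_ip {ξ η : X} (h : ∀ (x : M) (ζ : X), E.ip x ζ ξ = E.ip x ζ η) : ξ = η := by
  rw [← sub_eq_zero]
  refine eq_zero_of_ip (E := E) fun x => ?_
  rw [ip_sub_right, h, sub_self]

theorem val_eq_val_iff {x : M} {ξ η : X} :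
    E.val x ξ = E.val x η ↔ ∀ ζ : X, E.ip x ζ ξ = E.ip x ζ η := by
  rw [← sub_eq_zero, ← map_sub]
  change (Submodule.Quotient.mk (ξ - η) : X ⧸ E.nullAt X x) = 0 ↔ _
  rw [Submodule.Quotient.mk_eq_zero]
  change (∀ ζ : X, E.ip x ζ (ξ - η) = 0) ↔ _
  simp only [ip_sub_right, sub_eq_zero]

/-- Identities in `X` may be checked pointwise on M; linearity of the maps defined by integrals is
obtained in this way. -/
theorem eq_of_val {ξ η : X} (h : ∀ x : M, E.val x ξ = E.val x η) : ξ = η :=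
  eq_of_ip fun x => val_eq_val_iff.1 (h x)

theorem norm_le_of_fibNorm {ξ : X} {C : ℝ} (hC : 0 ≤ C)
    (h : ∀ x : M, E.fibNorm (E.val x ξ) ≤ C) : ‖ξ‖ ≤ C := by
  refine le_of_sq_le_sq ?_ hC
  refine norm_sq_le_of_ip (E := E) (sq_nonneg _) fun x => ?_
  have : √‖E.ip x ξ ξ‖ ^ 2 ≤ C ^ 2 := pow_le_pow_left₀ (Real.sqrt_nonneg _) (h x) 2
  rwa [Real.sq_sqrt (norm_nonneg _)] at this

theorem fibNorm_val_le (x : M) (ξ : X) : E.fibNorm (E.val x ξ) ≤ ‖ξ‖ := by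
  refine Real.sqrt_le_iff.2 ⟨norm_nonneg _, ?_⟩
  rw [fibInner_val, sq]
  exact norm_ip_le x ξ ξ

theorem fibNorm_smul {x : M} (c : ℂ) (z : E.Fib X x) : E.fibNorm (c • z) = ‖c‖ * E.fibNorm z := by
  unfold fibNorm
  rw [map_smul, map_smulₛₗ, LinearMap.smul_apply, norm_smul, norm_smul, ← _root_.mul_assoc,
    Real.sqrt_mul (by positivity)]
  simp

/-- The norm of `ξ(x)` is upper semicontinuous in `x`. -/
theorem upperSemicontinuous_fibNorm (ξ : X) :
    UpperSemicontinuous fun x : M => E.fibNorm (E.val x ξ) := by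
  intro x r hr
  have hr0 : 0 < r := (Real.sqrt_nonneg _).trans_lt hr
  have h1 : ‖E.ip x ξ ξ‖ < r ^ 2 := (Real.sqrt_lt' hr0).1 hr
  have := (A_continuous (inner E.Aop ξ ξ).unop).continuousAt.eventually (E.norm_usc _ _ h1)
  filter_upwards [this] with y hy
  exact (Real.sqrt_lt' hr0).2 hy

/-! ### Fibres of a complete Hilbert module as Banach spaces -/

section Complete

variable [CompleteSpace X]

/-- Multiplication of an element of a Hilbert module by a bounded function on the base. -/
theorem exists_funMul (f : C(M, ℝ)) {C : ℝ} (hf : ∀ x, |f x| ≤ C) (ξ : X) :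
    ∃ η : X, ∀ x, E.val x η = (f x : ℂ) • E.val x ξ := by
  -- Functions act on `A`, and through it on `X`: ξ is the limit of elements ξ a_n, and the element
  -- sought is the limit of ξ (f a_n).
  have hne : ∀ n : ℕ, ∃ a : E.A, ‖ξ - op a • ξ‖ < 1 / ((n : ℝ) + 1) := fun n => by
    obtain ⟨b, hb⟩ := CStarModule.exists_norm_sub_smul_lt (B := E.Aop) ξ
      (show 0 < 1 / ((n : ℝ) + 1) by positivity)
    exact ⟨b.unop, hb⟩
  choose a ha using hne
  have hval : ∀ (a : E.A) x (ζ : X), E.ip x ζ (op (mulFun f hf a) • ξ)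
      = (f x : ℂ) • E.ip x ζ (op a • ξ) := fun a x ζ => by
    rw [ip_act_right, ip_act_right, mulFun_apply, mul_smul_comm]
  have hval' : ∀ (a : E.A) x, E.val x (op (mulFun f hf a) • ξ)
      = (f x : ℂ) • E.val x (op a • ξ) := fun a x => by
    rw [← map_smul, val_eq_val_iff]
    intro ζ
    rw [hval, ip_smul_right]
  have hlim : Tendsto (fun n => op (a n) • ξ) atTop (𝓝 ξ) := by
    rw [tendsto_iff_norm_sub_tendsto_zero]
    refine squeeze_zero (fun _ => norm_nonneg _) (fun n => ?_)
      tendsto_one_div_add_atTop_nhds_zero_nat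
    rw [norm_sub_rev]
    exact (ha n).le
  set η : ℕ → X := fun n => op (mulFun f hf (a n)) • ξ
  -- In each fibre the difference is f(x) times the difference of the ξ a_n, so the bound on f makes
  -- the new sequence Cauchy.
  have hdist : ∀ m n, ‖η m - η n‖ ≤ |C| * ‖op (a m) • ξ - op (a n) • ξ‖ := fun m n => by
    refine norm_le_of_fibNorm (E := E) (by positivity) fun x => ?_
    rw [map_sub, hval', hval', ← smul_sub, ← map_sub, fibNorm_smul, Complex.norm_real]
    exact mul_le_mul ((hf x).trans (le_abs_self C)) (fibNorm_val_le _ _) (Real.sqrt_nonneg _)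
      (abs_nonneg _)
  have hcau : CauchySeq η := by
    have h0 := hlim.cauchySeq
    rw [Metric.cauchySeq_iff] at h0 ⊢
    intro ε hε
    obtain ⟨N, hN⟩ := h0 (ε / (|C| + 1)) (by positivity)
    refine ⟨N, fun m hm n hn => ?_⟩
    have := hN m hm n hn
    rw [dist_eq_norm, lt_div_iff₀ (by positivity)] at this
    rw [dist_eq_norm]
    nlinarith [hdist m n, norm_nonneg (op (a m) • ξ - op (a n) • ξ)]
  obtain ⟨η₀, hη₀⟩ := cauchySeq_tendsto_of_complete hcau
  refine ⟨η₀, fun x => ?_⟩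
  rw [← map_smul, val_eq_val_iff]
  intro ζ
  have hc : ∀ {u : ℕ → X} {v : X}, Tendsto u atTop (𝓝 v) →
      Tendsto (fun n => E.ip x ζ (u n)) atTop (𝓝 (E.ip x ζ v)) := by
    intro u v huv
    rw [tendsto_iff_norm_sub_tendsto_zero] at huv ⊢
    refine squeeze_zero (fun _ => norm_nonneg _) (fun n => ?_)
      (by simpa using huv.const_mul ‖ζ‖)
    rw [← ip_sub_right]
    exact norm_ip_le x ζ _
  refine tendsto_nhds_unique (hc hη₀) ?_
  rw [ip_smul_right]
  refine ((hc hlim).const_smul (f x : ℂ)).congr fun n => ?_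
  rw [hval]

variable [T2Space Γ] [LocallyCompactSpace Γ]

/-- Every element of a fibre lifts with almost the same norm. -/
theorem exists_lift {x : M} (z : E.Fib X x) {r : ℝ} (hr : E.fibNorm z < r) :
    ∃ ξ : X, E.val x ξ = z ∧ ‖ξ‖ ≤ r := by
  obtain ⟨ξ, rfl⟩ := E.val_surjective x z
  -- By upper semicontinuity the norm of a first lift stays below r on a neighbourhood of x. A bump
  -- function that vanishes outside it cuts the lift down without changing its value at x.
  obtain ⟨U, hU, hUo, hxU⟩ := eventually_nhds_iff.1 (upperSemicontinuous_fibNorm (E := E) ξ x r hr)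
  obtain ⟨f, hf1, hf0, -, hf⟩ := 𝒢.exists_bump isCompact_singleton hUo (singleton_subset_iff.2 hxU)
  obtain ⟨η, hη⟩ := exists_funMul (E := E) f (C := 1)
    (fun y => abs_le.2 ⟨by linarith [(hf y).1], (hf y).2⟩) ξ
  have hr0 : 0 ≤ r := (Real.sqrt_nonneg _).trans hr.le
  refine ⟨η, ?_, norm_le_of_fibNorm (E := E) hr0 fun y => ?_⟩
  · rw [hη, hf1 rfl]
    simp
  · rw [hη, fibNorm_smul, Complex.norm_real, Real.norm_of_nonneg (hf y).1]
    by_cases hy : y ∈ U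
    · calc _ ≤ 1 * E.fibNorm (E.val y ξ) :=
            mul_le_mul_of_nonneg_right (hf y).2 (Real.sqrt_nonneg _)
        _ ≤ r := by rw [one_mul]; exact (hU y hy).le
    · rw [hf0 y hy, zero_mul]
      exact hr0

/-- Cauchy–Schwarz is inherited from `X`: lift both vectors with nearly the same norm and let the
excess tend to 0. -/
theorem norm_fibInner_le {x : M} (z w : E.Fib X x) :
    ‖E.fibInner x z w‖ ≤ E.fibNorm z * E.fibNorm w := by
  have h : ∀ ε > 0, ‖E.fibInner x z w‖ ≤ (E.fibNorm z + ε) * (E.fibNorm w + ε) := by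
    intro ε hε
    obtain ⟨ξ, rfl, hξ⟩ := exists_lift z (lt_add_of_pos_right _ hε)
    obtain ⟨η, rfl, hη⟩ := exists_lift w (lt_add_of_pos_right _ hε)
    exact (norm_ip_le x ξ η).trans (mul_le_mul hξ hη (norm_nonneg _) ((norm_nonneg _).trans hξ))
  have hlim : Tendsto (fun ε : ℝ => (E.fibNorm z + ε) * (E.fibNorm w + ε)) (𝓝[>] 0)
      (𝓝 (E.fibNorm z * E.fibNorm w)) := by
    have : Continuous fun ε : ℝ => (E.fibNorm z + ε) * (E.fibNorm w + ε) := by fun_prop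
    simpa using (this.tendsto 0).mono_left nhdsWithin_le_nhds
  exact ge_of_tendsto hlim (eventually_mem_nhdsWithin.mono h)

theorem fibNorm_add_le {x : M} (z w : E.Fib X x) :
    E.fibNorm (z + w) ≤ E.fibNorm z + E.fibNorm w := by
  refine le_of_forall_pos_le_add fun ε hε => ?_
  obtain ⟨ξ, rfl, hξ⟩ := exists_lift z (lt_add_of_pos_right _ (half_pos hε))
  obtain ⟨η, rfl, hη⟩ := exists_lift w (lt_add_of_pos_right _ (half_pos hε))
  rw [← map_add]
  refine (fibNorm_val_le _ _).trans ((norm_add_le _ _).trans ?_)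
  linarith

noncomputable instance (x : M) : Norm (E.Fib X x) := ⟨E.fibNorm⟩

theorem fib_norm_def {x : M} (z : E.Fib X x) : ‖z‖ = E.fibNorm z := rfl

theorem eq_zero_of_fibInner {x : M} {z : E.Fib X x} (h : ∀ w, E.fibInner x w z = 0) : z = 0 := by
  obtain ⟨ξ, rfl⟩ := E.val_surjective x z
  rw [← map_zero (E.val x), val_eq_val_iff]
  intro ζ
  exact (h (E.val x ζ)).trans (map_zero (E.ipL x ζ)).symm

theorem fib_normedCore (x : M) : NormedSpace.Core ℂ (E.Fib X x) where
  norm_nonneg _ := Real.sqrt_nonneg _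
  norm_smul := fibNorm_smul
  norm_triangle := fibNorm_add_le
  norm_eq_zero_iff z := by
    constructor
    · intro h
      refine eq_zero_of_fibInner fun w => ?_
      have := norm_fibInner_le w z
      rw [show E.fibNorm z = 0 from h, mul_zero] at this
      exact norm_le_zero_iff.1 this
    · rintro rfl
      change E.fibNorm 0 = 0
      unfold fibNorm
      simp

noncomputable instance (x : M) : NormedAddCommGroup (E.Fib X x) :=
  NormedAddCommGroup.ofCore (fib_normedCore x)

noncomputable instance (x : M) : NormedSpace ℂ (E.Fib X x) := NormedSpace.ofCore (fib_normedCore x)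

theorem norm_val_le (x : M) (ξ : X) : ‖E.val x ξ‖ ≤ ‖ξ‖ := fibNorm_val_le x ξ

theorem norm_fib_sq {x : M} (z : E.Fib X x) : ‖z‖ ^ 2 = ‖E.fibInner x z z‖ :=
  Real.sq_sqrt (norm_nonneg _)

variable (E X) in
/-- Evaluation at `x` as a continuous linear map. -/
noncomputable def valL (x : M) : X →L[ℂ] E.Fib X x :=
  (E.val x).mkContinuous 1 fun ξ => by rw [one_mul]; exact norm_val_le x ξ

theorem valL_apply (x : M) (ξ : X) : valL E X x ξ = E.val x ξ := rfl

variable (E X) in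
/-- The inner product of a fibre as a continuous sesquilinear map. -/
noncomputable def fibInnerL (x : M) : E.Fib X x →L⋆[ℂ] E.Fib X x →L[ℂ] E.unitFiber x :=
  LinearMap.mkContinuous₂ (E.fibInner x) 1 fun z w => by
    rw [one_mul]
    exact norm_fibInner_le z w

theorem fibInnerL_apply {x : M} (z w : E.Fib X x) : fibInnerL E X x z w = E.fibInner x z w := rfl

theorem star_fibInner {x : M} (z w : E.Fib X x) :
    Star.star (E.fibInner x z w) = E.fibInner x w z := by
  obtain ⟨ξ, rfl⟩ := E.val_surjective x z
  obtain ⟨η, rfl⟩ := E.val_surjective x w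
  exact E.star_ip x ξ η

/-- An absolutely convergent series in the fibre lifts to one in `X`, with an excess of 2^{-n}
allowed in the norm of the n-th lift. -/
instance (x : M) : CompleteSpace (E.Fib X x) := by
  refine NormedAddCommGroup.completeSpace_of_summable_imp_tendsto fun u hu => ?_
  have : ∀ n, ∃ ξ : X, E.val x ξ = u n ∧ ‖ξ‖ ≤ ‖u n‖ + (1 / 2) ^ n := fun n =>
    exists_lift (u n) (lt_add_of_pos_right _ (by positivity))
  choose ξ hξ hξn using this
  have hs : Summable fun n => ‖ξ n‖ := Summable.of_nonneg_of_le (fun _ => norm_nonneg _) hξn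
    (hu.add (summable_geometric_of_lt_one (by norm_num) (by norm_num)))
  have := hs.of_norm.hasSum.tendsto_sum_nat
  refine ⟨E.val x (∑' n, ξ n), ?_⟩
  have h2 := ((valL E X x).continuous.tendsto _).comp this
  refine h2.congr fun n => ?_
  simp only [Function.comp_apply, map_sum, valL_apply, hξ]

end Complete

end Module

end FellBundle

namespace FellBundle

variable {Γ M : Type*} [TopologicalSpace Γ] [TopologicalSpace M] {𝒢 : TopGroupoid Γ M}
  {E : FellBundle 𝒢}

/-- ‖a‖² = ‖a* a‖ ≤ ‖a*‖ ‖a‖ gives one inequality, and the same applied to a* gives the other. -/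
theorem norm_star_eq {g k : Γ} (c : 𝒢.inv g = k) (a : E.fiber g) : ‖E.star c a‖ = ‖a‖ := by
  have key : ∀ {g k : Γ} (c : 𝒢.inv g = k) (a : E.fiber g), ‖a‖ ≤ ‖E.star c a‖ := by
    rintro g k rfl a
    rcases eq_or_ne ‖a‖ 0 with h | h
    · rw [h]
      exact norm_nonneg _
    have h1 := E.norm_star_mul_self rfl (TopGroupoid.comp_inv_self rfl) a
    have h2 := E.norm_mul_le (TopGroupoid.comp_inv_self (g := g) rfl) (E.star rfl a) a
    rw [h1, sq] at h2
    exact le_of_mul_le_mul_right h2 (lt_of_le_of_ne (norm_nonneg _) h.symm)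
  refine le_antisymm ?_ (key c a)
  have := key (show 𝒢.inv k = g by rw [← c, 𝒢.inv_inv]) (E.star c a)
  rwa [E.star_star] at this

end FellBundle

/-! ### Equivariant adjointable operators: their C⋆-algebra and polar decomposition -/

section Operators

open FellBundle

variable {Γ M : Type*} [TopologicalSpace Γ] [TopologicalSpace M] {𝒢 : TopGroupoid Γ M}
  [T2Space Γ] [LocallyCompactSpace Γ] {E : FellBundle 𝒢}
  {X Y Z : Type*} [NormedAddCommGroup X] [NormedSpace ℂ X] [CompleteSpace X] [SMul E.Aop X]
  [CStarModule E.Aop X] [NormedAddCommGroup Y] [NormedSpace ℂ Y] [CompleteSpace Y]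
  [SMul E.Aop Y] [CStarModule E.Aop Y] [NormedAddCommGroup Z] [NormedSpace ℂ Z]
  [CompleteSpace Z] [SMul E.Aop Z] [CStarModule E.Aop Z]

namespace EquivariantStructure

theorem norm_act_le (α : EquivariantStructure E X) {g : Γ} {x y : M} (ht : 𝒢.tgt g = y)
    (hs : 𝒢.src g = x) (z : E.Fib X y) (e : E.fiber g) : ‖α.act ht hs z e‖ ≤ ‖z‖ * ‖e‖ := by
  refine le_of_sq_le_sq ?_ (by positivity)
  rw [norm_fib_sq, α.inner_act]
  refine (E.norm_mul_le _ _ _).trans ?_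
  rw [norm_star_eq, mul_pow, norm_fib_sq]
  nlinarith [E.norm_mul_le (TopGroupoid.comp_unit_left ht) (E.fibInner y z z) e, norm_nonneg e]

/-- The action of `e` as a continuous linear map between fibres. -/
noncomputable def actL (α : EquivariantStructure E X) {g : Γ} {x y : M} (ht : 𝒢.tgt g = y)
    (hs : 𝒢.src g = x) (e : E.fiber g) : E.Fib X y →L[ℂ] E.Fib X x :=
  ((α.act ht hs).flip e).mkContinuous ‖e‖ fun z => (α.norm_act_le ht hs z e).trans_eq (mul_comm _ _)

theorem actL_apply (α : EquivariantStructure E X) {g : Γ} {x y : M} (ht : 𝒢.tgt g = y)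
    (hs : 𝒢.src g = x) (e : E.fiber g) (z : E.Fib X y) : α.actL ht hs e z = α.act ht hs z e := rfl

/-- Elements of a fibre are determined by their inner products with the elements `z e`. -/
theorem eq_of_fibInner_act (α : EquivariantStructure E X) {g : Γ} {x y : M} (ht : 𝒢.tgt g = y)
    (hs : 𝒢.src g = x) {u v : E.Fib X x}
    (h : ∀ z e, E.fibInner x (α.act ht hs z e) u = E.fibInner x (α.act ht hs z e) v) : u = v := by
  rw [← sub_eq_zero]
  set d := u - v with hd
  have h0 : ∀ w ∈ Submodule.span ℂ (range fun p : E.Fib X y × E.fiber g => α.act ht hs p.1 p.2),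
      E.fibInner x w d = 0 := by
    intro w hw
    induction hw using Submodule.span_induction with
    | mem w hw =>
      obtain ⟨p, rfl⟩ := hw
      rw [hd, map_sub, h, sub_self]
    | zero => simp
    | add w w' _ _ h h' => rw [map_add, LinearMap.add_apply, h, h', add_zero]
    | smul c w _ h => rw [map_smulₛₗ, LinearMap.smul_apply, h, smul_zero]
  rw [← norm_le_zero_iff]
  refine le_of_forall_pos_le_add fun ε hε => ?_
  obtain ⟨w, hw, hwε⟩ := α.dense_act ht hs d ε hε
  rw [zero_add]
  rcases eq_or_ne ‖d‖ 0 with hd0 | hd0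
  · rw [hd0]
    exact hε.le
  -- The vector d is orthogonal to the dense span, so ⟨d, d⟩ = ⟨d - w, d⟩ for every w in it, in
  -- particular for one close to d.
  have h1 : ‖d‖ ^ 2 ≤ E.fibNorm (d - w) * ‖d‖ := by
    rw [norm_fib_sq]
    calc ‖E.fibInner x d d‖ = ‖E.fibInner x (d - w) d‖ := by
          rw [map_sub (E.fibInner x) d w, LinearMap.sub_apply, h0 w hw, sub_zero]
      _ ≤ _ := norm_fibInner_le _ _
  rw [sq] at h1
  exact (le_of_mul_le_mul_right h1 (lt_of_le_of_ne (norm_nonneg _) hd0.symm)).trans hwε.le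

end EquivariantStructure

/-- `T` is an adjointable operator with adjoint `S` that intertwines the actions. -/
structure IsEquivariantAdjoint (α : EquivariantStructure E X) (β : EquivariantStructure E Y)
    (T : X →L[ℂ] Y) (S : Y →L[ℂ] X) : Prop where
  adj : ∀ ξ η, inner E.Aop η (T ξ) = inner E.Aop (S η) ξ
  -- Expressed on representatives ξ, ξ' in `X`; evaluation at a point is onto, so all vectors of the
  -- fibres are covered.
  equivariant : ∀ {g : Γ} {x y : M} (ht : 𝒢.tgt g = y) (hs : 𝒢.src g = x) (e : E.fiber g)
    (ξ ξ' : X), α.act ht hs (E.val y ξ) e = E.val x ξ' →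
      β.act ht hs (E.val y (T ξ)) e = E.val x (T ξ')

namespace IsEquivariantAdjoint

variable {α : EquivariantStructure E X} {β : EquivariantStructure E Y}
  {γ : EquivariantStructure E Z} {T T' : X →L[ℂ] Y} {S S' : Y →L[ℂ] X}

theorem adj' (h : IsEquivariantAdjoint α β T S) (ξ : X) (η : Y) :
    inner E.Aop (T ξ) η = inner E.Aop ξ (S η) := by
  rw [← CStarModule.star_inner η, h.adj, CStarModule.star_inner]

theorem ip_adj (h : IsEquivariantAdjoint α β T S) (x : M) (ξ : X) (η : Y) :
    E.ip x η (T ξ) = E.ip x (S η) ξ :=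
  congrArg (fun a : E.Aop => a.unop x) (h.adj ξ η)

/-- Equivariance of the adjoint is automatic. Against the total vectors η e', one has ⟨η e', (S ξ)
e⟩ = e'* ⟨T η, ξ⟩ e = ⟨(T η) e', ξ e⟩, and equivariance of T turns this into ⟨η e', S (ξ e)⟩. -/
theorem symm (h : IsEquivariantAdjoint α β T S) : IsEquivariantAdjoint β α S T where
  adj ξ η := (h.adj' η ξ).symm
  equivariant {g x y} ht hs e ξ ξ' hξ := by
    refine α.eq_of_fibInner_act ht hs fun z e' => ?_
    obtain ⟨η, rfl⟩ := E.val_surjective y z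
    obtain ⟨η', hη'⟩ := E.val_surjective x (α.act ht hs (E.val y η) e')
    rw [α.inner_act]
    have e1 : E.fibInner y (E.val y η) (E.val y (S ξ))
        = E.fibInner y (E.val y (T η)) (E.val y ξ) :=
      congrArg (fun a : E.Aop => a.unop y) (h.adj' η ξ).symm
    have e2 : E.fibInner x (E.val x η') (E.val x (S ξ'))
        = E.fibInner x (E.val x (T η')) (E.val x ξ') :=
      congrArg (fun a : E.Aop => a.unop x) (h.adj' η' ξ').symm
    rw [e1, ← β.inner_act ht hs, h.equivariant ht hs e' η η' hη'.symm, hξ, ← hη', e2]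

theorem comp {T₂ : Y →L[ℂ] Z} {S₂ : Z →L[ℂ] Y} (h₂ : IsEquivariantAdjoint β γ T₂ S₂)
    (h : IsEquivariantAdjoint α β T S) : IsEquivariantAdjoint α γ (T₂.comp T) (S.comp S₂) where
  adj ξ η := by
    simp only [ContinuousLinearMap.comp_apply]
    rw [h₂.adj, h.adj]
  equivariant ht hs e ξ ξ' hξ := h₂.equivariant ht hs e _ _ (h.equivariant ht hs e ξ ξ' hξ)

theorem add (h : IsEquivariantAdjoint α β T S) (h' : IsEquivariantAdjoint α β T' S') :
    IsEquivariantAdjoint α β (T + T') (S + S') where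
  adj ξ η := by
    simp only [_root_.add_apply, CStarModule.inner_add_left,
      CStarModule.inner_add_right, h.adj, h'.adj]
  equivariant ht hs e ξ ξ' hξ := by
    simp only [_root_.add_apply, map_add, LinearMap.add_apply,
      h.equivariant ht hs e ξ ξ' hξ, h'.equivariant ht hs e ξ ξ' hξ]

theorem smul (h : IsEquivariantAdjoint α β T S) (c : ℂ) :
    IsEquivariantAdjoint α β (c • T) ((starRingEnd ℂ c) • S) where
  adj ξ η := by
    simp only [_root_.smul_apply, CStarModule.inner_smul_left_complex,
      CStarModule.inner_smul_right_complex, h.adj]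
    simp
  equivariant ht hs e ξ ξ' hξ := by
    simp only [_root_.smul_apply, map_smul, LinearMap.smul_apply,
      h.equivariant ht hs e ξ ξ' hξ]

variable (α β) in
theorem zero : IsEquivariantAdjoint α β 0 0 where
  adj := by simp
  equivariant := by simp

variable (α) in
theorem id : IsEquivariantAdjoint α α (ContinuousLinearMap.id ℂ X) (ContinuousLinearMap.id ℂ X) where
  adj _ _ := rfl
  equivariant _ _ _ _ _ hξ := hξ

theorem unique_right (h : IsEquivariantAdjoint α β T S) (h' : IsEquivariantAdjoint α β T S') :
    S = S' := by
  ext η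
  refine eq_of_ip (E := E) fun x ζ => ?_
  rw [h.symm.ip_adj, h'.symm.ip_adj]

/-- Both conditions survive pointwise limits of operators and adjoints. This serves series of
operators as well as the closedness of the algebra of equivariant operators. -/
theorem of_tendsto {T : ℕ → X →L[ℂ] Y} {S : ℕ → Y →L[ℂ] X} {T₀ : X →L[ℂ] Y} {S₀ : Y →L[ℂ] X}
    (h : ∀ n, IsEquivariantAdjoint α β (T n) (S n)) (hT : Tendsto T atTop (𝓝 T₀))
    (hS : Tendsto S atTop (𝓝 S₀)) : IsEquivariantAdjoint α β T₀ S₀ := by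
  have hTp : ∀ ξ, Tendsto (fun n => T n ξ) atTop (𝓝 (T₀ ξ)) := fun ξ =>
    ((ContinuousLinearMap.apply ℂ Y ξ).continuous.tendsto T₀).comp hT
  have hSp : ∀ ξ, Tendsto (fun n => S n ξ) atTop (𝓝 (S₀ ξ)) := fun ξ =>
    ((ContinuousLinearMap.apply ℂ X ξ).continuous.tendsto S₀).comp hS
  constructor
  · intro ξ η
    have h1 : Tendsto (fun n => inner E.Aop η (T n ξ)) atTop (𝓝 (inner E.Aop η (T₀ ξ))) :=
      (CStarModule.continuous_inner.tendsto (η, T₀ ξ)).comp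
        (tendsto_const_nhds.prodMk_nhds (hTp ξ))
    have h2 : Tendsto (fun n => inner E.Aop (S n η) ξ) atTop (𝓝 (inner E.Aop (S₀ η) ξ)) :=
      (CStarModule.continuous_inner.tendsto (S₀ η, ξ)).comp
        ((hSp η).prodMk_nhds tendsto_const_nhds)
    exact tendsto_nhds_unique h1 (h2.congr fun n => ((h n).adj ξ η).symm)
  · intro g x y ht hs e ξ ξ' hξ
    have h1 : Tendsto (fun n => β.act ht hs (E.val y (T n ξ)) e) atTop
        (𝓝 (β.act ht hs (E.val y (T₀ ξ)) e)) :=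
      (((β.actL ht hs e).comp (valL E Y y)).continuous.tendsto _).comp (hTp ξ)
    have h2 : Tendsto (fun n => E.val x (T n ξ')) atTop (𝓝 (E.val x (T₀ ξ'))) :=
      ((valL E Y x).continuous.tendsto _).comp (hTp ξ')
    exact tendsto_nhds_unique h1 (h2.congr fun n => ((h n).equivariant ht hs e ξ ξ' hξ).symm)

theorem norm_le (h : IsEquivariantAdjoint α β T S) : ‖S‖ ≤ ‖T‖ := by
  refine S.opNorm_le_bound (norm_nonneg _) fun η => ?_
  rcases eq_or_ne ‖S η‖ 0 with h0 | h0
  · rw [h0]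
    positivity
  have h1 : ‖S η‖ ^ 2 ≤ ‖T‖ * ‖η‖ * ‖S η‖ := by
    rw [CStarModule.norm_sq_eq E.Aop, ← h.adj]
    refine (CStarModule.norm_inner_le (A := E.Aop) Y).trans ?_
    nlinarith [T.le_opNorm (S η), norm_nonneg η]
  rw [sq] at h1
  exact le_of_mul_le_mul_right h1 (lt_of_le_of_ne (norm_nonneg _) h0.symm)

theorem norm_eq (h : IsEquivariantAdjoint α β T S) : ‖S‖ = ‖T‖ :=
  le_antisymm h.norm_le h.symm.norm_le

/-- The C⋆-inequality, from ‖T ξ‖² = ‖⟨ξ, S T ξ⟩‖ ≤ ‖S T‖ ‖ξ‖². -/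
theorem norm_sq_le (h : IsEquivariantAdjoint α β T S) : ‖T‖ * ‖T‖ ≤ ‖S.comp T‖ := by
  rw [← sq, ← Real.le_sqrt (norm_nonneg _) (norm_nonneg _)]
  refine T.opNorm_le_bound (Real.sqrt_nonneg _) fun ξ => ?_
  refine le_of_sq_le_sq ?_ (by positivity)
  rw [mul_pow, Real.sq_sqrt (norm_nonneg _), CStarModule.norm_sq_eq E.Aop, h.adj']
  refine (CStarModule.norm_inner_le (A := E.Aop) X).trans ?_
  have := (S.comp T).le_opNorm ξ
  rw [ContinuousLinearMap.comp_apply] at this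
  nlinarith [norm_nonneg ξ]

theorem sum {ι : Type*} (s : Finset ι) {T : ι → X →L[ℂ] Y} {S : ι → Y →L[ℂ] X}
    (h : ∀ i, IsEquivariantAdjoint α β (T i) (S i)) :
    IsEquivariantAdjoint α β (∑ i ∈ s, T i) (∑ i ∈ s, S i) := by
  classical
  induction s using Finset.induction_on with
  | empty => simpa using zero α β
  | insert i s hi ih =>
    rw [Finset.sum_insert hi, Finset.sum_insert hi]
    exact (h i).add ih

theorem tsum {T : ℕ → X →L[ℂ] Y} {S : ℕ → Y →L[ℂ] X}
    (h : ∀ n, IsEquivariantAdjoint α β (T n) (S n)) (hT : Summable fun n => ‖T n‖) :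
    IsEquivariantAdjoint α β (∑' n, T n) (∑' n, S n) := by
  have hS : Summable fun n => ‖S n‖ := by simpa only [(h _).norm_eq] using hT
  exact of_tendsto (fun n => sum (Finset.range n) h) hT.of_norm.hasSum.tendsto_sum_nat
    hS.of_norm.hasSum.tendsto_sum_nat

end IsEquivariantAdjoint

/-- The algebra of equivariant adjointable operators. -/
def equivariantAlgebra (α : EquivariantStructure E X) : Subalgebra ℂ (X →L[ℂ] X) where
  carrier := {T | ∃ S, IsEquivariantAdjoint α α T S}
  mul_mem' := by
    rintro T T' ⟨S, h⟩ ⟨S', h'⟩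
    exact ⟨_, h.comp h'⟩
  add_mem' := by
    rintro T T' ⟨S, h⟩ ⟨S', h'⟩
    exact ⟨_, h.add h'⟩
  algebraMap_mem' c := by
    rw [Algebra.algebraMap_eq_smul_one]
    exact ⟨_, (IsEquivariantAdjoint.id α).smul c⟩

namespace equivariantAlgebra

variable (α : EquivariantStructure E X)

/-- The adjoint of an equivariant adjointable operator. -/
noncomputable def adjoint (T : equivariantAlgebra α) : X →L[ℂ] X := T.2.choose

variable {α}

theorem adjoint_spec (T : equivariantAlgebra α) : IsEquivariantAdjoint α α T.1 (adjoint α T) :=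
  T.2.choose_spec

theorem adjoint_eq {T : equivariantAlgebra α} {S : X →L[ℂ] X}
    (h : IsEquivariantAdjoint α α T.1 S) : adjoint α T = S :=
  (adjoint_spec T).unique_right h

noncomputable instance : StarRing (equivariantAlgebra α) where
  star T := ⟨adjoint α T, T.1, (adjoint_spec T).symm⟩
  star_involutive T := Subtype.ext (adjoint_eq (adjoint_spec T).symm)
  star_mul T T' := Subtype.ext (adjoint_eq ((adjoint_spec T).comp (adjoint_spec T')))
  star_add T T' := Subtype.ext (adjoint_eq ((adjoint_spec T).add (adjoint_spec T')))

theorem star_coe (T : equivariantAlgebra α) : (star T : equivariantAlgebra α).1 = adjoint α T := rfl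

/-- Passing to adjoints is isometric, so the adjoints of a convergent sequence form a Cauchy
sequence, whose limit is the adjoint of the limit. -/
theorem isClosed_equivariantAlgebra : IsClosed (equivariantAlgebra α : Set (X →L[ℂ] X)) := by
  refine isSeqClosed_iff_isClosed.1 fun T T₀ hT hT₀ => ?_
  choose S hS using hT
  have hc : CauchySeq S := by
    have h0 := hT₀.cauchySeq
    rw [Metric.cauchySeq_iff] at h0 ⊢
    intro ε hε
    obtain ⟨N, hN⟩ := h0 ε hε
    refine ⟨N, fun m hm n hn => ?_⟩
    have := hN m hm n hn
    rw [dist_eq_norm] at this ⊢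
    have h2 := (hS m).add ((hS n).smul (-1))
    have h3 := h2.norm_eq
    simp only [map_neg, map_one, neg_smul, one_smul, ← sub_eq_add_neg] at h3
    rwa [h3]
  obtain ⟨S₀, hS₀⟩ := cauchySeq_tendsto_of_complete hc
  exact ⟨S₀, IsEquivariantAdjoint.of_tendsto hS hT₀ hS₀⟩

instance : CompleteSpace (equivariantAlgebra α) :=
  (isClosed_equivariantAlgebra (α := α)).completeSpace_coe

noncomputable instance : CStarAlgebra (equivariantAlgebra α) where
  norm_mul_self_le T := (adjoint_spec T).norm_sq_le
  star_smul c T := Subtype.ext (adjoint_eq ((adjoint_spec T).smul c))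

theorem inner_apply_right (T : equivariantAlgebra α) (ξ η : X) :
    inner E.Aop ξ (T.1 η) = inner E.Aop ((star T).1 ξ) η := (adjoint_spec T).adj η ξ

/-- An operator `T* T` with `T` equivariant and adjointable has a self-adjoint square root. -/
theorem exists_sqrt {β : EquivariantStructure E Y} {T : X →L[ℂ] Y} {S : Y →L[ℂ] X}
    (h : IsEquivariantAdjoint α β T S) :
    ∃ P : X →L[ℂ] X, IsEquivariantAdjoint α α P P ∧ P.comp P = S.comp T := by
  set a : equivariantAlgebra α := ⟨S.comp T, _, h.symm.comp h⟩ with ha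
  have hsa : IsSelfAdjoint a := Subtype.ext (adjoint_eq (h.symm.comp h))
  -- The negative part n = e* e of a = T* T has to vanish. Since n (d* d) = 0, n a n = -n³, and so
  -- ⟨T n ξ, T n ξ⟩ + ⟨e n ξ, e n ξ⟩ = 0. Both terms are positive, hence e n = 0 and n² = e* e n =
  -- 0.
  obtain ⟨d, e, hde, h0⟩ := exists_posPart_negPart a hsa
  set n := star e * e with hn
  have hnsa : star n = n := by rw [hn, StarMul.star_mul, _root_.star_star]
  have hen : e * n = 0 := by
    refine Subtype.ext (ContinuousLinearMap.ext fun ξ => ?_)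
    change e.1 (n.1 ξ) = 0
    have hsum : inner E.Aop (T (n.1 ξ)) (T (n.1 ξ)) + inner E.Aop (e.1 (n.1 ξ)) (e.1 (n.1 ξ)) = 0 := by
      have e1 : inner E.Aop (T (n.1 ξ)) (T (n.1 ξ)) = inner E.Aop ξ ((n * a * n).1 ξ) := by
        rw [h.adj', show (n * a * n).1 ξ = n.1 (a.1 (n.1 ξ)) from rfl, inner_apply_right, hnsa]
        rfl
      have e2 : inner E.Aop (e.1 (n.1 ξ)) (e.1 (n.1 ξ)) = inner E.Aop ξ ((n * n * n).1 ξ) := by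
        rw [show (n * n * n).1 ξ = n.1 (n.1 (n.1 ξ)) from rfl, inner_apply_right n, hnsa,
          show n.1 (n.1 ξ) = (star e).1 (e.1 (n.1 ξ)) from rfl, inner_apply_right (star e),
          _root_.star_star]
      have e3 : n * a * n + n * n * n = 0 := by
        rw [hde, mul_sub, h0]
        simp
      rw [e1, e2, ← CStarModule.inner_add_right]
      have : (n * a * n).1 ξ + (n * n * n).1 ξ = (n * a * n + n * n * n).1 ξ := rfl
      rw [this, e3]
      exact CStarModule.inner_zero_right
    have h1 : (0 : E.Aop) ≤ inner E.Aop (T (n.1 ξ)) (T (n.1 ξ)) := CStarModule.inner_self_nonneg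
    have h2 : (0 : E.Aop) ≤ inner E.Aop (e.1 (n.1 ξ)) (e.1 (n.1 ξ)) := CStarModule.inner_self_nonneg
    exact CStarModule.inner_self.1 (((add_eq_zero_iff_of_nonneg h1 h2).1 hsum).2)
  have hn0 : n = 0 := by
    rw [← CStarRing.star_mul_self_eq_zero_iff, hnsa, hn, _root_.mul_assoc, ← hn, hen, mul_zero]
  let _ : PartialOrder (equivariantAlgebra α) := CStarAlgebra.spectralOrder _
  have _ : StarOrderedRing (equivariantAlgebra α) := CStarAlgebra.spectralOrderedRing _
  have hpos : 0 ≤ a := by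
    rw [hde, hn0, sub_zero]
    exact star_mul_self_nonneg d
  refine ⟨(CFC.sqrt a).1, ?_, congrArg Subtype.val (CFC.sqrt_mul_sqrt_self a hpos)⟩
  have h3 := adjoint_spec (CFC.sqrt a)
  rwa [← star_coe, (IsSelfAdjoint.of_nonneg (CFC.sqrt_nonneg a)).star_eq] at h3

end equivariantAlgebra

/-- Polar decomposition: an equivariant adjointable operator which, together with its adjoint, has
dense range, yields an isomorphism. -/
theorem IsEquivariantAdjoint.nonempty_equivariantIso {α : EquivariantStructure E X}
    {β : EquivariantStructure E Y} {T : X →L[ℂ] Y} {S : Y →L[ℂ] X}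
    (h : IsEquivariantAdjoint α β T S) (hT : DenseRange T) (hS : DenseRange S) :
    Nonempty (EquivariantIso α β) := by
  obtain ⟨P, hP, hPP⟩ := equivariantAlgebra.exists_sqrt h
  have hinner : ∀ ξ η, inner E.Aop (P ξ) (P η) = inner E.Aop (T ξ) (T η) := fun ξ η => by
    rw [hP.adj', h.adj', ← ContinuousLinearMap.comp_apply, hPP, ContinuousLinearMap.comp_apply]
  -- The range of P contains that of P² = S T, which is dense because the ranges of S and T are.
  have hPd : DenseRange P := by
    have h1 : DenseRange (S.comp T) := hS.comp hT S.continuous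
    rw [← hPP] at h1
    refine h1.mono ?_
    rintro _ ⟨ξ, rfl⟩
    exact ⟨P ξ, rfl⟩
  have hnorm : ∀ ξ, ‖T ξ‖ = ‖P ξ‖ := fun ξ => by
    rw [CStarModule.norm_eq_sqrt_norm_inner_self (A := E.Aop) (T ξ),
      CStarModule.norm_eq_sqrt_norm_inner_self (A := E.Aop) (P ξ), hinner]
  -- The assignment P ξ ↦ T ξ preserves inner products, so it is well defined and isometric on a
  -- dense subspace. U is its extension, the unitary part of T.
  set U : X →L[ℂ] Y := (T : X →ₗ[ℂ] Y).extendOfNorm (P : X →ₗ[ℂ] X) with hU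
  have hUP : ∀ ξ, U (P ξ) = T ξ := fun ξ =>
    LinearMap.extendOfNorm_eq (f := (T : X →ₗ[ℂ] Y)) (e := (P : X →ₗ[ℂ] X)) hPd
      ⟨1, fun ξ => by rw [one_mul]; exact (hnorm ξ).le⟩ ξ
  have hUi : ∀ ξ η, inner E.Aop (U ξ) (U η) = inner E.Aop ξ η := by
    intro ξ η
    refine hPd.induction_on₂ (p := fun ξ η => inner E.Aop (U ξ) (U η) = inner E.Aop ξ η) ?_ ?_ ξ η
    · exact isClosed_eq (CStarModule.continuous_inner.comp
        ((U.continuous.comp continuous_fst).prodMk (U.continuous.comp continuous_snd)))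
        CStarModule.continuous_inner
    · intro ξ η
      rw [hUP, hUP, hinner]
  have hUn : ∀ ξ, ‖U ξ‖ = ‖ξ‖ := fun ξ => by
    rw [CStarModule.norm_eq_sqrt_norm_inner_self (A := E.Aop) (U ξ),
      CStarModule.norm_eq_sqrt_norm_inner_self (A := E.Aop) ξ, hUi]
  have hiso : Isometry U := AddMonoidHomClass.isometry_of_norm U hUn
  have hsurj : Function.Surjective U := by
    rw [← range_eq_univ, ← hiso.isClosedEmbedding.isClosed_range.closure_eq]
    refine (hT.mono ?_).closure_eq
    rintro _ ⟨ξ, rfl⟩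
    exact ⟨P ξ, hUP ξ⟩
  let W : X ≃ₗ[ℂ] Y := LinearEquiv.ofBijective (U : X →ₗ[ℂ] Y) ⟨hiso.injective, hsurj⟩
  have hW : ∀ ξ, W ξ = U ξ := fun _ => rfl
  -- Module linearity is a consequence of the rest: U(a ξ) - a U(ξ) is orthogonal to every U(η), and
  -- U is onto.
  have hact : ∀ (a : E.Aop) (ξ : X), U (a • ξ) = a • U ξ := fun a ξ => by
    rw [← sub_eq_zero, ← CStarModule.inner_self (A := E.Aop)]
    have key : ∀ η, inner E.Aop (U η) (U (a • ξ) - a • U ξ) = 0 := fun η => by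
      rw [CStarModule.inner_sub_right, hUi, CStarModule.inner_op_smul_right,
        CStarModule.inner_op_smul_right, hUi, sub_self]
    obtain ⟨η, hη⟩ := hsurj (U (a • ξ) - a • U ξ)
    have := key η
    rwa [hη] at this
  let V : E.HilbertModuleIso X Y :=
    { W with
      map_act := hact
      inner_map := hUi }
  refine ⟨{ V with equivariant := ?_ }⟩
  intro g x y ht hs z e
  obtain ⟨ξ, rfl⟩ := E.val_surjective y z
  obtain ⟨ξ', hξ'⟩ := E.val_surjective x (α.act ht hs (E.val y ξ) e)
  -- The chosen lift of ξ(y) e need not depend continuously on ξ, but its value at x does, and U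
  -- preserves fibre norms. Both sides are therefore continuous in ξ, and it suffices to take ξ in
  -- the range of P, where U P = T and the equivariance of P and T applies.
  have hcl : ∀ ξ : X, valL E Y x (U (E.val_surjective x (α.act ht hs (E.val y ξ) e)).choose) =
      β.actL ht hs e (valL E Y y (U ξ)) := by
    have hUx : ∀ ξ : X, ‖E.val x (U ξ)‖ = ‖E.val x ξ‖ := fun ξ =>
      congrArg (fun a : E.Aop => √‖a.unop x‖) (hUi ξ ξ)
    intro ξ
    have hlip : ∀ ξ η : X,
        ‖E.val x (U (E.val_surjective x (α.act ht hs (E.val y ξ) e)).choose) -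
          E.val x (U (E.val_surjective x (α.act ht hs (E.val y η) e)).choose)‖ ≤ ‖ξ - η‖ * ‖e‖ := by
      intro ξ η
      rw [← map_sub, ← map_sub, hUx, map_sub,
        (E.val_surjective x (α.act ht hs (E.val y ξ) e)).choose_spec,
        (E.val_surjective x (α.act ht hs (E.val y η) e)).choose_spec, ← LinearMap.sub_apply,
        ← map_sub, ← map_sub]
      refine (α.norm_act_le ht hs _ e).trans ?_
      gcongr
      exact norm_val_le y _
    refine hPd.induction_on (p := fun ξ =>
      valL E Y x (U (E.val_surjective x (α.act ht hs (E.val y ξ) e)).choose) =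
      β.actL ht hs e (valL E Y y (U ξ))) ξ (isClosed_eq ?_ ?_) ?_
    · refine (LipschitzWith.of_dist_le_mul (K := ‖e‖₊) fun ξ η => ?_).continuous
      rw [dist_eq_norm, dist_eq_norm, mul_comm]
      exact hlip ξ η
    · exact ((β.actL ht hs e).comp ((valL E Y y).comp U)).continuous
    · intro ξ
      obtain ⟨ξ', hξ'⟩ := E.val_surjective x (α.act ht hs (E.val y ξ) e)
      have h1 := hP.equivariant ht hs e ξ ξ' hξ'.symm
      have h2 := h.equivariant ht hs e ξ ξ' hξ'.symm
      rw [valL_apply, valL_apply, EquivariantStructure.actL_apply, hUP, h2, ← hUP ξ',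
        ← sub_eq_zero, ← map_sub, ← map_sub, ← norm_eq_zero, hUx, map_sub,
        (E.val_surjective x (α.act ht hs (E.val y (P ξ)) e)).choose_spec, h1, sub_self, norm_zero]
  have := hcl ξ
  set ξ'' := (E.val_surjective x (α.act ht hs (E.val y ξ) e)).choose with hξ''
  have hspec : E.val x ξ'' = α.act ht hs (E.val y ξ) e :=
    (E.val_surjective x (α.act ht hs (E.val y ξ) e)).choose_spec
  rw [← hspec]
  exact this

end Operators

/-! ### Extension of an action from a dense subspace -/

section PreEquivariant

open FellBundle

variable {Γ M : Type*} [TopologicalSpace Γ] [TopologicalSpace M] {𝒢 : TopGroupoid Γ M}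
  [T2Space Γ] [LocallyCompactSpace Γ]

namespace FellBundle

variable (E : FellBundle 𝒢)

/-- The map `b ↦ e* b e'` from `A_{t(g)}` to `A_{s(g)}`. -/
noncomputable def conjL {g : Γ} {x y : M} (ht : 𝒢.tgt g = y) (hs : 𝒢.src g = x)
    (e e' : E.fiber g) : E.unitFiber y →L[ℂ] E.unitFiber x :=
  LinearMap.mkContinuous
    { toFun := fun b => E.mul (TopGroupoid.comp_inv_self hs) (E.star rfl e)
        (E.mul (TopGroupoid.comp_unit_left ht) b e')
      map_add' := fun b b' => by rw [E.add_mul, E.mul_add]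
      map_smul' := fun c b => by rw [E.smul_mul, E.mul_smul, RingHom.id_apply] }
    (‖e‖ * ‖e'‖) fun b => by
      refine (E.norm_mul_le _ _ _).trans ?_
      rw [norm_star_eq]
      have := E.norm_mul_le (TopGroupoid.comp_unit_left ht) b e'
      calc _ ≤ ‖e‖ * (‖b‖ * ‖e'‖) := by gcongr
        _ = _ := by ring

theorem conjL_apply {g : Γ} {x y : M} (ht : 𝒢.tgt g = y) (hs : 𝒢.src g = x)
    (e e' : E.fiber g) (b : E.unitFiber y) :
    E.conjL ht hs e e' b = E.mul (TopGroupoid.comp_inv_self hs) (E.star rfl e)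
        (E.mul (TopGroupoid.comp_unit_left ht) b e') := rfl

theorem norm_conjL_le {g : Γ} {x y : M} (ht : 𝒢.tgt g = y) (hs : 𝒢.src g = x)
    (e e' : E.fiber g) (b : E.unitFiber y) : ‖E.conjL ht hs e e' b‖ ≤ ‖e‖ * ‖e'‖ * ‖b‖ :=
  (LinearMap.mkContinuous_norm_le _ (by positivity) _ |> fun h =>
    (E.conjL ht hs e e').le_of_opNorm_le h b)

end FellBundle

/-- Equivariance data on a dense subspace `V` of a Hilbert module `Y`. -/
structure PreEquivariantStructure (E : FellBundle 𝒢) (V Y : Type*) [AddCommGroup V] [Module ℂ V]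
    [NormedAddCommGroup Y] [NormedSpace ℂ Y] [SMul E.Aop Y] [CStarModule E.Aop Y] where
  incl : V →ₗ[ℂ] Y
  denseRange_incl : DenseRange incl
  act : ∀ {g : Γ} {x y : M}, 𝒢.tgt g = y → 𝒢.src g = x → V →ₗ[ℂ] E.fiber g →ₗ[ℂ] E.Fib Y x
  inner_act : ∀ {g : Γ} {x y : M} (ht : 𝒢.tgt g = y) (hs : 𝒢.src g = x) (v v' : V)
    (e e' : E.fiber g), E.fibInner x (act ht hs v e) (act ht hs v' e') =
      E.conjL ht hs e e' (E.ip y (incl v) (incl v'))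
  dense_act : ∀ {g : Γ} {x y : M} (ht : 𝒢.tgt g = y) (hs : 𝒢.src g = x) (v : V),
    ∀ ε > 0, ∃ w' ∈ Submodule.span ℂ (range fun p : V × E.fiber g => act ht hs p.1 p.2),
      E.fibNorm (E.val x (incl v) - w') < ε
  act_act : ∀ {g h k : Γ} {x y z : M} (c : 𝒢.Comp g h k) (htg : 𝒢.tgt g = z) (hsg : 𝒢.src g = y)
    (hth : 𝒢.tgt h = y) (hsh : 𝒢.src h = x) (htk : 𝒢.tgt k = z) (hsk : 𝒢.src k = x)
    (v : V) (a : E.fiber g), ∃ v' : V, E.val y (incl v') = act htg hsg v a ∧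
      ∀ b : E.fiber h, act hth hsh v' b = act htk hsk v (E.mul c a b)
  continuous_act : ∀ (v : V) (η : ∀ g, E.fiber g),
    Continuous (fun g => (⟨g, η g⟩ : E.Tot)) →
    (∀ ε > 0, ∃ K : Set Γ, IsCompact K ∧ ∀ g ∉ K, ‖η g‖ < ε) →
    ∀ (g₀ : Γ), ∀ ε > 0, ∃ ζ : Y, ∀ᶠ g in 𝓝 g₀,
      E.fibNorm (act rfl rfl v (η g) - E.val (𝒢.src g) ζ) < ε

namespace PreEquivariantStructure

variable {E : FellBundle 𝒢} {V Y : Type*} [AddCommGroup V] [Module ℂ V]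
    [NormedAddCommGroup Y] [NormedSpace ℂ Y] [CompleteSpace Y] [SMul E.Aop Y] [CStarModule E.Aop Y]
    (P : PreEquivariantStructure E V Y)

/-- The map from `V` to the fibre at `x`. -/
noncomputable def inclFib (x : M) : V →ₗ[ℂ] E.Fib Y x := (E.val x).comp P.incl

theorem inclFib_apply (x : M) (v : V) : P.inclFib x v = E.val x (P.incl v) := rfl

theorem denseRange_inclFib (x : M) : DenseRange (P.inclFib x) :=
  (E.val_surjective x).denseRange.comp P.denseRange_incl (valL E Y x).continuous

theorem norm_act_le {g : Γ} {x y : M} (ht : 𝒢.tgt g = y) (hs : 𝒢.src g = x) (e : E.fiber g)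
    (v : V) : ‖P.act ht hs v e‖ ≤ ‖e‖ * ‖P.inclFib y v‖ := by
  refine le_of_sq_le_sq ?_ (by positivity)
  rw [norm_fib_sq, P.inner_act]
  refine (E.norm_conjL_le _ _ _ _ _).trans ?_
  rw [mul_pow, norm_fib_sq, ← sq]
  rfl

/-- The action of `e` on the fibre at `t(g)`. -/
noncomputable def extend {g : Γ} {x y : M} (ht : 𝒢.tgt g = y) (hs : 𝒢.src g = x)
    (e : E.fiber g) : E.Fib Y y →L[ℂ] E.Fib Y x :=
  ((P.act ht hs).flip e).extendOfNorm (P.inclFib y)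

theorem extend_inclFib {g : Γ} {x y : M} (ht : 𝒢.tgt g = y) (hs : 𝒢.src g = x)
    (e : E.fiber g) (v : V) : P.extend ht hs e (P.inclFib y v) = P.act ht hs v e :=
  LinearMap.extendOfNorm_eq (P.denseRange_inclFib y) ⟨‖e‖, P.norm_act_le ht hs e⟩ v

theorem norm_extend_le {g : Γ} {x y : M} (ht : 𝒢.tgt g = y) (hs : 𝒢.src g = x)
    (e : E.fiber g) (z : E.Fib Y y) : ‖P.extend ht hs e z‖ ≤ ‖e‖ * ‖z‖ :=
  LinearMap.norm_extendOfNorm_apply_le (P.denseRange_inclFib y) _ (P.norm_act_le ht hs e) z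

/-- The equivariant structure determined by its restriction to a dense subspace. -/
noncomputable def toEquivariantStructure : EquivariantStructure E Y where
  act {g x y} ht hs := LinearMap.mk₂ ℂ (fun z e => P.extend ht hs e z)
    (fun z z' e => map_add _ z z') (fun c z e => map_smul _ c z)
    (fun z e e' => (P.denseRange_inclFib y).induction_on
      (p := fun z => P.extend ht hs (e + e') z = P.extend ht hs e z + P.extend ht hs e' z) z
      (isClosed_eq (by fun_prop) (by fun_prop)) fun v => by
        rw [extend_inclFib, extend_inclFib, extend_inclFib, map_add])
    (fun c z e => (P.denseRange_inclFib y).induction_on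
      (p := fun z => P.extend ht hs (c • e) z = c • P.extend ht hs e z) z
      (isClosed_eq (by fun_prop) (by fun_prop)) fun v => by
        rw [extend_inclFib, extend_inclFib, map_smul])
  inner_act {g x y} ht hs z z' e e' := by
    change fibInnerL E Y x (P.extend ht hs e z) (P.extend ht hs e' z')
      = E.conjL ht hs e e' (fibInnerL E Y y z z')
    refine (P.denseRange_inclFib y).induction_on₂ (p := fun z z' =>
      fibInnerL E Y x (P.extend ht hs e z) (P.extend ht hs e' z')
      = E.conjL ht hs e e' (fibInnerL E Y y z z')) ?_ (fun v v' => ?_) z z'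
    · exact isClosed_eq (by fun_prop) (by fun_prop)
    · rw [extend_inclFib, extend_inclFib]
      exact P.inner_act ht hs v v' e e'
  dense_act {g x y} ht hs w ε hε := by
    obtain ⟨v, hv⟩ := Metric.denseRange_iff.1 (P.denseRange_inclFib x) w (ε / 2) (half_pos hε)
    obtain ⟨w', hw', hw'ε⟩ := P.dense_act ht hs v (ε / 2) (half_pos hε)
    refine ⟨w', ?_, ?_⟩
    · refine Submodule.span_mono ?_ hw'
      rintro _ ⟨⟨v, e⟩, rfl⟩
      exact ⟨(P.inclFib y v, e), P.extend_inclFib ht hs e v⟩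
    · rw [dist_eq_norm] at hv
      change ‖w - w'‖ < ε
      calc ‖w - w'‖ = ‖(w - P.inclFib x v) + (P.inclFib x v - w')‖ := by congr 1; abel
        _ ≤ _ := norm_add_le _ _
        _ < ε / 2 + ε / 2 := add_lt_add hv hw'ε
        _ = ε := add_halves ε
  act_act {g h k x y z} c htg hsg hth hsh htk hsk w a b := by
    change P.extend hth hsh b (P.extend htg hsg a w) = P.extend htk hsk (E.mul c a b) w
    refine (P.denseRange_inclFib z).induction_on (p := fun w =>
      P.extend hth hsh b (P.extend htg hsg a w) = P.extend htk hsk (E.mul c a b) w) w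
      (isClosed_eq (by fun_prop) (by fun_prop)) fun v => ?_
    obtain ⟨v', hv', hb⟩ := P.act_act c htg hsg hth hsh htk hsk v a
    rw [extend_inclFib, extend_inclFib, ← hv', ← inclFib_apply, extend_inclFib, hb]
  continuous_act ξ η hη hη0 g₀ ε hε := by
    -- A continuous section vanishing at infinity is bounded, so ξ can be replaced by a nearby
    -- element of `V` with an error uniform in g.
    obtain ⟨K, hK, hK1⟩ := hη0 1 one_pos
    obtain ⟨C, hC⟩ := E.bddAbove_norm_of_isCompact hη hK
    have hb : ∀ g, ‖η g‖ ≤ |C| + 1 := fun g => by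
      by_cases hg : g ∈ K
      · exact (hC g hg).trans ((le_abs_self C).trans (by linarith))
      · exact (hK1 g hg).le.trans (by linarith [abs_nonneg C])
    obtain ⟨v, hv⟩ := Metric.denseRange_iff.1 P.denseRange_incl ξ (ε / 2 / (|C| + 1)) (by positivity)
    obtain ⟨ζ, hζ⟩ := P.continuous_act v η hη hη0 g₀ (ε / 2) (half_pos hε)
    refine ⟨ζ, hζ.mono fun g hg => ?_⟩
    change ‖P.extend rfl rfl (η g) (E.val (𝒢.tgt g) ξ) - E.val (𝒢.src g) ζ‖ < ε
    have h1 : ‖P.extend rfl rfl (η g) (E.val (𝒢.tgt g) ξ)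
        - P.act rfl rfl v (η g)‖ < ε / 2 := by
      rw [← extend_inclFib, ← map_sub, inclFib_apply, ← map_sub]
      rw [dist_eq_norm, lt_div_iff₀ (by positivity)] at hv
      calc _ ≤ ‖η g‖ * ‖E.val (𝒢.tgt g) (ξ - P.incl v)‖ := P.norm_extend_le _ _ _ _
        _ ≤ (|C| + 1) * ‖ξ - P.incl v‖ := by
          gcongr
          · exact hb g
          · exact norm_val_le _ _
        _ < ε / 2 := by rw [mul_comm]; exact hv
    calc _ = ‖(P.extend rfl rfl (η g) (E.val (𝒢.tgt g) ξ) - P.act rfl rfl v (η g))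
          + (P.act rfl rfl v (η g) - E.val (𝒢.src g) ζ)‖ := by congr 1; abel
      _ ≤ _ := norm_add_le _ _
      _ < ε / 2 + ε / 2 := add_lt_add h1 hg
      _ = ε := add_halves ε

theorem toEquivariantStructure_act {g : Γ} {x y : M} (ht : 𝒢.tgt g = y) (hs : 𝒢.src g = x)
    (v : V) (e : E.fiber g) :
    P.toEquivariantStructure.act ht hs (E.val y (P.incl v)) e = P.act ht hs v e :=
  P.extend_inclFib ht hs e v

end PreEquivariantStructure

end PreEquivariant

/-! ### Amplification of equivariant structures -/

section Amplification

variable {B X : Type*} [NonUnitalCStarAlgebra B] [PartialOrder B] [StarOrderedRing B]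
  [NormedAddCommGroup X] [NormedSpace ℂ X] [SMul B X] [CStarModule B X]

variable (B X) in
/-- The inclusion of the finitely supported sequences into `X ⊗ H`. -/
noncomputable def toTensorH : (ℕ →₀ X) →ₗ[ℂ] TensorH B X where
  toFun := (ampSemiInner B X).toHilb
  map_add' _ _ := UniformSpace.Completion.coe_add _ _
  map_smul' c v := UniformSpace.Completion.coe_smul c (show (ampSemiInner B X).Pre from v)

theorem toTensorH_single (n : ℕ) (ξ : X) : toTensorH B X (Finsupp.single n ξ) = tmulDelta B ξ n := rfl

theorem denseRange_toTensorH : DenseRange (toTensorH B X) := (ampSemiInner B X).denseRange_toHilb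

theorem inner_toTensorH (v w : ℕ →₀ X) :
    inner B (toTensorH B X v) (toTensorH B X w) = w.sum fun n η => inner B (v n) η :=
  (ampSemiInner B X).inner_toHilb v w

theorem inner_tmulDelta_left (ξ : X) (n : ℕ) (v : ℕ →₀ X) :
    inner B (tmulDelta B ξ n) (toTensorH B X v) = inner B ξ (v n) := by
  rw [← toTensorH_single, inner_toTensorH, Finsupp.sum, Finset.sum_eq_single n]
  · simp
  · intro m _ hm
    rw [Finsupp.single_eq_of_ne hm, CStarModule.inner_zero_left]
  · intro hn
    rw [Finsupp.notMem_support_iff.1 hn, CStarModule.inner_zero_right]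

theorem inner_tmulDelta (ξ η : X) (m n : ℕ) :
    inner B (tmulDelta B ξ m) (tmulDelta B η n) = if m = n then inner B ξ η else 0 := by
  rw [← toTensorH_single n, inner_tmulDelta_left]
  split_ifs with h
  · rw [h, Finsupp.single_eq_same]
  · rw [Finsupp.single_eq_of_ne h, CStarModule.inner_zero_right]

variable (B X) in
/-- The inclusion `ξ ↦ ξ ⊗ δ_n`. -/
noncomputable def tensorIncl (n : ℕ) : X →L[ℂ] TensorH B X :=
  LinearMap.mkContinuous ((toTensorH B X).comp (Finsupp.lsingle n)) 1 fun ξ => by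
    rw [one_mul]
    refine le_of_sq_le_sq ?_ (norm_nonneg _)
    rw [CStarModule.norm_sq_eq B, CStarModule.norm_sq_eq B]
    refine (congrArg norm ((inner_tmulDelta ξ ξ n n).trans (if_pos rfl))).le

theorem tensorIncl_apply (n : ℕ) (ξ : X) : tensorIncl B X n ξ = tmulDelta B ξ n := rfl

theorem norm_tensorIncl_le (n : ℕ) : ‖tensorIncl B X n‖ ≤ 1 :=
  LinearMap.mkContinuous_norm_le _ zero_le_one _

/-- ⟨v n, v n⟩ is one term of ⟨v, v⟩, a sum of positive elements. The bound lets the coordinate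
extend to the completion; the factor 1 is in the form that the extension takes. -/
theorem norm_apply_le_toTensorH (v : ℕ →₀ X) (n : ℕ) : ‖v n‖ ≤ 1 * ‖toTensorH B X v‖ := by
  rw [one_mul]
  refine le_of_sq_le_sq ?_ (norm_nonneg _)
  rw [CStarModule.norm_sq_eq B, CStarModule.norm_sq_eq B, inner_toTensorH]
  refine CStarAlgebra.norm_le_norm_of_nonneg_of_le CStarModule.inner_self_nonneg ?_
  by_cases hn : n ∈ v.support
  · exact Finset.single_le_sum (f := fun n => inner B (v n) (v n))
      (fun m _ => CStarModule.inner_self_nonneg) hn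
  · rw [Finsupp.notMem_support_iff.1 hn, CStarModule.inner_zero_right]
    exact Finset.sum_nonneg fun m _ => CStarModule.inner_self_nonneg

variable [CompleteSpace X]

variable (B X) in
/-- The `n`-th coordinate of an element of `X ⊗ H`. -/
noncomputable def tensorProj (n : ℕ) : TensorH B X →L[ℂ] X :=
  (Finsupp.lapply n : (ℕ →₀ X) →ₗ[ℂ] X).extendOfNorm (toTensorH B X)

theorem tensorProj_toTensorH (n : ℕ) (v : ℕ →₀ X) : tensorProj B X n (toTensorH B X v) = v n :=
  LinearMap.extendOfNorm_eq denseRange_toTensorH ⟨1, fun v => norm_apply_le_toTensorH v n⟩ v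

theorem norm_tensorProj_le (n : ℕ) : ‖tensorProj B X n‖ ≤ 1 :=
  LinearMap.opNorm_extendOfNorm_le denseRange_toTensorH zero_le_one
    fun v => norm_apply_le_toTensorH v n

/-- Inclusion and coordinate are adjoint on finite sequences, hence everywhere by density; the
inclusion thereby induces maps of fibres. -/
theorem inner_tensorIncl (n : ℕ) (ξ : X) (w : TensorH B X) :
    inner B w (tensorIncl B X n ξ) = inner B (tensorProj B X n w) ξ := by
  rw [← CStarModule.star_inner (tensorIncl B X n ξ), ← CStarModule.star_inner ξ]
  congr 1
  refine denseRange_toTensorH.induction_on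
    (p := fun w => inner B (tensorIncl B X n ξ) w = inner B ξ (tensorProj B X n w)) w
    (isClosed_eq ?_ ?_) fun v => ?_
  · exact CStarModule.continuous_inner.comp (continuous_const.prodMk continuous_id)
  · exact CStarModule.continuous_inner.comp
      (continuous_const.prodMk (tensorProj B X n).continuous)
  · rw [tensorProj_toTensorH, tensorIncl_apply, inner_tmulDelta_left]

end Amplification

namespace EquivariantStructure

open FellBundle

variable {Γ M : Type*} [TopologicalSpace Γ] [TopologicalSpace M] {𝒢 : TopGroupoid Γ M}
  [T2Space Γ] [LocallyCompactSpace Γ] {E : FellBundle 𝒢}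
  {X : Type*} [NormedAddCommGroup X] [NormedSpace ℂ X] [CompleteSpace X] [SMul E.Aop X]
  [CStarModule E.Aop X] (α : EquivariantStructure E X)

theorem isAdjointable_tensorIncl (n : ℕ) :
    E.IsAdjointable (tensorIncl E.Aop X n : X →ₗ[ℂ] TensorH E.Aop X) :=
  ⟨tensorProj E.Aop X n, fun ξ w => inner_tensorIncl n ξ w⟩

variable (E X) in
/-- The inclusion `X_x → (X ⊗ H)_x`, `z ↦ z ⊗ δ_n`. -/
noncomputable def fibIncl (n : ℕ) (x : M) : E.Fib X x →ₗ[ℂ] E.Fib (TensorH E.Aop X) x :=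
  fibMap (isAdjointable_tensorIncl (E := E) (X := X) n) x

theorem fibIncl_val (n : ℕ) (x : M) (ξ : X) :
    fibIncl E X n x (E.val x ξ) = E.val x (tmulDelta E.Aop ξ n) := rfl

theorem fibInner_fibIncl (m n : ℕ) (x : M) (z w : E.Fib X x) :
    E.fibInner x (fibIncl E X m x z) (fibIncl E X n x w) =
      if m = n then E.fibInner x z w else 0 := by
  obtain ⟨ξ, rfl⟩ := E.val_surjective x z
  obtain ⟨η, rfl⟩ := E.val_surjective x w
  refine (congrArg (fun a : E.Aop => a.unop x) (inner_tmulDelta ξ η m n)).trans ?_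
  split_ifs <;> rfl

theorem norm_fibIncl (n : ℕ) (x : M) (z : E.Fib X x) : E.fibNorm (fibIncl E X n x z) = E.fibNorm z := by
  unfold fibNorm
  rw [fibInner_fibIncl, if_pos rfl]

/-- The action of `e` on finitely supported sequences. -/
noncomputable def ampAct {g : Γ} {x y : M} (ht : 𝒢.tgt g = y) (hs : 𝒢.src g = x) :
    (ℕ →₀ X) →ₗ[ℂ] E.fiber g →ₗ[ℂ] E.Fib (TensorH E.Aop X) x :=
  Finsupp.lsum ℂ fun n => LinearMap.mk₂ ℂ
    (fun ξ e => fibIncl E X n x (α.act ht hs (E.val y ξ) e))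
    (fun ξ ξ' e => by simp only [map_add, LinearMap.add_apply])
    (fun c ξ e => by simp only [map_smul, LinearMap.smul_apply])
    (fun ξ e e' => by simp only [map_add])
    (fun c ξ e => by simp only [map_smul])

theorem ampAct_single {g : Γ} {x y : M} (ht : 𝒢.tgt g = y) (hs : 𝒢.src g = x) (n : ℕ) (ξ : X)
    (e : E.fiber g) :
    α.ampAct ht hs (Finsupp.single n ξ) e = fibIncl E X n x (α.act ht hs (E.val y ξ) e) := by
  rw [ampAct, Finsupp.lsum_single]
  rfl

/-- The action on finitely supported sequences as equivariance data on `X ⊗ H`. -/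
noncomputable def preAmp : PreEquivariantStructure E (ℕ →₀ X) (TensorH E.Aop X) where
  incl := toTensorH E.Aop X
  denseRange_incl := denseRange_toTensorH
  act ht hs := α.ampAct ht hs
  inner_act {g x y} ht hs v v' e e' := by
    -- In terms of `ipL` both sides are visibly additive in `v` and `v'`, so elementary sequences
    -- suffice.
    have hip : ∀ u w : TensorH E.Aop X, E.ip y u w = E.ipL y u w := fun _ _ => rfl
    rw [hip]
    induction v using Finsupp.induction_linear with
    | zero => simp only [map_zero, LinearMap.zero_apply]
    | add v w hv hw => simp only [map_add, LinearMap.add_apply, hv, hw]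
    | single m ξ =>
      induction v' using Finsupp.induction_linear with
      | zero => simp only [map_zero, LinearMap.zero_apply]
      | add v w hv hw => simp only [map_add, LinearMap.add_apply, hv, hw]
      | single n η =>
        rw [ampAct_single, ampAct_single, fibInner_fibIncl, α.inner_act]
        have e1 : E.ipL y (toTensorH E.Aop X (Finsupp.single m ξ))
            (toTensorH E.Aop X (Finsupp.single n η)) = if m = n then E.ip y ξ η else 0 := by
          refine (congrArg (fun a : E.Aop => a.unop y) (inner_tmulDelta ξ η m n)).trans ?_
          split_ifs <;> rfl
        rw [e1]
        split_ifs
        · rfl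
        · rw [map_zero]
  dense_act {g x y} ht hs v := by
    induction v using Finsupp.induction_linear with
    | zero =>
      intro ε hε
      refine ⟨0, Submodule.zero_mem _, ?_⟩
      rw [map_zero, map_zero, sub_zero]
      change ‖(0 : E.Fib (TensorH E.Aop X) x)‖ < ε
      rwa [norm_zero]
    | add v w hv hw =>
      intro ε hε
      obtain ⟨v', hv', hvε⟩ := hv (ε / 2) (half_pos hε)
      obtain ⟨w', hw', hwε⟩ := hw (ε / 2) (half_pos hε)
      refine ⟨v' + w', Submodule.add_mem _ hv' hw', ?_⟩
      rw [map_add, map_add, add_sub_add_comm]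
      exact (fibNorm_add_le _ _).trans_lt (by linarith)
    | single n ξ =>
      intro ε hε
      obtain ⟨w', hw', hwε⟩ := α.dense_act ht hs (E.val x ξ) ε hε
      refine ⟨fibIncl E X n x w', ?_, ?_⟩
      · refine (Submodule.span_le (p := (Submodule.span ℂ _).comap (fibIncl E X n x))).2 ?_ hw'
        rintro _ ⟨⟨z, e⟩, rfl⟩
        obtain ⟨η, rfl⟩ := E.val_surjective y z
        exact Submodule.subset_span ⟨(Finsupp.single n η, e), α.ampAct_single ht hs n η e⟩
      · rw [toTensorH_single, ← fibIncl_val, ← map_sub, norm_fibIncl]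
        exact hwε
  act_act {g h k x y z} c htg hsg hth hsh htk hsk v a := by
    induction v using Finsupp.induction_linear with
    | zero => exact ⟨0, by simp only [map_zero, LinearMap.zero_apply], fun b => by
        simp only [map_zero, LinearMap.zero_apply]⟩
    | add v w hv hw =>
      obtain ⟨v', hv', hvb⟩ := hv
      obtain ⟨w', hw', hwb⟩ := hw
      exact ⟨v' + w', by simp only [map_add, LinearMap.add_apply, hv', hw'], fun b => by
        simp only [map_add, LinearMap.add_apply, hvb, hwb]⟩
    | single n ξ =>
      obtain ⟨ξ', hξ'⟩ := E.val_surjective y (α.act htg hsg (E.val z ξ) a)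
      refine ⟨Finsupp.single n ξ', ?_, fun b => ?_⟩
      · rw [ampAct_single, toTensorH_single, ← fibIncl_val, hξ']
      · rw [ampAct_single, ampAct_single, hξ', α.act_act c htg hsg hth hsh htk hsk]
  continuous_act v η hη hη0 g₀ := by
    induction v using Finsupp.induction_linear with
    | zero =>
      intro ε hε
      refine ⟨0, Eventually.of_forall fun g => ?_⟩
      rw [map_zero, LinearMap.zero_apply, map_zero, sub_zero]
      change ‖(0 : E.Fib (TensorH E.Aop X) _)‖ < ε
      rwa [norm_zero]
    | add v w hv hw =>
      intro ε hε
      obtain ⟨ζ, hζ⟩ := hv (ε / 2) (half_pos hε)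
      obtain ⟨ζ', hζ'⟩ := hw (ε / 2) (half_pos hε)
      refine ⟨ζ + ζ', ?_⟩
      filter_upwards [hζ, hζ'] with g hg hg'
      rw [map_add, map_add, LinearMap.add_apply, add_sub_add_comm]
      exact (fibNorm_add_le _ _).trans_lt (by linarith)
    | single n ξ =>
      intro ε hε
      obtain ⟨ζ, hζ⟩ := α.continuous_act ξ η hη hη0 g₀ ε hε
      refine ⟨tmulDelta E.Aop ζ n, hζ.mono fun g hg => ?_⟩
      rw [ampAct_single, ← fibIncl_val, ← map_sub, norm_fibIncl]
      exact hg

/-- The equivariant structure `(ξ ⊗ v) e = (ξ e) ⊗ v` on `X ⊗ H`. -/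
noncomputable def amp : EquivariantStructure E (TensorH E.Aop X) := α.preAmp.toEquivariantStructure

theorem amp_act {g : Γ} {x y : M} (ht : 𝒢.tgt g = y) (hs : 𝒢.src g = x) (n : ℕ) (ξ : X)
    (e : E.fiber g) : α.amp.act ht hs (E.val y (tmulDelta E.Aop ξ n)) e
      = fibIncl E X n x (α.act ht hs (E.val y ξ) e) :=
  (α.preAmp.toEquivariantStructure_act ht hs (Finsupp.single n ξ) e).trans
    (α.ampAct_single ht hs n ξ e)

theorem isEquivariantAdjoint_tensorIncl (n : ℕ) :
    IsEquivariantAdjoint α α.amp (tensorIncl E.Aop X n) (tensorProj E.Aop X n) where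
  adj ξ w := inner_tensorIncl n ξ w
  equivariant ht hs e ξ ξ' h := by
    rw [tensorIncl_apply, amp_act, h]
    rfl

end EquivariantStructure

section Sum

open FellBundle

variable {Γ M : Type*} [TopologicalSpace Γ] [TopologicalSpace M] {𝒢 : TopGroupoid Γ M}
  [T2Space Γ] [LocallyCompactSpace Γ] {E : FellBundle 𝒢}
  {X Y : Type*} [NormedAddCommGroup X] [NormedSpace ℂ X] [CompleteSpace X] [SMul E.Aop X]
  [CStarModule E.Aop X] [NormedAddCommGroup Y] [NormedSpace ℂ Y] [CompleteSpace Y]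
  [SMul E.Aop Y] [CStarModule E.Aop Y]

theorem norm_sumInl (ξ : X) : ‖sumInl E X Y ξ‖ = ‖ξ‖ := by
  rw [CStarModule.norm_eq_sqrt_norm_inner_self (A := E.Aop) ξ,
    CStarModule.norm_eq_sqrt_norm_inner_self (A := E.Aop)]
  simp [WithCStarModule.prod_inner, sumInl]

end Sum

/-! ### Partitions of unity -/

/-- Functions summing to 1 on K may have a larger sum elsewhere. Dividing by max(1, sum) and
multiplying by χ keeps the sum 1 on K and at most χ everywhere. As χ is fixed before the cover,
errors integrate to bounds that do not depend on the cover. -/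
theorem exists_partition_subordinate {Γ : Type*} [TopologicalSpace Γ] [T2Space Γ]
    [LocallyCompactSpace Γ] {K : Set Γ} (hK : IsCompact K) {χ : Γ → ℝ} (hχ : Continuous χ)
    (hχ1 : EqOn χ 1 K) (hχc : HasCompactSupport χ) (hχ0 : ∀ g, 0 ≤ χ g) {U : Γ → Set Γ}
    (hUo : ∀ g, IsOpen (U g)) (hU : ∀ g ∈ K, g ∈ U g) :
    ∃ (n : ℕ) (c : Fin n → Γ) (φ : Fin n → Γ → ℝ), (∀ i, c i ∈ K) ∧ (∀ i, Continuous (φ i)) ∧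
      (∀ i, HasCompactSupport (φ i)) ∧ (∀ i g, 0 ≤ φ i g) ∧ (∀ i g, g ∉ U (c i) → φ i g = 0) ∧
      (∀ g, ∑ i, φ i g ≤ χ g) ∧ ∀ g ∈ K, ∑ i, φ i g = 1 := by
  obtain ⟨t, ht⟩ := hK.elim_nhds_subcover' (fun g _ => U g)
    (fun g hg => (hUo g).mem_nhds (hU g hg))
  let e := t.equivFin.symm
  have hcov : K ⊆ ⋃ i : Fin t.card, U (e i).1.1 := by
    intro g hg
    obtain ⟨g₀, hg₀, hgU⟩ := mem_iUnion₂.1 (ht hg)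
    exact mem_iUnion.2 ⟨t.equivFin ⟨g₀, hg₀⟩, by simpa [e] using hgU⟩
  obtain ⟨f, hfs, hf1, hf01, -⟩ := exists_continuous_sum_one_of_isOpen_isCompact
    (fun i : Fin t.card => hUo (e i).1.1) hK hcov
  let S : Γ → ℝ := fun g => max 1 (∑ i, f i g)
  have hS : Continuous S := by fun_prop
  have hS1 : ∀ g, 1 ≤ S g := fun g => le_max_left _ _
  let φ : Fin t.card → Γ → ℝ := fun i g => f i g / S g * χ g
  have hsum : ∀ g, ∑ i, φ i g = (∑ i, f i g) / S g * χ g := fun g => by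
    simp only [φ, Finset.sum_div, Finset.sum_mul]
  refine ⟨t.card, fun i => (e i).1.1, φ, fun i => (e i).1.2, fun i => ?_, fun i => ?_,
    fun i g => ?_, fun i g hg => ?_, fun g => ?_, fun g hg => ?_⟩
  · exact ((f i).continuous.div hS fun g => (zero_lt_one.trans_le (hS1 g)).ne').mul hχ
  · exact hχc.mul_left
  · exact mul_nonneg (div_nonneg (hf01 i g).1 (zero_le_one.trans (hS1 g))) (hχ0 g)
  · have : f i g = 0 := by
      by_contra h
      exact hg (hfs i (subset_tsupport _ h))
    simp [φ, this]
  · rw [hsum]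
    exact mul_le_of_le_one_left (hχ0 g)
      (div_le_one_of_le₀ (le_max_right _ _) (zero_le_one.trans (hS1 g)))
  · have h1 : ∑ i, f i g = 1 := by simpa using hf1 hg
    rw [hsum, h1, hχ1 hg]
    simp [S, h1]

/-- Where the weights sum to 1, or where k = 0, k is its own weighted sum, and it is compared only
with those a_i that have nonzero weight. -/
theorem norm_sub_sum_smul_le {F ι : Type*} [NormedAddCommGroup F] [NormedSpace ℂ F] (s : Finset ι)
    {k : F} {a : ι → F} {φ : ι → ℝ} {ε r : ℝ} (hε : 0 ≤ ε) (hφ : ∀ i, 0 ≤ φ i)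
    (hk : k = 0 ∨ ∑ i ∈ s, φ i = 1) (ha : ∀ i, φ i ≠ 0 → ‖k - a i‖ ≤ ε) (hr : ∑ i ∈ s, φ i ≤ r) :
    ‖k - ∑ i ∈ s, (φ i : ℂ) • a i‖ ≤ ε * r := by
  have hK : k = ∑ i ∈ s, (φ i : ℂ) • k := by
    rcases hk with h | h
    · simp [h]
    · rw [← Finset.sum_smul, ← Complex.ofReal_sum, h]
      simp
  calc ‖k - ∑ i ∈ s, (φ i : ℂ) • a i‖ = ‖∑ i ∈ s, (φ i : ℂ) • (k - a i)‖ := by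
        simp only [smul_sub, Finset.sum_sub_distrib]
        rw [← hK]
    _ ≤ ∑ i ∈ s, φ i * ε := by
        refine (norm_sum_le _ _).trans (Finset.sum_le_sum fun i _ => ?_)
        rw [norm_smul, Complex.norm_real, Real.norm_of_nonneg (hφ i)]
        rcases eq_or_ne (φ i) 0 with h | h
        · simp [h]
        · exact mul_le_mul_of_nonneg_left (ha i h) (hφ i)
    _ = ε * ∑ i ∈ s, φ i := by rw [← Finset.sum_mul, mul_comm]
    _ ≤ ε * r := by gcongr

theorem exists_cutoff {Γ : Type*} [TopologicalSpace Γ] [T2Space Γ] [LocallyCompactSpace Γ]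
    {K : Set Γ} (hK : IsCompact K) : ∃ χ : Γ → ℝ, Continuous χ ∧ EqOn χ 1 K ∧
      HasCompactSupport χ ∧ ∀ g, χ g ∈ Icc (0 : ℝ) 1 := by
  obtain ⟨χ, h1, _, h3, h4⟩ := exists_continuous_one_zero_of_isCompact hK
    (isClosed_empty (X := Γ)) (disjoint_empty K)
  exact ⟨χ, χ.continuous, h1, h3, h4⟩

/-! ### Compactly supported sections -/

namespace FellBundle

variable {Γ M : Type*} [TopologicalSpace Γ] [TopologicalSpace M] {𝒢 : TopGroupoid Γ M}
  {E : FellBundle 𝒢}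

theorem Cc_continuous (ξ : E.Cc) : Continuous fun g => (⟨g, ξ.1 g⟩ : E.Tot) := ξ.2.1

/-- The product of a compactly supported section and a continuous function. -/
def ccFunMul (f : Γ → ℝ) (hf : Continuous f) (ξ : E.Cc) : E.Cc :=
  ⟨fun g => (f g : ℂ) • ξ.1 g, continuous_iff_continuousAt.2 fun _ => E.continuousAt_smul
      (Complex.continuous_ofReal.comp hf).continuousAt (Cc_continuous ξ).continuousAt, by
    obtain ⟨K, hK, h⟩ := ξ.2.2
    exact ⟨K, hK, fun g hg => by simp [h g hg]⟩⟩

/-- The product of a continuous section and a compactly supported continuous function. -/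
def ccOfSection (f : Γ → ℝ) (hf : Continuous f) (hc : HasCompactSupport f) (σ : ∀ g, E.fiber g)
    (hσ : Continuous fun g => (⟨g, σ g⟩ : E.Tot)) : E.Cc :=
  ⟨fun g => (f g : ℂ) • σ g, continuous_iff_continuousAt.2 fun _ => E.continuousAt_smul
      (Complex.continuous_ofReal.comp hf).continuousAt hσ.continuousAt, tsupport f, hc, fun g hg => by
    simp [image_eq_zero_of_notMem_tsupport hg]⟩

/-- Compactly supported sections vanish at infinity. -/
theorem Cc_vanish (ξ : E.Cc) : ∀ ε > 0, ∃ K : Set Γ, IsCompact K ∧ ∀ g ∉ K, ‖ξ.1 g‖ < ε := by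
  intro ε hε
  obtain ⟨K, hK, h⟩ := ξ.2.2
  exact ⟨K, hK, fun g hg => by rwa [h g hg, norm_zero]⟩

theorem Cc_sum_apply {ι : Type*} (s : Finset ι) (ξ : ι → E.Cc) (g : Γ) :
    (∑ i ∈ s, ξ i : E.Cc).1 g = ∑ i ∈ s, (ξ i).1 g := by
  rw [AddSubmonoidClass.coe_finsetSum, Finset.sum_apply]

variable [T2Space Γ] [LocallyCompactSpace Γ]

theorem exists_Cc_apply_eq (g : Γ) (e : E.fiber g) : ∃ ξ : E.Cc, ξ.1 g = e := by
  obtain ⟨σ, hσ, rfl⟩ := E.exists_section g e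
  obtain ⟨χ, hχ, h1, hc, -⟩ := exists_cutoff (isCompact_singleton (x := g))
  refine ⟨ccOfSection χ hχ hc σ hσ, ?_⟩
  change (χ g : ℂ) • σ g = σ g
  rw [h1 rfl]
  simp

section Tietze

variable {C K : Set Γ} {φ : ∀ g : C, E.fiber g.1}

/-- A compactly supported section over a closed subset can be approximated by global sections. -/
theorem exists_Cc_approx (hC : IsClosed C) (hK : IsCompact K)
    (hφ : Continuous fun g : C => (⟨g.1, φ g⟩ : E.Tot)) (hφK : ∀ g : C, g.1 ∉ K → φ g = 0)
    {χ : Γ → ℝ} (hχ : Continuous χ) (hχ1 : EqOn χ 1 K) (hχc : HasCompactSupport χ)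
    (hχ01 : ∀ g, χ g ∈ Icc (0 : ℝ) 1) {ε : ℝ} (hε : 0 < ε) :
    ∃ ζ : E.Cc, (∀ g : C, ‖φ g - ζ.1 g.1‖ ≤ ε) ∧ ∀ g, χ g = 0 → ζ.1 g = 0 := by
  -- The partition below has its centres in K ∩ C, so a point outside C may be given the zero
  -- section and the whole space.
  have hloc : ∀ g₀ : Γ, ∃ σ : E.Cc, ∃ U : Set Γ, IsOpen U ∧ g₀ ∈ U ∧
      (g₀ ∈ K ∩ C → ∀ g : C, g.1 ∈ U → ‖φ g - σ.1 g.1‖ < ε) := by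
    intro g₀
    by_cases hg₀ : g₀ ∈ C
    · obtain ⟨σ, hσ⟩ := exists_Cc_apply_eq g₀ (φ ⟨g₀, hg₀⟩)
      have hc : ContinuousAt (fun g : C => (⟨g.1, φ g - σ.1 g.1⟩ : E.Tot)) ⟨g₀, hg₀⟩ :=
        E.continuousAt_sub (f := fun g : C => g.1) hφ.continuousAt
          ((Cc_continuous σ).comp continuous_subtype_val).continuousAt
      have h0 : ‖φ ⟨g₀, hg₀⟩ - σ.1 g₀‖ < ε := by
        rw [hσ, sub_self, norm_zero]
        exact hε
      have := hc.eventually (E.norm_usc _ _ h0)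
      rw [nhds_subtype, eventually_comap] at this
      obtain ⟨U, hU, hUo, hgU⟩ := eventually_nhds_iff.1 this
      exact ⟨σ, U, hUo, hgU, fun _ g hg => hU g.1 hg g rfl⟩
    · exact ⟨0, univ, isOpen_univ, mem_univ _, fun h => absurd h.2 hg₀⟩
  choose σ U hUo hgU hU using hloc
  obtain ⟨n, c, f, hcK, hf, hfc, hf0, hfU, hfχ, hf1⟩ := exists_partition_subordinate
    (hK.inter_right hC) hχ (hχ1.mono inter_subset_left) hχc (fun g => (hχ01 g).1) hUo
    (fun g _ => hgU g)
  refine ⟨∑ i, ccFunMul (f i) (hf i) (σ (c i)), fun g => ?_, fun g hg => ?_⟩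
  · rw [Cc_sum_apply]
    have := norm_sub_sum_smul_le Finset.univ (k := φ g) (a := fun i => (σ (c i)).1 g.1)
      (φ := fun i => f i g.1) hε.le (fun i => hf0 i g.1) ?_ (fun i hi => ?_)
      ((hfχ g.1).trans (hχ01 g.1).2)
    · rwa [mul_one] at this
    · by_cases hg : g.1 ∈ K
      · exact Or.inr (hf1 g.1 ⟨hg, g.2⟩)
      · exact Or.inl (hφK g hg)
    · refine (hU (c i) (hcK i) g ?_).le
      by_contra h
      exact hi (hfU i g.1 h)
  · rw [Cc_sum_apply]
    refine Finset.sum_eq_zero fun i _ => ?_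
    have h1 : ∑ i, f i g ≤ 0 := (hfχ g).trans_eq hg
    have h2 : f i g = 0 := le_antisymm
      ((Finset.single_le_sum (fun j _ => hf0 j g) (Finset.mem_univ i)).trans h1) (hf0 i g)
    change (f i g : ℂ) • _ = 0
    rw [h2]
    simp

/-- A compactly supported section over a closed subset extends to a global section. -/
theorem exists_Cc_extension (hC : IsClosed C) (hK : IsCompact K)
    (hφ : Continuous fun g : C => (⟨g.1, φ g⟩ : E.Tot)) (hφK : ∀ g : C, g.1 ∉ K → φ g = 0) :
    ∃ ζ : E.Cc, ∀ g : C, ζ.1 g.1 = φ g := by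
  obtain ⟨χ, hχ, hχ1, hχc, hχ01⟩ := exists_cutoff hK
  -- Tietze's iteration: approximations with error 2^{-n} on C whose successive differences are at
  -- most 2 · 2^{-n} on all of Γ.
  let P : ℕ → E.Cc → Prop := fun n s => ∀ g : C, ‖φ g - s.1 g.1‖ ≤ (1 / 2) ^ n
  obtain ⟨s₀, hs₀, -⟩ := exists_Cc_approx hC hK hφ hφK hχ hχ1 hχc hχ01 one_pos
  have hstep : ∀ n, ∀ s : {s // P n s}, ∃ s' : {s // P (n + 1) s},
      ∀ g, ‖s.1.1 g - s'.1.1 g‖ ≤ 2 * (1 / 2) ^ n := by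
    rintro n ⟨s, hs⟩
    set r : ℝ := (1 / 2) ^ n with hr
    have hr0 : 0 < r := by positivity
    obtain ⟨L, hL, hsL⟩ := s.2.2
    obtain ⟨χ', hχ', hχ1', hχc', hχ01'⟩ := exists_cutoff (hK.union hL)
    have hψ : Continuous fun g : C => (⟨g.1, φ g - s.1 g.1⟩ : E.Tot) :=
      continuous_iff_continuousAt.2 fun g => E.continuousAt_sub (f := fun g : C => g.1)
        hφ.continuousAt ((Cc_continuous s).comp continuous_subtype_val).continuousAt
    obtain ⟨ζ, hζ, -⟩ := exists_Cc_approx (φ := fun g : C => φ g - s.1 g.1) hC (hK.union hL) hψ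
      (fun g hg => by
        rw [mem_union, not_or] at hg
        rw [hsL g.1 hg.2, hφK g hg.1, sub_zero])
      hχ' hχ1' hχc' hχ01' (show 0 < r / 2 by positivity)
    obtain ⟨L', hL', hζL⟩ := ζ.2.2
    -- On C the correction ζ has norm at most r + r/2 < 2r, and {‖ζ‖ < 2r} is open by upper
    -- semicontinuity. Multiplying ζ by a function that is 1 on L' ∩ C and 0 outside this open set
    -- makes it small everywhere; on C nothing changes, since ζ vanishes off L'.
    have hV : IsOpen {g | ‖ζ.1 g‖ < 2 * r} := isOpen_iff_mem_nhds.2 fun g hg =>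
      (Cc_continuous ζ).continuousAt.eventually (E.norm_usc ⟨g, ζ.1 g⟩ (2 * r) hg)
    have hCV : L' ∩ C ⊆ {g | ‖ζ.1 g‖ < 2 * r} := by
      rintro g ⟨-, hg⟩
      have h1 := hζ ⟨g, hg⟩
      have h2 := hs ⟨g, hg⟩
      have h3 := norm_sub_norm_le (ζ.1 g) (φ ⟨g, hg⟩ - s.1 g)
      rw [norm_sub_rev (ζ.1 g)] at h3
      change ‖ζ.1 g‖ < 2 * r
      linarith
    obtain ⟨u, hu1, hu0, -, hu01⟩ := exists_continuous_one_zero_of_isCompact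
      (hL'.inter_right hC) hV.isClosed_compl (disjoint_compl_right_iff_subset.2 hCV)
    refine ⟨⟨s + ccFunMul u u.continuous ζ, fun g => ?_⟩, fun g => ?_⟩
    · have h1 : (u g.1 : ℂ) • ζ.1 g.1 = ζ.1 g.1 := by
        by_cases hg : g.1 ∈ L'
        · rw [hu1 ⟨hg, g.2⟩]
          simp
        · rw [hζL g.1 hg, smul_zero]
      change ‖φ g - (s.1 g.1 + (u g.1 : ℂ) • ζ.1 g.1)‖ ≤ _
      rw [h1, ← sub_sub, pow_succ, ← hr]
      exact (hζ g).trans_eq (by ring)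
    · change ‖s.1 g - (s.1 g + (u g : ℂ) • ζ.1 g)‖ ≤ 2 * r
      rw [sub_add_cancel_left, norm_neg, norm_smul, Complex.norm_real,
        Real.norm_of_nonneg (hu01 g).1]
      by_cases hg : ‖ζ.1 g‖ < 2 * r
      · nlinarith [(hu01 g).2, (hu01 g).1, norm_nonneg (ζ.1 g)]
      · have : u g = 0 := hu0 hg
        rw [this, zero_mul]
        positivity
  choose step hstep using hstep
  let s : ∀ n, {s // P n s} := fun n => Nat.rec ⟨s₀, by simpa [P] using hs₀⟩ (fun n s => step n s) n
  have hs : ∀ n g, ‖(s n).1.1 g - (s (n + 1)).1.1 g‖ ≤ 2 * (1 / 2) ^ n := fun n g =>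
    hstep n (s n) g
  have hlim : ∀ g, ∃ e : E.fiber g, Tendsto (fun n => (s n).1.1 g) atTop (𝓝 e) := fun g =>
    cauchySeq_tendsto_of_complete (cauchySeq_of_le_geometric (1 / 2) 2 (by norm_num) fun n => by
      rw [dist_eq_norm]
      exact hs n g)
  choose σ hσ using hlim
  have hσn : ∀ n g, ‖(s n).1.1 g - σ g‖ ≤ 4 * (1 / 2) ^ n := fun n g => by
    have := dist_le_of_le_geometric_of_tendsto (1 / 2) 2 (by norm_num)
      (fun n => by rw [dist_eq_norm]; exact hs n g) (hσ g) n
    rw [dist_eq_norm] at this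
    refine this.trans_eq (by ring)
  have hσc : Continuous fun g => (⟨g, σ g⟩ : E.Tot) := continuous_iff_continuousAt.2 fun g =>
    E.continuousAt_of_approx (f := fun g => g) continuousAt_id fun ε hε => by
      obtain ⟨n, hn⟩ := exists_pow_lt_of_lt_one (show 0 < ε / 4 by positivity)
        (show (1 / 2 : ℝ) < 1 by norm_num)
      refine ⟨(s n).1.1, (Cc_continuous (s n).1).continuousAt, Eventually.of_forall fun z => ?_⟩
      rw [norm_sub_rev]
      linarith [hσn n z]
  have hσφ : ∀ g : C, σ g.1 = φ g := fun g => by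
    refine tendsto_nhds_unique (hσ g.1) ?_
    rw [tendsto_iff_norm_sub_tendsto_zero]
    refine squeeze_zero (fun _ => norm_nonneg _) (fun n => ?_)
      (tendsto_pow_atTop_nhds_zero_of_lt_one (r := (1 / 2 : ℝ)) (by norm_num) (by norm_num))
    rw [norm_sub_rev]
    exact (s n).2 g
  -- The uniform limit σ need not have compact support. The cutoff restores it and is 1 on K, off
  -- which φ vanishes.
  refine ⟨ccOfSection χ hχ hχc σ hσc, fun g => ?_⟩
  change (χ g.1 : ℂ) • σ g.1 = φ g
  rw [hσφ]
  by_cases hg : g.1 ∈ K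
  · rw [hχ1 hg]
    simp
  · rw [hφK g hg, smul_zero]

end Tietze

end FellBundle

/-! ### Invariance of the Haar system -/

namespace TopGroupoid

variable {Γ M : Type*} [TopologicalSpace Γ] [TopologicalSpace M] {𝒢 : TopGroupoid Γ M}

theorem comp_mul_inv_right {g h k : Γ} (c : 𝒢.Comp h g k) : 𝒢.mul k (𝒢.inv g) = h := by
  obtain ⟨hc, rfl⟩ := c
  rw [𝒢.mul_assoc _ _ _ hc (𝒢.tgt_inv g).symm, 𝒢.mul_inv, ← hc, 𝒢.mul_unit]

theorem inv_mul_inv {g h : Γ} (hc : 𝒢.src (𝒢.inv g) = 𝒢.tgt h) :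
    𝒢.inv (𝒢.mul (𝒢.inv g) h) = 𝒢.mul (𝒢.inv h) g := by
  have hc' : 𝒢.tgt g = 𝒢.tgt h := by rw [← hc, 𝒢.src_inv]
  have hc2 : 𝒢.src (𝒢.inv h) = 𝒢.tgt g := by rw [𝒢.src_inv, hc']
  have e : 𝒢.mul (𝒢.mul (𝒢.inv h) g) (𝒢.mul (𝒢.inv g) h) = 𝒢.unit (𝒢.src h) := by
    rw [𝒢.mul_assoc _ _ _ hc2 (by rw [𝒢.tgt_mul _ _ hc, 𝒢.tgt_inv]),
      ← 𝒢.mul_assoc g _ _ (𝒢.tgt_inv g).symm hc, 𝒢.mul_inv, hc', 𝒢.unit_mul, 𝒢.inv_mul]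
  have c : 𝒢.Comp (𝒢.mul (𝒢.inv h) g) (𝒢.mul (𝒢.inv g) h) (𝒢.unit (𝒢.src h)) :=
    ⟨by rw [𝒢.src_mul _ _ hc2, 𝒢.tgt_mul _ _ hc, 𝒢.tgt_inv], e⟩
  have h1 := comp_mul_inv_right c
  rw [← h1]
  have h2 := 𝒢.unit_mul (𝒢.inv (𝒢.mul (𝒢.inv g) h))
  rw [𝒢.tgt_inv, 𝒢.src_mul _ _ hc] at h2
  exact h2.symm

/-- Composability is a closed condition, so the composable pairs in K × L form a compact set, on
which multiplication is continuous. -/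
theorem isCompact_comp {K L : Set Γ} [T2Space Γ] (hK : IsCompact K) (hL : IsCompact L) :
    ∃ N : Set Γ, IsCompact N ∧ ∀ {h g k : Γ}, 𝒢.Comp h g k → h ∈ K → g ∈ L → k ∈ N := by
  have := 𝒢.t2Space_base
  have hcl : IsClosed {p : Γ × Γ | 𝒢.src p.1 = 𝒢.tgt p.2} :=
    isClosed_eq (𝒢.continuous_src.comp continuous_fst) (𝒢.continuous_tgt.comp continuous_snd)
  refine ⟨(fun p : Γ × Γ => 𝒢.mul p.1 p.2) '' (K ×ˢ L ∩ {p | 𝒢.src p.1 = 𝒢.tgt p.2}),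
    ((hK.prod hL).inter_right hcl).image_of_continuousOn
      (𝒢.continuous_mul.mono inter_subset_right), ?_⟩
  rintro h g k ⟨hc, rfl⟩ hh hg
  exact ⟨(h, g), ⟨⟨hh, hg⟩, hc⟩, rfl⟩

end TopGroupoid

namespace HaarSystem

variable {Γ M : Type*} [TopologicalSpace Γ] [TopologicalSpace M] {𝒢 : TopGroupoid Γ M}
  [T2Space Γ] [LocallyCompactSpace Γ] [SecondCountableTopology Γ] [MeasurableSpace Γ]
  [BorelSpace Γ] (lam : HaarSystem 𝒢)

theorem ae_src_eq (x : M) : ∀ᵐ g ∂(lam.rmeas x), 𝒢.src g = x := lam.rmeas_compl x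

theorem ae_tgt_eq (x : M) : ∀ᵐ g ∂(lam.meas x), 𝒢.tgt g = x := by
  have h : (lam.meas x) ((lam.meas x).support)ᶜ = 0 := Measure.measure_compl_support
  rw [lam.support_eq] at h
  exact h

theorem continuousOn_mul_right {g : Γ} {y : M} (ht : 𝒢.tgt g = y) :
    ContinuousOn (fun k => 𝒢.mul k g) {k | 𝒢.src k = y} :=
  𝒢.continuous_mul.comp (f := fun k => (k, g)) (by fun_prop) fun k (hk : 𝒢.src k = y) => by
    simp [hk, ht]

theorem aemeasurable_mul_right {g : Γ} {y : M} (ht : 𝒢.tgt g = y) :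
    AEMeasurable (fun k => 𝒢.mul k g) (lam.rmeas y) := by
  have := (continuousOn_mul_right ht).aemeasurable (μ := lam.rmeas y)
    (𝒢.isClosed_src y).measurableSet
  rwa [Measure.restrict_eq_self_of_ae_mem] at this
  exact lam.rmeas_compl y

/-- Since (k g)⁻¹ = g⁻¹ k⁻¹ and λ_x is the image of λ^x under inversion, left invariance under g⁻¹
becomes right invariance under g. It is tested on compactly supported functions, which suffice
because both measures are finite on compact sets. -/
theorem map_mul_right {g : Γ} {x y : M} (ht : 𝒢.tgt g = y) (hs : 𝒢.src g = x) :
    (lam.rmeas y).map (fun k => 𝒢.mul k g) = lam.rmeas x := by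
  have hm := lam.aemeasurable_mul_right ht
  have _ : IsFiniteMeasureOnCompacts (lam.rmeas x) := ⟨fun _ hK => lam.rmeas_lt_top x hK⟩
  have _ : IsFiniteMeasureOnCompacts ((lam.rmeas y).map (fun k => 𝒢.mul k g)) := by
    refine ⟨fun K hK => ?_⟩
    rw [Measure.map_apply_of_aemeasurable hm hK.measurableSet]
    -- If k g ∈ K then k ∈ K g⁻¹, which lies in a compact set.
    obtain ⟨N, hN, h⟩ := 𝒢.isCompact_comp hK (isCompact_singleton (x := 𝒢.inv g))
    refine lt_of_le_of_lt ?_ (lam.rmeas_lt_top y hN)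
    refine measure_mono_ae ?_
    filter_upwards [lam.ae_src_eq y] with k hk hkK
    have c : 𝒢.Comp k g (𝒢.mul k g) := ⟨hk.trans ht.symm, rfl⟩
    exact h ⟨by rw [𝒢.src_mul _ _ c.1, 𝒢.tgt_inv], TopGroupoid.comp_mul_inv_right c⟩ hkK rfl
  have _ : SigmaCompactSpace Γ := inferInstance
  let _ := TopologicalSpace.metrizableSpaceMetric Γ
  refine Measure.ext_of_integral_eq_on_compactlySupported fun f => ?_
  have hfc : Continuous (f : Γ → ℝ) := f.continuous
  rw [integral_map hm hfc.aestronglyMeasurable, rmeas, rmeas]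
  have hf1 : AEStronglyMeasurable (fun k => f (𝒢.mul k g)) ((lam.meas y).map 𝒢.inv) := by
    exact (hfc.measurable.comp_aemeasurable hm).aestronglyMeasurable
  rw [integral_map 𝒢.continuous_inv.aemeasurable hf1,
    integral_map 𝒢.continuous_inv.aemeasurable hfc.aestronglyMeasurable]
  let e : Γ ≃ₜ Γ :=
    { toFun := 𝒢.inv, invFun := 𝒢.inv, left_inv := 𝒢.inv_inv, right_inv := 𝒢.inv_inv
      continuous_toFun := 𝒢.continuous_inv, continuous_invFun := 𝒢.continuous_inv }
  have h := lam.left_invariant (𝒢.inv g) (fun h => f (𝒢.inv h))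
    (hfc.comp 𝒢.continuous_inv) (f.hasCompactSupport.comp_homeomorph e)
  rw [𝒢.src_inv, 𝒢.tgt_inv, ht, hs] at h
  rw [← h]
  refine integral_congr_ae ?_
  filter_upwards [lam.ae_tgt_eq y] with k hk
  rw [TopGroupoid.inv_mul_inv (by rw [𝒢.src_inv, ht, hk])]

end HaarSystem

namespace FellBundle

variable {Γ M : Type*} [TopologicalSpace Γ] [TopologicalSpace M] {𝒢 : TopGroupoid Γ M}
  [T2Space Γ] [LocallyCompactSpace Γ] [SecondCountableTopology Γ] [MeasurableSpace Γ]
  [BorelSpace Γ] (lam : HaarSystem 𝒢) {E : FellBundle 𝒢}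

/-- Integrals over `Γ_{s(g)}` and `Γ_{t(g)}` of kernels that correspond under `h ↦ h g`. -/
theorem sliceIntegral_conj {g : Γ} {x y : M} (ht : 𝒢.tgt g = y) (hs : 𝒢.src g = x)
    (e e' : E.fiber g) {k : ∀ h, 𝒢.src h = x → E.unitFiber x}
    {b : ∀ h, 𝒢.src h = y → E.unitFiber y}
    (hk : AEStronglyMeasurable (E.extend x k) (lam.rmeas x))
    (hb : Integrable (E.extend y b) (lam.rmeas y))
    (hkb : ∀ {h m} (hh : 𝒢.src h = y) (hm : 𝒢.src m = x), 𝒢.Comp h g m →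
      k m hm = E.conjL ht hs e e' (b h hh)) :
    E.sliceIntegral lam x k = E.conjL ht hs e e' (E.sliceIntegral lam y b) := by
  rw [sliceIntegral, sliceIntegral, ← ContinuousLinearMap.integral_comp_comm _ hb]
  rw [← lam.map_mul_right ht hs] at hk ⊢
  rw [integral_map (lam.aemeasurable_mul_right ht) hk]
  refine integral_congr_ae ?_
  filter_upwards [lam.ae_src_eq y] with h hh
  have c : 𝒢.Comp h g (𝒢.mul h g) := ⟨hh.trans ht.symm, rfl⟩
  have hm : 𝒢.src (𝒢.mul h g) = x := by rw [𝒢.src_mul _ _ c.1, hs]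
  rw [extend, dif_pos hm, extend, dif_pos hh]
  exact hkb hh hm c

end FellBundle

namespace TopGroupoid

variable {Γ M : Type*} [TopologicalSpace Γ] [TopologicalSpace M] {𝒢 : TopGroupoid Γ M}

theorem comp_inv_left {h g m : Γ} (c : 𝒢.Comp h g m) : 𝒢.Comp (𝒢.inv h) m g := by
  obtain ⟨hc, rfl⟩ := c
  refine ⟨by rw [𝒢.src_inv, 𝒢.tgt_mul _ _ hc], ?_⟩
  rw [← 𝒢.mul_assoc _ _ _ (𝒢.src_inv h) hc, 𝒢.inv_mul, hc, 𝒢.unit_mul]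

theorem comp_inv_inv {h g m : Γ} (c : 𝒢.Comp h g m) : 𝒢.Comp (𝒢.inv g) (𝒢.inv h) (𝒢.inv m) := by
  obtain ⟨hc, rfl⟩ := c
  refine ⟨by rw [𝒢.src_inv, 𝒢.tgt_inv, hc], ?_⟩
  have := inv_mul_inv (𝒢 := 𝒢) (g := 𝒢.inv h) (h := g) (by rw [𝒢.inv_inv, hc])
  rw [𝒢.inv_inv] at this
  exact this.symm

end TopGroupoid

namespace FellBundle

variable {Γ M : Type*} [TopologicalSpace Γ] [TopologicalSpace M] {𝒢 : TopGroupoid Γ M}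
  [T2Space Γ] [LocallyCompactSpace Γ] {E : FellBundle 𝒢}

/-! ### Right translation of sections -/

/-- There is a section that is equal to `h ↦ ξ(h g⁻¹) e` on `Γ_{s(g)}`. -/
theorem exists_translate {g : Γ} (ξ : E.Cc) (e : E.fiber g) :
    ∃ ζ : E.Cc, ∀ {h k} (c : 𝒢.Comp h g k), ζ.1 k = E.mul c (ξ.1 h) e := by
  have := 𝒢.t2Space_base
  -- On the closed fibre of s containing g the translated section is continuous, with support in the
  -- compact set (supp ξ) g, so it extends to Γ. The values off this fibre are arbitrary.
  set C : Set Γ := {k | 𝒢.src k = 𝒢.src g}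
  have hC : IsClosed C := isClosed_singleton.preimage 𝒢.continuous_src
  obtain ⟨K, hK, hξK⟩ := ξ.2.2
  obtain ⟨N, hN, hKN⟩ := 𝒢.isCompact_comp hK (isCompact_singleton (x := g))
  let φ : ∀ k : C, E.fiber k.1 := fun k =>
    E.mul (TopGroupoid.comp_mul_inv k.2) (ξ.1 (𝒢.mul k.1 (𝒢.inv g))) e
  have hdiv : Continuous fun k : C => 𝒢.mul k.1 (𝒢.inv g) :=
    𝒢.continuous_mul.comp_continuous (f := fun k : C => (k.1, 𝒢.inv g)) (by fun_prop)
      fun k => by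
        have : 𝒢.src k.1 = 𝒢.src g := k.2
        simp [this, 𝒢.tgt_inv]
  have hφ : Continuous fun k : C => (⟨k.1, φ k⟩ : E.Tot) :=
    continuous_iff_continuousAt.2 fun k => E.continuousAt_mul (f₁ := fun k : C => 𝒢.mul k.1 (𝒢.inv g))
      (f₂ := fun _ => g) (f₃ := fun k : C => k.1) (b := fun _ => e)
      (fun k => TopGroupoid.comp_mul_inv k.2)
      ((Cc_continuous ξ).comp hdiv).continuousAt continuousAt_const
  obtain ⟨ζ, hζ⟩ := exists_Cc_extension hC hN hφ fun k hk => by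
    change E.mul _ (ξ.1 (𝒢.mul k.1 (𝒢.inv g))) e = 0
    rw [hξK _ fun h => hk (hKN (TopGroupoid.comp_mul_inv k.2) h rfl), E.mul_zero_left]
  refine ⟨ζ, fun {h k} c => ?_⟩
  have hk : 𝒢.src k = 𝒢.src g := by rw [← c.2, 𝒢.src_mul _ _ c.1]
  rw [hζ ⟨k, hk⟩]
  have key : ∀ h' (c' : 𝒢.Comp h' g k), h' = h → E.mul c' (ξ.1 h') e = E.mul c (ξ.1 h) e := by
    rintro h' c' rfl
    rfl
  exact key _ _ (TopGroupoid.comp_mul_inv_right c)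

/-- A section that is equal to `h ↦ ξ(h g⁻¹) e` on `Γ_{s(g)}`. -/
noncomputable def translate {g : Γ} (ξ : E.Cc) (e : E.fiber g) : E.Cc :=
  (exists_translate ξ e).choose

theorem translate_apply {g : Γ} (ξ : E.Cc) (e : E.fiber g) {h k : Γ} (c : 𝒢.Comp h g k) :
    (translate ξ e).1 k = E.mul c (ξ.1 h) e := (exists_translate ξ e).choose_spec c

theorem comp_of_src_eq {g k : Γ} (hk : 𝒢.src k = 𝒢.src g) : ∃ h, 𝒢.Comp h g k :=
  ⟨_, TopGroupoid.comp_mul_inv hk⟩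

/-- For m = h g this is (ξ(h) e)* (ξ'(h) e') = e* (ξ(h)* ξ'(h)) e', the pointwise form of the
compatibility of translation with inner products. -/
theorem conjL_ccKernel {g : Γ} {x y : M} (ht : 𝒢.tgt g = y) (hs : 𝒢.src g = x) (ξ ξ' : E.Cc)
    (e e' : E.fiber g) {h m : Γ} (hh : 𝒢.src h = y) (hm : 𝒢.src m = x) (c : 𝒢.Comp h g m) :
    E.ccKernel (translate ξ e).1 (translate ξ' e').1 x m hm =
      E.conjL ht hs e e' (E.ccKernel ξ.1 ξ'.1 y h hh) := by
  rw [conjL_apply, ccKernel, ccKernel, translate_apply ξ e c, translate_apply ξ' e' c,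
    E.star_mul c (TopGroupoid.comp_inv_inv c) rfl rfl rfl,
    E.mul_assoc _ _ (TopGroupoid.comp_inv_left c) (TopGroupoid.comp_inv_self hs),
    E.mul_assoc _ _ c (TopGroupoid.comp_inv_left c)]

section L2

variable [SecondCountableTopology Γ] [MeasurableSpace Γ] [BorelSpace Γ] (lam : HaarSystem 𝒢)

variable (E) in
/-- The inclusion of `C_c(Γ; E)` into `L²(Γ; E)`. -/
noncomputable def toL2L : E.Cc →ₗ[ℂ] E.L2 lam where
  toFun := toL2 lam
  map_add' _ _ := UniformSpace.Completion.coe_add _ _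
  map_smul' c v := UniformSpace.Completion.coe_smul c (show (E.ccSemiInner lam).Pre from v)

theorem toL2L_apply (ξ : E.Cc) : toL2L E lam ξ = toL2 lam ξ := rfl

theorem denseRange_toL2L : DenseRange (toL2L E lam) := (E.ccSemiInner lam).denseRange_toHilb

theorem ip_toL2L (x : M) (ξ η : E.Cc) :
    E.ip x (toL2L E lam ξ) (toL2L E lam η) = E.sliceIntegral lam x (E.ccKernel ξ.1 η.1 x) :=
  congrArg (fun a : E.Aop => a.unop x) ((E.ccSemiInner lam).inner_toHilb ξ η)

theorem fibInner_eq_of_dense {x : M} {u v : E.Fib (E.L2 lam) x}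
    (h : ∀ ξ : E.Cc, E.fibInner x (E.val x (toL2L E lam ξ)) u
      = E.fibInner x (E.val x (toL2L E lam ξ)) v) : u = v := by
  rw [← sub_eq_zero]
  refine eq_zero_of_fibInner fun w => ?_
  rw [map_sub, sub_eq_zero]
  obtain ⟨ζ, rfl⟩ := E.val_surjective x w
  refine (denseRange_toL2L (E := E) lam).induction_on (p := fun ζ =>
    E.fibInner x (E.val x ζ) u = E.fibInner x (E.val x ζ) v) ζ (isClosed_eq ?_ ?_) h
  · exact ((fibInnerL E (E.L2 lam) x).flip u).continuous.comp (valL E (E.L2 lam) x).continuous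
  · exact ((fibInnerL E (E.L2 lam) x).flip v).continuous.comp (valL E (E.L2 lam) x).continuous

/-- The inner product at x integrates over Γ_x only. Hence the arbitrary values of `translate` off
the fibre are harmless. -/
theorem val_toL2L_congr {x : M} {ζ ζ' : E.Cc} (h : ∀ k, 𝒢.src k = x → ζ.1 k = ζ'.1 k) :
    E.val x (toL2L E lam ζ) = E.val x (toL2L E lam ζ') := by
  refine fibInner_eq_of_dense lam fun ξ => ?_
  rw [fibInner_val, fibInner_val, ip_toL2L, ip_toL2L]
  congr 1
  funext k hk
  rw [ccKernel, ccKernel, h k hk]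

theorem norm_val_toL2L_sq_le {x : M} {ζ : E.Cc} {χ : Γ → ℝ} (hχ : Continuous χ)
    (hχc : HasCompactSupport χ) {C : ℝ} (h : ∀ k, 𝒢.src k = x → ‖ζ.1 k‖ ^ 2 ≤ C * χ k) :
    ‖E.val x (toL2L E lam ζ)‖ ^ 2 ≤ C * ∫ k, χ k ∂(lam.rmeas x) := by
  rw [norm_fib_sq, fibInner_val, ip_toL2L, sliceIntegral, ← integral_const_mul]
  refine norm_integral_le_of_norm_le ((lam.integrable_rmeas hχ hχc x).const_mul _) ?_
  filter_upwards [lam.ae_src_eq x] with k hk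
  rw [extend, dif_pos hk, ccKernel]
  refine (E.norm_mul_le _ _ _).trans ?_
  rw [norm_star_eq, ← sq]
  exact h k hk

/-! ### The action on `L²(Γ; E)` -/

variable (E) in
/-- The action of `E_g` on sections. -/
noncomputable def ccTranslate {g : Γ} {x : M} (hs : 𝒢.src g = x) :
    E.Cc →ₗ[ℂ] E.fiber g →ₗ[ℂ] E.Fib (E.L2 lam) x :=
  LinearMap.mk₂ ℂ (fun ξ e => E.val x (toL2L E lam (translate ξ e)))
    (fun ξ ξ' e => by
      rw [← map_add, ← map_add]
      refine val_toL2L_congr lam fun k hk => ?_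
      obtain ⟨h, c⟩ := comp_of_src_eq (hk.trans hs.symm)
      change (translate (ξ + ξ') e).1 k = (translate ξ e).1 k + (translate ξ' e).1 k
      rw [translate_apply _ _ c, translate_apply _ _ c, translate_apply _ _ c, ← E.add_mul]
      rfl)
    (fun z ξ e => by
      rw [← map_smul, ← map_smul]
      refine val_toL2L_congr lam fun k hk => ?_
      obtain ⟨h, c⟩ := comp_of_src_eq (hk.trans hs.symm)
      change (translate (z • ξ) e).1 k = z • (translate ξ e).1 k
      rw [translate_apply _ _ c, translate_apply _ _ c, ← E.smul_mul]
      rfl)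
    (fun ξ e e' => by
      rw [← map_add, ← map_add]
      refine val_toL2L_congr lam fun k hk => ?_
      obtain ⟨h, c⟩ := comp_of_src_eq (hk.trans hs.symm)
      change (translate ξ (e + e')).1 k = (translate ξ e).1 k + (translate ξ e').1 k
      rw [translate_apply _ _ c, translate_apply _ _ c, translate_apply _ _ c, ← E.mul_add])
    (fun z ξ e => by
      rw [← map_smul, ← map_smul]
      refine val_toL2L_congr lam fun k hk => ?_
      obtain ⟨h, c⟩ := comp_of_src_eq (hk.trans hs.symm)
      change (translate ξ (z • e)).1 k = z • (translate ξ e).1 k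
      rw [translate_apply _ _ c, translate_apply _ _ c, ← E.mul_smul])

theorem ccTranslate_apply {g : Γ} {x : M} (hs : 𝒢.src g = x) (ξ : E.Cc) (e : E.fiber g) :
    ccTranslate E lam hs ξ e = E.val x (toL2L E lam (translate ξ e)) := rfl

theorem ccTranslate_eq {g : Γ} {x : M} (hs : 𝒢.src g = x) (ξ : E.Cc) (e : E.fiber g) {ζ : E.Cc}
    (hζ : ∀ {h k} (c : 𝒢.Comp h g k), ζ.1 k = E.mul c (ξ.1 h) e) :
    ccTranslate E lam hs ξ e = E.val x (toL2L E lam ζ) := by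
  refine val_toL2L_congr lam fun k hk => ?_
  obtain ⟨h, c⟩ := comp_of_src_eq (hk.trans hs.symm)
  rw [translate_apply _ _ c, hζ c]

variable (E) in
/-- The space of sections spanned by the translates `h ↦ ξ(h g⁻¹) e`. -/
def translates (g : Γ) : Submodule ℂ E.Cc :=
  Submodule.span ℂ {ω | ∃ (ξ : E.Cc) (e : E.fiber g),
    ∀ {h k} (c : 𝒢.Comp h g k), ω.1 k = E.mul c (ξ.1 h) e}

theorem val_mem_of_mem_translates {g : Γ} {x : M} (hs : 𝒢.src g = x) {ω : E.Cc}
    (hω : ω ∈ translates E g) : E.val x (toL2L E lam ω) ∈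
      Submodule.span ℂ (range fun p : E.Cc × E.fiber g => ccTranslate E lam hs p.1 p.2) := by
  induction hω using Submodule.span_induction with
  | mem ω hω =>
    obtain ⟨ξ, e, h⟩ := hω
    exact Submodule.subset_span ⟨(ξ, e), ccTranslate_eq lam hs ξ e h⟩
  | zero => simp only [map_zero, Submodule.zero_mem]
  | add ω ω' _ _ h h' =>
    rw [map_add, map_add]
    exact Submodule.add_mem _ h h'
  | smul c ω _ h =>
    rw [map_smul, map_smul]
    exact Submodule.smul_mem _ c h

-- f(k) ξ(k g⁻¹) e is the translate of h ↦ f(h g) ξ(h), which is defined on a closed fibre and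
-- extends to Γ. Partitions of unity can therefore be used inside the span.
omit [SecondCountableTopology Γ] [MeasurableSpace Γ] [BorelSpace Γ] in
theorem ccFunMul_mem_translates {g : Γ} (f : Γ → ℝ) (hf : Continuous f) {ω : E.Cc}
    (hω : ω ∈ translates E g) : ccFunMul f hf ω ∈ translates E g := by
  induction hω using Submodule.span_induction with
  | mem ω hω =>
    obtain ⟨ξ, e, h⟩ := hω
    have := 𝒢.t2Space_base
    set C : Set Γ := {k | 𝒢.src k = 𝒢.tgt g}
    have hC : IsClosed C := isClosed_singleton.preimage 𝒢.continuous_src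
    obtain ⟨K, hK, hξK⟩ := ξ.2.2
    have hm : Continuous fun l : C => 𝒢.mul l.1 g :=
      𝒢.continuous_mul.comp_continuous (f := fun l : C => (l.1, g)) (by fun_prop) fun l => l.2
    obtain ⟨ξ', hξ'⟩ := exists_Cc_extension (E := E)
      (φ := fun l : C => (f (𝒢.mul l.1 g) : ℂ) • ξ.1 l.1) hC hK
      (continuous_iff_continuousAt.2 fun l => E.continuousAt_smul (f := fun l : C => l.1)
        (Complex.continuous_ofReal.comp (hf.comp hm)).continuousAt
        ((Cc_continuous ξ).comp continuous_subtype_val).continuousAt)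
      (fun l hl => by rw [hξK _ hl, smul_zero])
    refine Submodule.subset_span ⟨ξ', e, fun {l k} c => ?_⟩
    change (f k : ℂ) • ω.1 k = _
    have hl : ξ'.1 l = (f k : ℂ) • ξ.1 l := by
      obtain ⟨hc, rfl⟩ := c
      exact hξ' ⟨l, hc⟩
    rw [hl, E.smul_mul, h c]
  | zero =>
    convert Submodule.zero_mem (translates E g)
    exact Subtype.ext (funext fun k => smul_zero _)
  | add ω ω' _ _ h h' =>
    convert Submodule.add_mem (translates E g) h h'
    exact Subtype.ext (funext fun k => smul_add _ _ _)
  | smul c ω _ h =>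
    convert Submodule.smul_mem (translates E g) c h
    exact Subtype.ext (funext fun k => smul_comm _ _ _)

-- Products E_h · E_g are total in E_k for k = h g, and every element of E_h is the value of a
-- section in C_c(Γ; E).
omit [SecondCountableTopology Γ] [MeasurableSpace Γ] [BorelSpace Γ] in
theorem exists_translates_near {g k : Γ} (hk : 𝒢.src k = 𝒢.src g) (e : E.fiber k) {δ : ℝ}
    (hδ : 0 < δ) : ∃ ω ∈ translates E g, ‖e - ω.1 k‖ < δ := by
  obtain ⟨h, c⟩ := comp_of_src_eq hk
  have key : ∀ w ∈ Submodule.span ℂ (range fun p : E.fiber h × E.fiber g => E.mul c p.1 p.2),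
      ∃ ω ∈ translates E g, ω.1 k = w := by
    intro w hw
    induction hw using Submodule.span_induction with
    | mem w hw =>
      obtain ⟨⟨b, a⟩, rfl⟩ := hw
      obtain ⟨ξ, hξ⟩ := exists_Cc_apply_eq h b
      refine ⟨translate ξ a, Submodule.subset_span ⟨ξ, a, fun c => translate_apply ξ a c⟩, ?_⟩
      rw [translate_apply ξ a c, hξ]
    | zero => exact ⟨0, Submodule.zero_mem _, rfl⟩
    | add w w' _ _ h h' =>
      obtain ⟨ω, hω, rfl⟩ := h
      obtain ⟨ω', hω', rfl⟩ := h'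
      exact ⟨ω + ω', Submodule.add_mem _ hω hω', rfl⟩
    | smul z w _ h =>
      obtain ⟨ω, hω, rfl⟩ := h
      exact ⟨z • ω, Submodule.smul_mem _ z hω, rfl⟩
  obtain ⟨w, hw, hwδ⟩ := Metric.dense_iff.1 (E.dense_mul c) e δ hδ
  obtain ⟨ω, hω, rfl⟩ := key w hwδ
  refine ⟨ω, hω, ?_⟩
  rw [← dist_eq_norm, dist_comm]
  exact hw

/-- Approximations at single points of Γ_x are glued by a partition of unity, which does not leave
the span. The pointwise error δ χ gives a squared norm of at most δ² ∫ χ dλ_x; as χ is independent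
of δ, this can be made smaller than ε². -/
theorem exists_translates_approx {g : Γ} {x : M} (hs : 𝒢.src g = x) (ζ : E.Cc) {ε : ℝ}
    (hε : 0 < ε) : ∃ ω ∈ translates E g,
      ‖E.val x (toL2L E lam ζ) - E.val x (toL2L E lam ω)‖ < ε := by
  obtain ⟨K, hK, hζK⟩ := ζ.2.2
  obtain ⟨χ, hχ, hχ1, hχc, hχ01⟩ := exists_cutoff hK
  have hC := 𝒢.isClosed_src x
  set I : ℝ := ∫ k, χ k ∂(lam.rmeas x)
  have hI : 0 ≤ I := integral_nonneg fun k => (hχ01 k).1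
  obtain ⟨δ, hδ, hδI⟩ : ∃ δ : ℝ, 0 < δ ∧ δ ^ 2 * I < ε ^ 2 := by
    refine ⟨ε / √(I + 1), by positivity, ?_⟩
    rw [div_pow, Real.sq_sqrt (by positivity), div_mul_eq_mul_div, div_lt_iff₀ (by positivity)]
    nlinarith [pow_pos hε 2]
  have hloc : ∀ k : Γ, ∃ ω ∈ translates E g, 𝒢.src k = x → ‖ζ.1 k - ω.1 k‖ < δ := by
    intro k
    by_cases hk : 𝒢.src k = x
    · obtain ⟨ω, hω, h⟩ := exists_translates_near (hk.trans hs.symm) (ζ.1 k) hδ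
      exact ⟨ω, hω, fun _ => h⟩
    · exact ⟨0, Submodule.zero_mem _, fun h => absurd h hk⟩
  choose ω hω hωk using hloc
  have hUo : ∀ k, IsOpen {h | ‖ζ.1 h - (ω k).1 h‖ < δ} := fun k => isOpen_iff_mem_nhds.2 fun h hh =>
    (E.continuousAt_sub (f := fun h => h) (Cc_continuous ζ).continuousAt
      (Cc_continuous (ω k)).continuousAt).eventually (E.norm_usc ⟨h, _⟩ δ hh)
  obtain ⟨n, c, f, hcK, hf, hfc, hf0, hfU, hfχ, hf1⟩ := exists_partition_subordinate
    (hK.inter_right hC) hχ (hχ1.mono inter_subset_left) hχc (fun g => (hχ01 g).1) hUo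
    (fun k hk => hωk k hk.2)
  refine ⟨∑ i, ccFunMul (f i) (hf i) (ω (c i)),
    Submodule.sum_mem _ fun i _ => ccFunMul_mem_translates _ _ (hω _), ?_⟩
  rw [← map_sub, ← map_sub]
  refine lt_of_pow_lt_pow_left₀ 2 hε.le (lt_of_le_of_lt ?_ hδI)
  refine norm_val_toL2L_sq_le lam hχ hχc fun k hk => ?_
  have h1 : ‖ζ.1 k - ∑ i, (f i k : ℂ) • (ω (c i)).1 k‖ ≤ δ * χ k := by
    refine norm_sub_sum_smul_le Finset.univ hδ.le (fun i => hf0 i k) ?_ (fun i hi => ?_) (hfχ k)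
    · by_cases hkK : k ∈ K
      · exact Or.inr (hf1 k ⟨hkK, hk⟩)
      · exact Or.inl (hζK k hkK)
    · refine le_of_lt ?_
      by_contra h
      exact hi (hfU i k h)
  have h2 : (ζ - ∑ i, ccFunMul (f i) (hf i) (ω (c i)) : E.Cc).1 k
      = ζ.1 k - ∑ i, (f i k : ℂ) • (ω (c i)).1 k := by
    change ζ.1 k - (∑ i, ccFunMul (f i) (hf i) (ω (c i)) : E.Cc).1 k = _
    rw [Cc_sum_apply]
    rfl
  rw [h2]
  calc _ ≤ (δ * χ k) ^ 2 := by gcongr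
    _ = δ ^ 2 * (χ k * χ k) := by ring
    _ ≤ δ ^ 2 * χ k := by
      gcongr
      exact mul_le_of_le_one_left (hχ01 k).1 (hχ01 k).2

/-- Translates by nearby arrows are uniformly close. -/
theorem eventually_translate_sub_le (ξ ζ : E.Cc) {η : ∀ g, E.fiber g}
    (hη : Continuous fun g => (⟨g, η g⟩ : E.Tot)) (g₀ : Γ)
    (hζ : ∀ {h k} (c : 𝒢.Comp h g₀ k), ζ.1 k = E.mul c (ξ.1 h) (η g₀)) :
    ∃ N : Set Γ, IsCompact N ∧ ∀ δ > 0, ∀ᶠ g in 𝓝 g₀, ∀ {h k} (c : 𝒢.Comp h g k),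
      ‖E.mul c (ξ.1 h) (η g) - ζ.1 k‖ < δ ∧
        (k ∉ N → E.mul c (ξ.1 h) (η g) - ζ.1 k = 0) := by
  have := 𝒢.t2Space_base
  obtain ⟨K, hK, hξK⟩ := ξ.2.2
  obtain ⟨L, hL, hζL⟩ := ζ.2.2
  obtain ⟨G, hG, hgG⟩ := exists_compact_mem_nhds g₀
  obtain ⟨N₀, hN₀, hKG⟩ := 𝒢.isCompact_comp hK hG
  have hzero : ∀ {g h k} (c : 𝒢.Comp h g k), g ∈ G → k ∉ N₀ ∪ L →
      E.mul c (ξ.1 h) (η g) - ζ.1 k = 0 := fun {g h k} c hg hk => by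
    rw [mem_union, not_or] at hk
    rw [hξK h fun hh => hk.1 (hKG c hh hg), E.mul_zero_left, hζL k hk.2, sub_zero]
  refine ⟨N₀ ∪ L, hN₀.union hL, fun δ hδ => ?_⟩
  have hev : ∀ᶠ g in 𝓝 g₀, ∀ k ∈ N₀ ∪ L, ∀ {h} (c : 𝒢.Comp h g k),
      ‖E.mul c (ξ.1 h) (η g) - ζ.1 k‖ < δ := by
    -- A tube argument over the compact set of all k. Near (g₀, k₀) with equal sources the
    -- difference is continuous and vanishes at the centre. If the sources differ, they differ for
    -- all nearby pairs, and no h exists.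
    refine (hN₀.union hL).eventually_forall_of_forall_eventually fun k₀ _ => ?_
    by_cases hk₀ : 𝒢.src k₀ = 𝒢.src g₀
    · have hdiv : Continuous fun p : {p : Γ × Γ // 𝒢.src p.2 = 𝒢.src p.1} => 𝒢.mul p.1.2 (𝒢.inv p.1.1) :=
        𝒢.continuous_mul.comp_continuous (f := fun p : {p : Γ × Γ // 𝒢.src p.2 = 𝒢.src p.1} => (p.1.2, 𝒢.inv p.1.1))
          (by have := 𝒢.continuous_inv; fun_prop) fun p => by
            simp [p.2, 𝒢.tgt_inv]
      have hc : Continuous fun p : {p : Γ × Γ // 𝒢.src p.2 = 𝒢.src p.1} => (⟨p.1.2, E.mul (TopGroupoid.comp_mul_inv p.2)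
          (ξ.1 (𝒢.mul p.1.2 (𝒢.inv p.1.1))) (η p.1.1) - ζ.1 p.1.2⟩ : E.Tot) :=
        continuous_iff_continuousAt.2 fun p => E.continuousAt_sub (f := fun p : {p : Γ × Γ // 𝒢.src p.2 = 𝒢.src p.1} => p.1.2)
          (E.continuousAt_mul (f₁ := fun p : {p : Γ × Γ // 𝒢.src p.2 = 𝒢.src p.1} => 𝒢.mul p.1.2 (𝒢.inv p.1.1))
            (f₂ := fun p : {p : Γ × Γ // 𝒢.src p.2 = 𝒢.src p.1} => p.1.1) (f₃ := fun p : {p : Γ × Γ // 𝒢.src p.2 = 𝒢.src p.1} => p.1.2)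
            (fun p => TopGroupoid.comp_mul_inv p.2) ((Cc_continuous ξ).comp hdiv).continuousAt
            (hη.comp (continuous_fst.comp continuous_subtype_val)).continuousAt)
          ((Cc_continuous ζ).comp (continuous_snd.comp continuous_subtype_val)).continuousAt
      have h0 : ‖E.mul (TopGroupoid.comp_mul_inv hk₀) (ξ.1 (𝒢.mul k₀ (𝒢.inv g₀))) (η g₀)
          - ζ.1 k₀‖ < δ := by
        rw [hζ (TopGroupoid.comp_mul_inv hk₀), sub_self, norm_zero]
        exact hδ
      have hev := (hc.continuousAt (x := ⟨(g₀, k₀), hk₀⟩)).eventually (E.norm_usc ⟨k₀, _⟩ δ h0)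
      obtain ⟨W, hW, hWs⟩ := mem_nhds_induced Subtype.val _ _ |>.1 hev
      filter_upwards [hW] with p hp h c
      have hp1 : 𝒢.src p.2 = 𝒢.src p.1 := by rw [← c.2, 𝒢.src_mul _ _ c.1]
      have h1 := hWs (a := ⟨p, hp1⟩) hp
      have key : ∀ h' (c' : 𝒢.Comp h' p.1 p.2), h' = h →
          E.mul c' (ξ.1 h') (η p.1) = E.mul c (ξ.1 h) (η p.1) := by
        rintro h' c' rfl
        rfl
      rwa [← key _ (TopGroupoid.comp_mul_inv hp1) (TopGroupoid.comp_mul_inv_right c)]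
    · have hop : IsOpen {p : Γ × Γ | 𝒢.src p.2 ≠ 𝒢.src p.1} :=
        isOpen_ne_fun (𝒢.continuous_src.comp continuous_snd) (𝒢.continuous_src.comp continuous_fst)
      filter_upwards [hop.mem_nhds (show (g₀, k₀) ∈ _ from hk₀)] with p hp h c
      exact absurd (by rw [← c.2, 𝒢.src_mul _ _ c.1]) hp
  filter_upwards [hev, hgG] with g hg hgG h k c
  refine ⟨?_, hzero c hgG⟩
  by_cases hk : k ∈ N₀ ∪ L
  · exact hg k hk c
  · rw [hzero c hgG hk, norm_zero]
    exact hδ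

variable (E) in
/-- Right translation as equivariance data on `L²(Γ; E)`. -/
noncomputable def preL2 : PreEquivariantStructure E E.Cc (E.L2 lam) where
  incl := toL2L E lam
  denseRange_incl := denseRange_toL2L lam
  act _ hs := ccTranslate E lam hs
  inner_act {g x y} ht hs ξ ξ' e e' := by
    rw [ccTranslate_apply, ccTranslate_apply, fibInner_val, ip_toL2L, ip_toL2L]
    exact sliceIntegral_conj lam ht hs e e' (integrable_ccKernel lam _ _ x).aestronglyMeasurable
      (integrable_ccKernel lam ξ ξ' y) fun hh hm c => conjL_ccKernel ht hs ξ ξ' e e' hh hm c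
  dense_act {g x y} ht hs ζ ε hε := by
    obtain ⟨ω, hω, h⟩ := exists_translates_approx lam hs ζ hε
    exact ⟨_, val_mem_of_mem_translates lam hs hω, h⟩
  act_act {g h k x y z} c htg hsg hth hsh htk hsk ξ a := by
    refine ⟨translate ξ a, rfl, fun b => ?_⟩
    refine val_toL2L_congr lam fun m hm => ?_
    obtain ⟨n, cn⟩ := comp_of_src_eq (hm.trans hsh.symm)
    obtain ⟨l, cl⟩ := comp_of_src_eq (cn.1.trans (hth.trans hsg.symm))
    have clk : 𝒢.Comp l k m := by
      refine ⟨cl.1.trans (htg.trans htk.symm), ?_⟩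
      rw [← c.2, ← 𝒢.mul_assoc _ _ _ cl.1 c.1, cl.2, cn.2]
    rw [translate_apply _ _ cn, translate_apply _ _ cl, translate_apply _ _ clk,
      E.mul_assoc cl cn c clk]
  continuous_act ξ η hη _ g₀ ε hε := by
    obtain ⟨N, hN, hev⟩ := eventually_translate_sub_le ξ (translate ξ (η g₀)) hη g₀
      (fun c => translate_apply ξ (η g₀) c)
    obtain ⟨χ, hχ, hχ1, hχc, hχ01⟩ := exists_cutoff hN
    set I : ℝ := ∫ k, χ k ∂(lam.rmeas (𝒢.src g₀)) with hIdef
    have hI : 0 ≤ I := integral_nonneg fun k => (hχ01 k).1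
    have hlt : ∀ᶠ g in 𝓝 g₀, ∫ k, χ k ∂(lam.rmeas (𝒢.src g)) < I + 1 :=
      ((lam.continuous_integral_rmeas hχ hχc).comp 𝒢.continuous_src).continuousAt.eventually_lt
        continuousAt_const (show I < I + 1 by linarith)
    set δ : ℝ := ε / √(I + 1) with hδdef
    have hδ : 0 < δ := by positivity
    have hδI : δ ^ 2 * (I + 1) = ε ^ 2 := by
      rw [hδdef, div_pow, Real.sq_sqrt (by positivity)]
      field_simp
    -- The single translate at g₀ approximates those at nearby g: the pointwise error is below δ on
    -- N and zero off N, while the integrals of χ stay below I + 1.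
    refine ⟨toL2L E lam (translate ξ (η g₀)), ?_⟩
    filter_upwards [hlt, hev δ hδ] with g hg hgδ
    rw [ccTranslate_apply, ← map_sub, ← map_sub]
    refine lt_of_pow_lt_pow_left₀ 2 hε.le ?_
    change ‖E.val (𝒢.src g) (toL2L E lam (translate ξ (η g) - translate ξ (η g₀)))‖ ^ 2 < ε ^ 2
    refine (norm_val_toL2L_sq_le lam (C := δ ^ 2) hχ hχc fun k hk => ?_).trans_lt ?_
    · obtain ⟨h, c⟩ := comp_of_src_eq hk
      have h1 : (translate ξ (η g) - translate ξ (η g₀) : E.Cc).1 k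
          = E.mul c (ξ.1 h) (η g) - (translate ξ (η g₀)).1 k := by
        rw [← translate_apply _ _ c]
        rfl
      rw [h1]
      by_cases hkN : k ∈ N
      · rw [hχ1 hkN, Pi.one_apply, mul_one]
        gcongr
        exact (hgδ c).1.le
      · rw [(hgδ c).2 hkN, norm_zero, zero_pow two_ne_zero]
        exact mul_nonneg (sq_nonneg _) (hχ01 k).1
    · rw [← hδI]
      gcongr

variable (E) in
/-- The equivariant structure of `L²(Γ; E)`. -/
noncomputable def l2Structure : EquivariantStructure E (E.L2 lam) :=
  (E.preL2 lam).toEquivariantStructure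

theorem l2Structure_act {g : Γ} {x y : M} (ht : 𝒢.tgt g = y) (hs : 𝒢.src g = x) (ξ : E.Cc)
    (e : E.fiber g) : (E.l2Structure lam).act ht hs (E.val y (toL2L E lam ξ)) e
      = E.val x (toL2L E lam (translate ξ e)) :=
  (E.preL2 lam).toEquivariantStructure_act ht hs ξ e

theorem isTranslation_amp : (E.l2Structure lam).amp.IsTranslation := by
  intro g x y ht hs e ξ ζ m n
  rw [EquivariantStructure.amp_act, ← EquivariantStructure.fibIncl_val,
    EquivariantStructure.fibInner_fibIncl, ← toL2L_apply, ← toL2L_apply, l2Structure_act,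
    fibInner_val, ip_toL2L]
  congr 1
  congr 1
  funext k hk
  rw [ccKernel, translate_apply _ _ (TopGroupoid.comp_mul_inv (hk.trans hs.symm))]

end L2

end FellBundle

namespace HaarSystem

variable {Γ M : Type*} [TopologicalSpace Γ] [TopologicalSpace M] {𝒢 : TopGroupoid Γ M}
  [T2Space Γ] [LocallyCompactSpace Γ] [SecondCountableTopology Γ] [MeasurableSpace Γ]
  [BorelSpace Γ] (lam : HaarSystem 𝒢)

/-- The integral is continuous in x and vanishes off the compact set s(supp χ). -/
theorem exists_abs_integral_le {χ : Γ → ℝ} (hχ : Continuous χ) (hχc : HasCompactSupport χ) :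
    ∃ C, 0 ≤ C ∧ ∀ x, |∫ g, χ g ∂(lam.rmeas x)| ≤ C := by
  obtain ⟨C, hC⟩ := (hχc.image 𝒢.continuous_src).exists_bound_of_continuousOn
    (lam.continuous_integral_rmeas hχ hχc).continuousOn
  refine ⟨max C 0, le_max_right _ _, fun x => ?_⟩
  by_cases hx : x ∈ 𝒢.src '' tsupport χ
  · exact (hC x hx).trans (le_max_left _ _)
  · rw [integral_eq_zero_of_ae, abs_zero]
    · exact le_max_right _ _
    · filter_upwards [lam.ae_src_eq x] with g hg
      exact image_eq_zero_of_notMem_tsupport fun h => hx ⟨g, h, hg⟩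

end HaarSystem

namespace FellBundle

variable {Γ M : Type*} [TopologicalSpace Γ] [TopologicalSpace M] {𝒢 : TopGroupoid Γ M}
  [T2Space Γ] [LocallyCompactSpace Γ] {E : FellBundle 𝒢} {X : Type*} [NormedAddCommGroup X]
  [NormedSpace ℂ X] [SMul E.Aop X] [CStarModule E.Aop X] [CompleteSpace X]

/-! ### Integration of sections of the field of fibres of a Hilbert module -/

/-- A section of `(X_x)` that is a uniform limit of elements of `X` belongs to `X`. -/
theorem exists_val_eq_of_approx {u : ∀ x, E.Fib X x}
    (h : ∀ ε > 0, ∃ w : X, ∀ x, ‖u x - E.val x w‖ ≤ ε) : ∃ w : X, ∀ x, E.val x w = u x := by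
  choose w hw using fun n : ℕ => h ((1 / 2) ^ n) (by positivity)
  have hc : CauchySeq w := by
    refine cauchySeq_of_le_geometric (1 / 2) 2 (by norm_num) fun n => ?_
    rw [dist_eq_norm]
    refine norm_le_of_fibNorm (E := E) (by positivity) fun x => ?_
    rw [← fib_norm_def]
    have e : E.val x (w n - w (n + 1))
        = (u x - E.val x (w (n + 1))) - (u x - E.val x (w n)) := by rw [map_sub]; abel
    rw [e]
    refine (norm_sub_le _ _).trans ?_
    have h1 := hw n x
    have h2 := hw (n + 1) x
    rw [pow_succ] at h2
    have h3 : (0 : ℝ) < (1 / 2) ^ n := by positivity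
    linarith
  obtain ⟨v, hv⟩ := cauchySeq_tendsto_of_complete hc
  refine ⟨v, fun x => ?_⟩
  refine tendsto_nhds_unique (((valL E X x).continuous.tendsto v).comp hv) ?_
  rw [tendsto_iff_norm_sub_tendsto_zero]
  refine squeeze_zero (fun _ => norm_nonneg _) (fun n => ?_)
    (tendsto_pow_atTop_nhds_zero_of_lt_one (r := (1 / 2 : ℝ)) (by norm_num) (by norm_num))
  rw [norm_sub_rev]
  exact hw n x

open Classical in
/-- The function on `Γ` equal to `κ` on `Γ_x` and to `0` elsewhere. -/
noncomputable def extendFib (x : M) (κ : ∀ g, 𝒢.src g = x → E.Fib X x) (g : Γ) : E.Fib X x :=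
  if h : 𝒢.src g = x then κ g h else 0

theorem extendFib_of_eq {x : M} (κ : ∀ g, 𝒢.src g = x → E.Fib X x) {g : Γ} (h : 𝒢.src g = x) :
    extendFib x κ g = κ g h := dif_pos h

/-- A compactly supported continuous section `κ` of the field `(X_{s(g)})_g`. -/
structure IsFibFamily (κ : ∀ x g, 𝒢.src g = x → E.Fib X x) (K : Set Γ) : Prop where
  isCompact : IsCompact K
  eq_zero : ∀ x g h, g ∉ K → κ x g h = 0
  approx : ∀ g₀ : Γ, ∀ ε > 0, ∃ ζ : X, ∀ᶠ g in 𝓝 g₀,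
    ‖κ (𝒢.src g) g rfl - E.val (𝒢.src g) ζ‖ < ε

variable {κ : ∀ x g, 𝒢.src g = x → E.Fib X x} {K : Set Γ}

theorem IsFibFamily.extendFib_eq_zero (hκ : IsFibFamily κ K) {x : M} {g : Γ} (hg : g ∉ K) :
    extendFib x (κ x) g = 0 := by
  unfold extendFib
  split_ifs with h
  · exact hκ.eq_zero x g h hg
  · rfl

/-- Within Γ_x the fibre is fixed, and near g₀ all values are close to the same vector ζ(x). -/
theorem IsFibFamily.continuousOn (hκ : IsFibFamily κ K) (x : M) :
    ContinuousOn (extendFib x (κ x)) {g | 𝒢.src g = x} := by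
  rintro g₀ rfl
  rw [ContinuousWithinAt, Metric.tendsto_nhds]
  intro ε hε
  obtain ⟨ζ, hζ⟩ := hκ.approx g₀ (ε / 2) (half_pos hε)
  have h0 := hζ.self_of_nhds
  filter_upwards [mem_nhdsWithin_of_mem_nhds hζ, self_mem_nhdsWithin] with g hg hgx
  have hgx : 𝒢.src g = 𝒢.src g₀ := hgx
  have key : ∀ y (hy : 𝒢.src g = y), ‖κ y g hy - E.val y ζ‖ < ε / 2 := by
    rintro _ rfl
    exact hg
  rw [extendFib_of_eq _ hgx, extendFib_of_eq _ rfl, dist_eq_norm]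
  have h1 := key _ hgx
  have e : κ (𝒢.src g₀) g hgx - κ (𝒢.src g₀) g₀ rfl = (κ (𝒢.src g₀) g hgx - E.val (𝒢.src g₀) ζ)
      - (κ (𝒢.src g₀) g₀ rfl - E.val (𝒢.src g₀) ζ) := by abel
  rw [e]
  exact (norm_sub_le _ _).trans_lt (by linarith)

variable [SecondCountableTopology Γ] [MeasurableSpace Γ] [BorelSpace Γ] (lam : HaarSystem 𝒢)

theorem IsFibFamily.aestronglyMeasurable (hκ : IsFibFamily κ K) (x : M) :
    AEStronglyMeasurable (extendFib x (κ x)) (lam.rmeas x) := by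
  have := (hκ.continuousOn x).aestronglyMeasurable (μ := lam.rmeas x)
    (𝒢.isClosed_src x).measurableSet
  rwa [Measure.restrict_eq_self_of_ae_mem] at this
  exact lam.rmeas_compl x

theorem IsFibFamily.integrable (hκ : IsFibFamily κ K) (x : M) :
    Integrable (extendFib x (κ x)) (lam.rmeas x) := by
  obtain ⟨C, hC⟩ := (hκ.isCompact.inter_right (𝒢.isClosed_src x)).exists_bound_of_continuousOn
    ((hκ.continuousOn x).mono inter_subset_right)
  have hsupp : Function.support (extendFib x (κ x)) ⊆ K := by
    intro g hg
    by_contra hgK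
    exact hg (hκ.extendFib_eq_zero hgK)
  rw [← integrableOn_iff_integrable_of_support_subset hsupp]
  refine Measure.integrableOn_of_bounded (M := C) (lam.rmeas_lt_top x hκ.isCompact).ne
    (hκ.aestronglyMeasurable lam x) ?_
  refine (ae_restrict_iff' hκ.isCompact.measurableSet).2 ?_
  filter_upwards [lam.ae_src_eq x] with g hg hgK
  exact hC g ⟨hgK, hg⟩

/-- The integrals `∫_{Γ_x} κ dλ_x` form an element of `X`. -/
theorem IsFibFamily.exists_integral (hκ : IsFibFamily κ K) :
    ∃ w : X, ∀ x, E.val x w = ∫ g, extendFib x (κ x) g ∂(lam.rmeas x) := by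
  obtain ⟨χ, hχ, hχ1, hχc, hχ01⟩ := exists_cutoff hκ.isCompact
  obtain ⟨C, hC0, hC⟩ := lam.exists_abs_integral_le hχ hχc
  refine exists_val_eq_of_approx fun ε hε => ?_
  -- If κ is within δ of ζ_i on the i-th set of a cover, the sums ∑ (∫ f_i dλ_x) ζ_i(x) differ from
  -- the integral by at most δ ∫ χ dλ_x ≤ δ (C + 1) = ε, uniformly in x.
  set δ : ℝ := ε / (C + 1) with hδ
  have hδ0 : 0 < δ := by positivity
  have hloc : ∀ g₀ : Γ, ∃ ζ : X, ∃ U : Set Γ, IsOpen U ∧ g₀ ∈ U ∧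
      ∀ x g (h : 𝒢.src g = x), g ∈ U → ‖κ x g h - E.val x ζ‖ < δ := by
    intro g₀
    obtain ⟨ζ, hζ⟩ := hκ.approx g₀ δ hδ0
    obtain ⟨U, hU, hUo, hgU⟩ := eventually_nhds_iff.1 hζ
    refine ⟨ζ, U, hUo, hgU, ?_⟩
    rintro x g rfl hg
    exact hU g hg
  choose ζ U hUo hgU hU using hloc
  obtain ⟨n, c, f, hcK, hf, hfc, hf0, hfU, hfχ, hf1⟩ := exists_partition_subordinate hκ.isCompact
    hχ hχ1 hχc (fun g => (hχ01 g).1) hUo (fun g _ => hgU g)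
  -- These sums come from elements of `X`, because x ↦ ∫ f_i dλ_x is a bounded continuous function.
  have hη : ∀ i, ∃ η : X, ∀ x, E.val x η
      = ((∫ g, f i g ∂(lam.rmeas x) : ℝ) : ℂ) • E.val x (ζ (c i)) := fun i => by
    obtain ⟨D, -, hD⟩ := lam.exists_abs_integral_le (hf i) (hfc i)
    exact exists_funMul (E := E) ⟨_, lam.continuous_integral_rmeas (hf i) (hfc i)⟩ hD _
  choose η hη using hη
  refine ⟨∑ i, η i, fun x => ?_⟩
  have hint : ∀ i, Integrable (fun g => (f i g : ℂ) • E.val x (ζ (c i))) (lam.rmeas x) := fun i =>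
    ((lam.integrable_rmeas (hf i) (hfc i) x).ofReal (𝕜 := ℂ)).smul_const _
  have e1 : E.val x (∑ i, η i) = ∫ g, ∑ i, (f i g : ℂ) • E.val x (ζ (c i)) ∂(lam.rmeas x) := by
    rw [integral_finsetSum _ fun i _ => hint i, map_sum]
    refine Finset.sum_congr rfl fun i _ => ?_
    rw [integral_smul_const, hη]
    congr 1
    exact (integral_ofReal (𝕜 := ℂ)).symm
  rw [e1, ← integral_sub (hκ.integrable lam x) (integrable_finsetSum _ fun i _ => hint i)]
  have hb : ‖∫ g, (extendFib x (κ x) g - ∑ i, (f i g : ℂ) • E.val x (ζ (c i))) ∂(lam.rmeas x)‖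
      ≤ ∫ g, δ * χ g ∂(lam.rmeas x) := by
    refine norm_integral_le_of_norm_le ((lam.integrable_rmeas hχ hχc x).const_mul _) ?_
    filter_upwards [lam.ae_src_eq x] with g hg
    refine norm_sub_sum_smul_le Finset.univ hδ0.le (fun i => hf0 i g) ?_ (fun i hi => ?_) (hfχ g)
    · by_cases hgK : g ∈ K
      · exact Or.inr (hf1 g hgK)
      · exact Or.inl (hκ.extendFib_eq_zero hgK)
    · rw [extendFib_of_eq _ hg]
      refine (hU (c i) x g hg ?_).le
      by_contra h
      exact hi (hfU i g h)
  refine hb.trans ?_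
  rw [integral_const_mul]
  calc δ * ∫ g, χ g ∂(lam.rmeas x) ≤ δ * (C + 1) := by
        gcongr
        exact ((le_abs_self _).trans (hC x)).trans (by linarith)
    _ = ε := by rw [hδ]; field_simp

end FellBundle

namespace EquivariantStructure

open FellBundle

variable {Γ M : Type*} [TopologicalSpace Γ] [TopologicalSpace M] {𝒢 : TopGroupoid Γ M}
  [T2Space Γ] [LocallyCompactSpace Γ] {E : FellBundle 𝒢} {X : Type*} [NormedAddCommGroup X]
  [NormedSpace ℂ X] [SMul E.Aop X] [CStarModule E.Aop X] [CompleteSpace X]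
  (α : EquivariantStructure E X)

theorem isFibFamily_act (ξ : X) (η : E.Cc) : ∃ K, IsFibFamily (fun x g (h : 𝒢.src g = x) =>
    α.act rfl h (E.val (𝒢.tgt g) ξ) (η.1 g)) K := by
  obtain ⟨K, hK, hηK⟩ := η.2.2
  refine ⟨K, hK, fun x g h hg => ?_, fun g₀ ε hε => ?_⟩
  · simp only [hηK g hg, map_zero]
  · exact α.continuous_act ξ η.1 (Cc_continuous η) (Cc_vanish η) g₀ ε hε

variable [SecondCountableTopology Γ] [MeasurableSpace Γ] [BorelSpace Γ] (lam : HaarSystem 𝒢)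

/-- The integral `∫_{Γ_x} ξ(t(g)) η(g) λ_x(dg)` as an element of `X`. -/
noncomputable def conv (ξ : X) : E.Cc →ₗ[ℂ] X where
  toFun η := ((α.isFibFamily_act ξ η).choose_spec.exists_integral lam).choose
  map_add' η η' := by
    refine eq_of_val (E := E) fun x => ?_
    rw [map_add]
    simp only [((α.isFibFamily_act ξ _).choose_spec.exists_integral lam).choose_spec x]
    rw [← integral_add ((α.isFibFamily_act ξ η).choose_spec.integrable lam x)
      ((α.isFibFamily_act ξ η').choose_spec.integrable lam x)]
    congr 1
    funext g
    simp only [extendFib]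
    split_ifs
    · exact map_add _ _ _
    · rw [add_zero]
  map_smul' c η := by
    refine eq_of_val (E := E) fun x => ?_
    rw [map_smul]
    simp only [((α.isFibFamily_act ξ _).choose_spec.exists_integral lam).choose_spec x]
    rw [RingHom.id_apply, ← integral_smul]
    congr 1
    funext g
    simp only [extendFib]
    split_ifs
    · exact map_smul _ _ _
    · rw [smul_zero]

theorem val_conv (ξ : X) (η : E.Cc) (x : M) : E.val x (α.conv lam ξ η)
    = ∫ g, extendFib x (fun g h => α.act rfl h (E.val (𝒢.tgt g) ξ) (η.1 g)) g ∂(lam.rmeas x) :=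
  ((α.isFibFamily_act ξ η).choose_spec.exists_integral lam).choose_spec x

theorem integrable_conv (ξ : X) (η : E.Cc) (x : M) : Integrable
    (extendFib x (fun g h => α.act rfl h (E.val (𝒢.tgt g) ξ) (η.1 g))) (lam.rmeas x) :=
  (α.isFibFamily_act ξ η).choose_spec.integrable lam x

/-- The map `η ↦ ∫ ξ(t(g)) η(g) dλ` is equivariant. -/
theorem act_conv (ξ : X) (η : E.Cc) {g : Γ} {x y : M} (ht : 𝒢.tgt g = y) (hs : 𝒢.src g = x)
    (e : E.fiber g) {ω : E.Cc} (hω : ∀ {h k} (c : 𝒢.Comp h g k), ω.1 k = E.mul c (η.1 h) e) :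
    α.act ht hs (E.val y (α.conv lam ξ η)) e = E.val x (α.conv lam ξ ω) := by
  have hm := (α.integrable_conv lam ξ ω x).aestronglyMeasurable
  rw [val_conv, val_conv, ← actL_apply,
    ← ContinuousLinearMap.integral_comp_comm _ (α.integrable_conv lam ξ η y)]
  -- Right invariance replaces the variable by h g, and (ξ(t(h)) η(h)) e = ξ(t(h g)) (η(h) e)
  -- because t(h g) = t(h).
  rw [← lam.map_mul_right ht hs] at hm ⊢
  rw [integral_map (lam.aemeasurable_mul_right ht) hm]
  refine integral_congr_ae ?_
  filter_upwards [lam.ae_src_eq y] with h hh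
  have c : 𝒢.Comp h g (𝒢.mul h g) := ⟨hh.trans ht.symm, rfl⟩
  have hm : 𝒢.src (𝒢.mul h g) = x := by rw [𝒢.src_mul _ _ c.1, hs]
  have htm : 𝒢.tgt (𝒢.mul h g) = 𝒢.tgt h := 𝒢.tgt_mul _ _ c.1
  rw [extendFib_of_eq _ hh, extendFib_of_eq _ hm, actL_apply, hω c,
    α.act_act c rfl hh ht hs htm hm]
  have key : ∀ z (hz : 𝒢.tgt (𝒢.mul h g) = z), α.act hz hm (E.val z ξ) (E.mul c (η.1 h) e)
      = α.act rfl hm (E.val (𝒢.tgt (𝒢.mul h g)) ξ) (E.mul c (η.1 h) e) := by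
    rintro _ rfl
    rfl
  exact key _ htm

end EquivariantStructure

namespace FellBundle

variable {Γ M : Type*} [TopologicalSpace Γ] [TopologicalSpace M] {𝒢 : TopGroupoid Γ M}
  (E : FellBundle 𝒢)

theorem norm_star_mul_self_eq {g : Γ} {x : M} (hs : 𝒢.src g = x) (b : E.fiber g) :
    ‖E.mul (TopGroupoid.comp_inv_self hs) (E.star rfl b) b‖ = ‖b‖ ^ 2 := by
  subst hs
  exact E.norm_star_mul_self rfl _ b

/-- Left multiplication as a linear map. -/
def mulLeft {g h k : Γ} (c : 𝒢.Comp g h k) (a : E.fiber g) : E.fiber h →ₗ[ℂ] E.fiber k where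
  toFun := E.mul c a
  map_add' := E.mul_add c a
  map_smul' z b := E.mul_smul c z a b

theorem continuous_mul_left {g h k : Γ} (c : 𝒢.Comp g h k) (a : E.fiber g) :
    Continuous (E.mul c a) :=
  ((E.mulLeft c a).mkContinuous ‖a‖ fun b => E.norm_mul_le c a b).continuous

end FellBundle

namespace EquivariantStructure

open FellBundle

variable {Γ M : Type*} [TopologicalSpace Γ] [TopologicalSpace M] {𝒢 : TopGroupoid Γ M}
  [T2Space Γ] [LocallyCompactSpace Γ] {E : FellBundle 𝒢} {X : Type*} [NormedAddCommGroup X]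
  [NormedSpace ℂ X] [SMul E.Aop X] [CStarModule E.Aop X] [CompleteSpace X]
  (α : EquivariantStructure E X) {g : Γ} {x y : M} (ht : 𝒢.tgt g = y) (hs : 𝒢.src g = x)

/-! ### The `E_g`-valued pairing of `X_{t(g)}` and `X_{s(g)}` -/

open TensorProduct in
/-- The map `z ⊗ e ↦ ⟨w, z⟩ e`. -/
noncomputable def prePairing (w : E.Fib X y) : E.Fib X y ⊗[ℂ] E.fiber g →ₗ[ℂ] E.fiber g :=
  TensorProduct.lift (LinearMap.mk₂ ℂ
    (fun z e => E.mul (TopGroupoid.comp_unit_left ht) (E.fibInner y w z) e)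
    (fun z z' e => by rw [map_add, E.add_mul])
    (fun c z e => by rw [map_smul, E.smul_mul])
    (fun z e e' => by rw [E.mul_add])
    (fun c z e => by rw [E.mul_smul]))

open TensorProduct in
/-- The map `z ⊗ e ↦ z e`. -/
noncomputable def tensorAct : E.Fib X y ⊗[ℂ] E.fiber g →ₗ[ℂ] E.Fib X x :=
  TensorProduct.lift (α.act ht hs)

theorem denseRange_tensorAct : DenseRange (α.tensorAct ht hs) := by
  intro w
  rw [Metric.mem_closure_iff]
  intro ε hε
  obtain ⟨w', hw', h⟩ := α.dense_act ht hs w ε hε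
  refine ⟨w', ?_, by rw [dist_eq_norm]; exact h⟩
  refine (Submodule.span_le (p := LinearMap.range (α.tensorAct ht hs))).2 ?_ hw'
  rintro _ ⟨⟨z, e⟩, rfl⟩
  exact ⟨z ⊗ₜ[ℂ] e, rfl⟩

open TensorProduct in
theorem star_mul_prePairing (w : E.Fib X y) (e : E.fiber g) (v : E.Fib X y ⊗[ℂ] E.fiber g) :
    E.mul (TopGroupoid.comp_inv_self hs) (E.star rfl e) (prePairing ht w v)
      = E.fibInner x (α.act ht hs w e) (α.tensorAct ht hs v) := by
  induction v using TensorProduct.induction_on with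
  | zero => rw [map_zero, map_zero, map_zero, E.mul_zero_right]
  | tmul z e' => exact (α.inner_act ht hs w z e e').symm
  | add v v' h h' => rw [map_add, map_add, map_add, E.mul_add, h, h']

-- For the value b ∈ E_g, b* b = ⟨w b, v⟩ and ‖w b‖ ≤ ‖w‖ ‖b‖, so one factor ‖b‖ cancels. In
-- particular b depends only on the image of v in X_{s(g)}, and the pairing descends to the fibre.
open TensorProduct in
theorem norm_prePairing_le (w : E.Fib X y) (v : E.Fib X y ⊗[ℂ] E.fiber g) :
    ‖prePairing ht w v‖ ≤ ‖w‖ * ‖α.tensorAct ht hs v‖ := by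
  set b := prePairing ht w v with hb
  rcases eq_or_ne ‖b‖ 0 with h0 | h0
  · rw [h0]
    positivity
  have h1 : ‖b‖ ^ 2 ≤ ‖w‖ * ‖b‖ * ‖α.tensorAct ht hs v‖ := by
    rw [← E.norm_star_mul_self_eq hs b]
    conv_lhs => rw [hb, α.star_mul_prePairing ht hs]
    exact (norm_fibInner_le _ _).trans (mul_le_mul_of_nonneg_right (α.norm_act_le ht hs w b)
      (Real.sqrt_nonneg _))
  have h2 : 0 < ‖b‖ := lt_of_le_of_ne (norm_nonneg _) h0.symm
  refine le_of_mul_le_mul_left ?_ h2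
  calc ‖b‖ * ‖b‖ = ‖b‖ ^ 2 := (sq _).symm
    _ ≤ _ := h1.trans_eq (by ring)

/-- The pairing `X_{t(g)} × X_{s(g)} → E_g` determined by `⟨w, z e⟩ = ⟨w, z⟩ e`. -/
noncomputable def pairing (w : E.Fib X y) : E.Fib X x →L[ℂ] E.fiber g :=
  (prePairing ht w).extendOfNorm (α.tensorAct ht hs)

theorem pairing_act (w z : E.Fib X y) (e : E.fiber g) : α.pairing ht hs w (α.act ht hs z e)
    = E.mul (TopGroupoid.comp_unit_left ht) (E.fibInner y w z) e :=
  LinearMap.extendOfNorm_eq (α.denseRange_tensorAct ht hs)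
    ⟨‖w‖, fun v => α.norm_prePairing_le ht hs w v⟩ (z ⊗ₜ[ℂ] e)

theorem norm_pairing_le (w : E.Fib X y) (z : E.Fib X x) : ‖α.pairing ht hs w z‖ ≤ ‖w‖ * ‖z‖ :=
  LinearMap.norm_extendOfNorm_apply_le (α.denseRange_tensorAct ht hs) _
    (fun v => α.norm_prePairing_le ht hs w v) z

theorem star_mul_pairing (w : E.Fib X y) (z : E.Fib X x) (e : E.fiber g) :
    E.mul (TopGroupoid.comp_inv_self hs) (E.star rfl e) (α.pairing ht hs w z)
      = E.fibInner x (α.act ht hs w e) z := by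
  refine (α.denseRange_tensorAct ht hs).induction_on (p := fun z =>
    E.mul (TopGroupoid.comp_inv_self hs) (E.star rfl e) (α.pairing ht hs w z)
      = E.fibInner x (α.act ht hs w e) z) z (isClosed_eq ?_ ?_) fun v => ?_
  · exact (E.continuous_mul_left _ _).comp (α.pairing ht hs w).continuous
  · exact (fibInnerL E X x (α.act ht hs w e)).continuous
  · rw [← α.star_mul_prePairing]
    congr 1
    exact LinearMap.extendOfNorm_eq (α.denseRange_tensorAct ht hs)
      ⟨‖w‖, fun v => α.norm_prePairing_le ht hs w v⟩ v

/-- Every element of the span of the `z e` extends to a continuous section with continuous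
pairings. -/
theorem exists_section_of_mem_span {g₀ : Γ} {w : E.Fib X (𝒢.src g₀)}
    (hw : w ∈ Submodule.span ℂ (range fun p : E.Fib X (𝒢.tgt g₀) × E.fiber g₀ =>
      α.act rfl rfl p.1 p.2)) :
    ∃ κ : ∀ g, E.Fib X (𝒢.src g), κ g₀ = w ∧
      (∀ ε > 0, ∃ ζ : X, ∀ᶠ g in 𝓝 g₀, ‖κ g - E.val (𝒢.src g) ζ‖ < ε) ∧
      ∀ ξ : X, ContinuousAt
        (fun g => (⟨g, α.pairing rfl rfl (E.val (𝒢.tgt g) ξ) (κ g)⟩ : E.Tot)) g₀ := by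
  induction hw using Submodule.span_induction with
  | mem w hw =>
    obtain ⟨⟨z, e⟩, rfl⟩ := hw
    obtain ⟨ζ, rfl⟩ := E.val_surjective _ z
    obtain ⟨η, rfl⟩ := exists_Cc_apply_eq g₀ e
    refine ⟨fun g => α.act rfl rfl (E.val (𝒢.tgt g) ζ) (η.1 g), rfl,
      fun ε hε => α.continuous_act ζ η.1 (Cc_continuous η) (Cc_vanish η) g₀ ε hε, fun ξ => ?_⟩
    simp only [pairing_act, fibInner_val]
    exact E.continuousAt_mul (f₁ := fun g => 𝒢.unit (𝒢.tgt g)) (f₂ := fun g => g) (f₃ := fun g => g)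
      (fun g => TopGroupoid.comp_unit_left rfl)
      ((A_continuous (inner E.Aop ξ ζ).unop).comp 𝒢.continuous_tgt).continuousAt
      (Cc_continuous η).continuousAt
  | zero =>
    refine ⟨fun _ => 0, rfl, fun ε hε => ⟨0, Eventually.of_forall fun g => ?_⟩, fun ξ => ?_⟩
    · rwa [map_zero, sub_zero, norm_zero]
    · simp only [map_zero]
      exact E.continuousAt_zero (f := fun g => g) continuousAt_id
  | add w w' _ _ h h' =>
    obtain ⟨κ, rfl, hκ, hκc⟩ := h
    obtain ⟨κ', rfl, hκ', hκc'⟩ := h'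
    refine ⟨fun g => κ g + κ' g, rfl, fun ε hε => ?_, fun ξ => ?_⟩
    · obtain ⟨ζ, hζ⟩ := hκ (ε / 2) (half_pos hε)
      obtain ⟨ζ', hζ'⟩ := hκ' (ε / 2) (half_pos hε)
      refine ⟨ζ + ζ', ?_⟩
      filter_upwards [hζ, hζ'] with g h h'
      rw [map_add, add_sub_add_comm]
      exact (norm_add_le _ _).trans_lt (by linarith)
    · simp only [map_add]
      exact E.continuousAt_add (f := fun g => g) (hκc ξ) (hκc' ξ)
  | smul c w _ h =>
    obtain ⟨κ, rfl, hκ, hκc⟩ := h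
    refine ⟨fun g => c • κ g, rfl, fun ε hε => ?_, fun ξ => ?_⟩
    · obtain ⟨ζ, hζ⟩ := hκ (ε / (‖c‖ + 1)) (by positivity)
      refine ⟨c • ζ, ?_⟩
      filter_upwards [hζ] with g h
      rw [map_smul, ← smul_sub, norm_smul]
      rw [lt_div_iff₀ (by positivity)] at h
      nlinarith [norm_nonneg (κ g - E.val (𝒢.src g) ζ)]
    · simp only [map_smul]
      exact E.continuousAt_smul (f := fun g => g) (c := fun _ => c) continuousAt_const (hκc ξ)

/-- Along sections g ↦ ζ(t(g)) η(g) continuity is visible from the formula for the pairing, and the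
values of such sections at g₀ are total. The norm bound and the upper semicontinuity of fibre norms
carry it over to every ζ. -/
theorem continuous_pairing (ξ ζ : X) : Continuous fun g =>
    (⟨g, α.pairing rfl rfl (E.val (𝒢.tgt g) ξ) (E.val (𝒢.src g) ζ)⟩ : E.Tot) := by
  refine continuous_iff_continuousAt.2 fun g₀ =>
    E.continuousAt_of_approx (f := fun g => g) continuousAt_id fun ε hε => ?_
  -- κ(g₀) is within δ/2 of ζ, and ζ' is within δ/2 of κ near g₀. So ζ - ζ' has norm below δ near
  -- g₀, and κ stays within 2δ of ζ there.
  set δ : ℝ := ε / (2 * (‖ξ‖ + 1)) with hδ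
  have hδ0 : 0 < δ := by positivity
  obtain ⟨w, hw, hwδ⟩ := α.dense_act (g := g₀) rfl rfl (E.val _ ζ) (δ / 2) (half_pos hδ0)
  obtain ⟨κ, rfl, hκ, hκc⟩ := α.exists_section_of_mem_span hw
  refine ⟨_, hκc ξ, ?_⟩
  obtain ⟨ζ', hζ'⟩ := hκ (δ / 2) (half_pos hδ0)
  have h0 : ‖E.val (𝒢.src g₀) (ζ - ζ')‖ < δ := by
    have e : E.val (𝒢.src g₀) (ζ - ζ') = (E.val (𝒢.src g₀) ζ - κ g₀)
        + (κ g₀ - E.val (𝒢.src g₀) ζ') := by rw [map_sub]; abel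
    rw [e]
    refine (norm_add_le _ _).trans_lt ?_
    have h1 : ‖E.val (𝒢.src g₀) ζ - κ g₀‖ < δ / 2 := hwδ
    linarith [hζ'.self_of_nhds]
  have h1 : ∀ᶠ g in 𝓝 g₀, ‖E.val (𝒢.src g) (ζ - ζ')‖ < δ :=
    𝒢.continuous_src.continuousAt.eventually (upperSemicontinuous_fibNorm (E := E) (ζ - ζ') _ _ h0)
  filter_upwards [h1, hζ'] with g h1 h2
  rw [← map_sub]
  have e : E.val (𝒢.src g) ζ - κ g = E.val (𝒢.src g) (ζ - ζ')
      - (κ g - E.val (𝒢.src g) ζ') := by rw [map_sub]; abel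
  have h3 : ‖E.val (𝒢.src g) ζ - κ g‖ ≤ 2 * δ := by
    rw [e]
    exact (norm_sub_le _ _).trans (by linarith)
  calc _ ≤ ‖E.val (𝒢.tgt g) ξ‖ * ‖E.val (𝒢.src g) ζ - κ g‖ := α.norm_pairing_le _ _ _ _
    _ ≤ ‖ξ‖ * (2 * δ) := mul_le_mul (norm_val_le _ _) h3 (norm_nonneg _) (norm_nonneg _)
    _ < (‖ξ‖ + 1) * (2 * δ) := by gcongr; linarith
    _ = ε := by rw [hδ]; field_simp

end EquivariantStructure

/-! ### Consequences of properness -/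

namespace TopGroupoid

variable {Γ M : Type*} [TopologicalSpace Γ] [TopologicalSpace M] {𝒢 : TopGroupoid Γ M}

theorem Proper.isCompact (h𝒢 : 𝒢.Proper) {K L : Set M} (hK : IsCompact K) (hL : IsCompact L) :
    IsCompact {g | 𝒢.src g ∈ K ∧ 𝒢.tgt g ∈ L} :=
  IsProperMap.isCompact_preimage h𝒢 (hK.prod hL)

/-- Arrows with source in supp θ and target in supp f form a compact set by properness. The factor θ
is there because f ∘ t alone need not have compact support. -/
theorem Proper.hasCompactSupport (h𝒢 : 𝒢.Proper) [T2Space Γ] {f θ : C(M, ℝ)}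
    (hf : HasCompactSupport f)
    (hθ : HasCompactSupport θ) : HasCompactSupport fun g => f (𝒢.tgt g) ^ 2 * θ (𝒢.src g) := by
  refine HasCompactSupport.intro (h𝒢.isCompact hθ hf) fun g hg => ?_
  by_cases h : 𝒢.src g ∈ tsupport θ
  · have : 𝒢.tgt g ∉ tsupport f := fun h' => hg ⟨h, h'⟩
    simp [image_eq_zero_of_notMem_tsupport this]
  · simp [image_eq_zero_of_notMem_tsupport h]

end TopGroupoid

namespace HaarSystem

variable {Γ M : Type*} [TopologicalSpace Γ] [TopologicalSpace M] {𝒢 : TopGroupoid Γ M}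
  [T2Space Γ] [LocallyCompactSpace Γ] [SecondCountableTopology Γ] [MeasurableSpace Γ]
  [BorelSpace Γ] (lam : HaarSystem 𝒢)

/-- On Γ_x the factor θ(s(g)) equals 1, so inserting it changes nothing and makes the integrand
compactly supported. -/
theorem integral_tgt_eq (h𝒢 : 𝒢.Proper) {f θ : C(M, ℝ)} (hf : HasCompactSupport f)
    (hθ : HasCompactSupport θ) {x : M} (hx : θ x = 1) :
    Integrable (fun g => f (𝒢.tgt g) ^ 2) (lam.rmeas x) ∧
      ∫ g, f (𝒢.tgt g) ^ 2 ∂(lam.rmeas x)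
        = ∫ g, f (𝒢.tgt g) ^ 2 * θ (𝒢.src g) ∂(lam.rmeas x) := by
  have hc : Continuous fun g => f (𝒢.tgt g) ^ 2 * θ (𝒢.src g) := by
    have h1 := 𝒢.continuous_tgt
    have h2 := 𝒢.continuous_src
    fun_prop
  have hae : (fun g => f (𝒢.tgt g) ^ 2 * θ (𝒢.src g)) =ᵐ[lam.rmeas x]
      fun g => f (𝒢.tgt g) ^ 2 := by
    filter_upwards [lam.ae_src_eq x] with g hg
    rw [hg, hx, mul_one]
  exact ⟨(lam.integrable_rmeas hc (h𝒢.hasCompactSupport hf hθ) x).congr hae,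
    (integral_congr_ae hae).symm⟩

/-- Right translation does not change targets, so by right invariance the integral is constant on
orbits. -/
theorem integral_tgt_invariant {f : C(M, ℝ)} {g : Γ} {x y : M} (ht : 𝒢.tgt g = y)
    (hs : 𝒢.src g = x) :
    ∫ h, f (𝒢.tgt h) ^ 2 ∂(lam.rmeas x) = ∫ h, f (𝒢.tgt h) ^ 2 ∂(lam.rmeas y) := by
  have hc : Continuous fun g => f (𝒢.tgt g) ^ 2 := by
    have h1 := 𝒢.continuous_tgt
    fun_prop
  rw [← lam.map_mul_right ht hs, integral_map (lam.aemeasurable_mul_right ht)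
    hc.aestronglyMeasurable]
  refine integral_congr_ae ?_
  filter_upwards [lam.ae_src_eq y] with h hh
  rw [𝒢.tgt_mul _ _ (hh.trans ht.symm)]

/-- The integrals `∫_{Γ_x} f(t(g))² λ_x(dg)` are uniformly bounded. -/
theorem exists_integral_tgt_le (h𝒢 : 𝒢.Proper) {f : C(M, ℝ)} (hf : HasCompactSupport f) :
    ∃ C, 0 ≤ C ∧ ∀ x, Integrable (fun g => f (𝒢.tgt g) ^ 2) (lam.rmeas x) ∧
      ∫ g, f (𝒢.tgt g) ^ 2 ∂(lam.rmeas x) ≤ C := by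
  obtain ⟨θ, hθ1, -, hθc, -⟩ := 𝒢.exists_bump hf isOpen_univ (subset_univ _)
  have hc : Continuous fun g => f (𝒢.tgt g) ^ 2 * θ (𝒢.src g) := by
    have h1 := 𝒢.continuous_tgt
    have h2 := 𝒢.continuous_src
    fun_prop
  obtain ⟨C, hC0, hC⟩ := lam.exists_abs_integral_le hc (h𝒢.hasCompactSupport hf hθc)
  refine ⟨C, hC0, fun x => ⟨?_, ?_⟩⟩
  · obtain ⟨θ', hθ1', -, hθc', -⟩ := 𝒢.exists_bump (isCompact_singleton (x := x)) isOpen_univ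
      (subset_univ _)
    exact (lam.integral_tgt_eq h𝒢 hf hθc' (hθ1' rfl)).1
  · by_cases h : ∃ g, 𝒢.src g = x ∧ 𝒢.tgt g ∈ tsupport f
    · obtain ⟨g, hs, ht⟩ := h
      rw [lam.integral_tgt_invariant rfl hs, (lam.integral_tgt_eq h𝒢 hf hθc (hθ1 ht)).2]
      exact (le_abs_self _).trans (hC _)
    · rw [integral_eq_zero_of_ae]
      · exact hC0
      · filter_upwards [lam.ae_src_eq x] with g hg
        have : 𝒢.tgt g ∉ tsupport f := fun h' => h ⟨g, hg, h'⟩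
        simp [image_eq_zero_of_notMem_tsupport this]

end HaarSystem

namespace FellBundle

variable {Γ M : Type*} [TopologicalSpace Γ] [TopologicalSpace M] {𝒢 : TopGroupoid Γ M}
  [T2Space Γ] [LocallyCompactSpace Γ] {E : FellBundle 𝒢} {X : Type*} [NormedAddCommGroup X]
  [NormedSpace ℂ X] [SMul E.Aop X] [CStarModule E.Aop X]

/-! ### Compactly supported elements of a Hilbert module -/

variable (E X) in
/-- The elements of a Hilbert module that vanish outside a compact subset of `M`. -/
def compactlySupported : Submodule ℂ X where
  carrier := {ζ | ∃ K : Set M, IsCompact K ∧ ∀ x ∉ K, E.val x ζ = 0}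
  zero_mem' := ⟨∅, isCompact_empty, fun _ _ => map_zero _⟩
  add_mem' := by
    rintro ζ ζ' ⟨K, hK, h⟩ ⟨K', hK', h'⟩
    refine ⟨K ∪ K', hK.union hK', fun x hx => ?_⟩
    rw [mem_union, not_or] at hx
    rw [map_add, h x hx.1, h' x hx.2, add_zero]
  smul_mem' := by
    rintro c ζ ⟨K, hK, h⟩
    exact ⟨K, hK, fun x hx => by rw [map_smul, h x hx, smul_zero]⟩

variable [CompleteSpace X]

/-- For u = (ξ a)(x) one has ⟨u, u⟩ = ⟨u, ξ(x)⟩ a(x), and a factor ‖u‖ cancels. -/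
theorem norm_val_act_le (x : M) (a : E.A) (ξ : X) : ‖E.val x (op a • ξ)‖ ≤ ‖ξ‖ * ‖a x‖ := by
  set u := E.val x (op a • ξ) with hu
  have h1 : ‖u‖ ^ 2 ≤ ‖u‖ * (‖ξ‖ * ‖a x‖) := by
    rw [norm_fib_sq, hu, fibInner_val, ip_act_right]
    refine (_root_.norm_mul_le _ _).trans ?_
    rw [← _root_.mul_assoc]
    refine mul_le_mul_of_nonneg_right ?_ (norm_nonneg _)
    rw [← fibInner_val]
    exact (norm_fibInner_le _ _).trans (mul_le_mul_of_nonneg_left (fibNorm_val_le x ξ)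
      (Real.sqrt_nonneg _))
  rcases eq_or_ne ‖u‖ 0 with h0 | h0
  · rw [h0]
    positivity
  · refine le_of_mul_le_mul_left ?_ (lt_of_le_of_ne (norm_nonneg _) h0.symm)
    rwa [← sq]

/-- Multiplication by elements of `A` can be approximated by multiplication by elements with
compact support. -/
theorem exists_compactSupport_approx (a : E.A) {ε : ℝ} (hε : 0 < ε) :
    ∃ b : E.A, (∃ K : Set M, IsCompact K ∧ ∀ x ∉ K, b x = 0) ∧ ∀ x, ‖a x - b x‖ ≤ ε := by
  obtain ⟨K, hK, hKa⟩ := a.2.2 ε hε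
  obtain ⟨f, hf1, -, hfc, hf01⟩ := 𝒢.exists_bump hK isOpen_univ (subset_univ _)
  refine ⟨mulFun f (C := 1) (fun y => abs_le.2 ⟨by linarith [(hf01 y).1], (hf01 y).2⟩) a,
    ⟨tsupport f, hfc, fun x hx => ?_⟩, fun x => ?_⟩
  · rw [mulFun_apply, image_eq_zero_of_notMem_tsupport hx]
    simp
  · rw [mulFun_apply]
    by_cases hx : x ∈ K
    · rw [hf1 hx]
      simpa using hε.le
    · have e : a x - (f x : ℂ) • a x = ((1 - f x : ℝ) : ℂ) • a x := by
        rw [Complex.ofReal_sub, sub_smul, Complex.ofReal_one, one_smul]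
      rw [e, norm_smul, Complex.norm_real, Real.norm_of_nonneg (by linarith [(hf01 x).2])]
      have h1 : ‖a x‖ < ε := hKa x hx
      nlinarith [norm_nonneg (a x), (hf01 x).1]

theorem val_act_sub (x : M) (a b : E.A) (ξ : X) :
    E.val x (op a • ξ) - E.val x (op b • ξ) = E.val x (op (a - b) • ξ) := by
  rw [← map_sub, val_eq_val_iff]
  intro ζ
  rw [ip_sub_right, ip_act_right, ip_act_right, ip_act_right, A_sub_apply, _root_.mul_sub]

theorem norm_act_sub_le {a b : E.A} {ε : ℝ} (hε : 0 ≤ ε) (h : ∀ x, ‖a x - b x‖ ≤ ε) (ξ : X) :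
    ‖op a • ξ - op b • ξ‖ ≤ ‖ξ‖ * ε := by
  refine norm_le_of_fibNorm (E := E) (by positivity) fun x => ?_
  rw [map_sub, val_act_sub]
  refine (norm_val_act_le x _ ξ).trans ?_
  gcongr
  exact h x

/-- ξ is close to some ξ a, and a is uniformly close to an element of `A` with compact support. -/
theorem dense_compactlySupported : Dense (compactlySupported E X : Set X) := by
  intro ξ
  rw [Metric.mem_closure_iff]
  intro ε hε
  obtain ⟨a, ha⟩ := CStarModule.exists_norm_sub_smul_lt (B := E.Aop) ξ (half_pos hε)
  obtain ⟨b, ⟨K, hK, hb⟩, hab⟩ := exists_compactSupport_approx a.unop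
    (show 0 < ε / (2 * (‖ξ‖ + 1)) by positivity)
  refine ⟨op b • ξ, ⟨K, hK, fun x hx => ?_⟩, ?_⟩
  · have := norm_val_act_le x b ξ
    rw [hb x hx, norm_zero, mul_zero] at this
    exact norm_le_zero_iff.1 this
  · rw [dist_eq_norm]
    have h1 := norm_act_sub_le (by positivity) hab ξ
    rw [MulOpposite.op_unop] at h1
    have h2 : ‖ξ‖ * (ε / (2 * (‖ξ‖ + 1))) < ε / 2 := by
      rw [mul_div_assoc', div_lt_div_iff₀ (by positivity) (by norm_num)]
      nlinarith [norm_nonneg ξ]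
    have e : ξ - op b • ξ = (ξ - a • ξ) + (a • ξ - op b • ξ) := by abel
    rw [e]
    exact (norm_add_le _ _).trans_lt (by linarith)

end FellBundle

/-! ### Integral operators from L²(Γ; E) to an equivariant module -/

namespace EquivariantStructure

open FellBundle

variable {Γ M : Type*} [TopologicalSpace Γ] [TopologicalSpace M] {𝒢 : TopGroupoid Γ M}
  [T2Space Γ] [LocallyCompactSpace Γ] {E : FellBundle 𝒢} {X : Type*} [NormedAddCommGroup X]
  [NormedSpace ℂ X] [SMul E.Aop X] [CStarModule E.Aop X] [CompleteSpace X]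
  (α : EquivariantStructure E X) (h𝒢 : 𝒢.Proper) (f : C(M, ℝ)) (hf : HasCompactSupport f) (ξ : X)

/-- The section `g ↦ f(t(g)) ⟨ξ(t(g)), ζ(s(g))⟩`. -/
noncomputable def pairingSection : compactlySupported E X →ₗ[ℂ] E.Cc where
  toFun ζ := ⟨fun g => (f (𝒢.tgt g) : ℂ) •
      α.pairing rfl rfl (E.val (𝒢.tgt g) ξ) (E.val (𝒢.src g) ζ.1),
    continuous_iff_continuousAt.2 fun g => E.continuousAt_smul (f := fun g => g)
      (Complex.continuous_ofReal.comp (f.continuous.comp 𝒢.continuous_tgt)).continuousAt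
      (α.continuous_pairing ξ ζ.1).continuousAt, by
    obtain ⟨ζ, K, hK, hζ⟩ := ζ
    refine ⟨_, h𝒢.isCompact hK hf, fun g hg => ?_⟩
    by_cases h : 𝒢.src g ∈ K
    · have : 𝒢.tgt g ∉ tsupport f := fun h' => hg ⟨h, h'⟩
      simp [image_eq_zero_of_notMem_tsupport this]
    · simp only [hζ _ h, map_zero, smul_zero]⟩
  map_add' ζ ζ' := Subtype.ext (funext fun g => by
    change (f (𝒢.tgt g) : ℂ) • α.pairing rfl rfl (E.val (𝒢.tgt g) ξ)
      (E.val (𝒢.src g) (ζ.1 + ζ'.1)) = (f (𝒢.tgt g) : ℂ) • α.pairing rfl rfl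
      (E.val (𝒢.tgt g) ξ) (E.val (𝒢.src g) ζ.1) + (f (𝒢.tgt g) : ℂ) • α.pairing rfl rfl
      (E.val (𝒢.tgt g) ξ) (E.val (𝒢.src g) ζ'.1)
    rw [map_add, map_add, smul_add])
  map_smul' c ζ := Subtype.ext (funext fun g => by
    change (f (𝒢.tgt g) : ℂ) • α.pairing rfl rfl (E.val (𝒢.tgt g) ξ)
      (E.val (𝒢.src g) (c • ζ.1)) = c • (f (𝒢.tgt g) : ℂ) • α.pairing rfl rfl
      (E.val (𝒢.tgt g) ξ) (E.val (𝒢.src g) ζ.1)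
    rw [map_smul, map_smul, smul_comm])

theorem pairingSection_apply (ζ : compactlySupported E X) (g : Γ) :
    (α.pairingSection h𝒢 f hf ξ ζ).1 g = (f (𝒢.tgt g) : ℂ) •
      α.pairing rfl rfl (E.val (𝒢.tgt g) ξ) (E.val (𝒢.src g) ζ.1) := rfl

variable [SecondCountableTopology Γ] [MeasurableSpace Γ] [BorelSpace Γ] (lam : HaarSystem 𝒢)

-- Pointwise the section has norm at most |f(t(g))| ‖ξ‖ ‖ζ‖, and ∫ f(t(g))² λ_x(dg) is bounded
-- uniformly in x.
include h𝒢 hf in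
theorem exists_norm_pairingSection_le : ∃ C, ∀ ζ, ‖toL2L E lam (α.pairingSection h𝒢 f hf ξ ζ)‖
    ≤ C * ‖(compactlySupported E X).subtype ζ‖ := by
  obtain ⟨C, hC0, hC⟩ := lam.exists_integral_tgt_le h𝒢 hf
  refine ⟨√C * ‖ξ‖, fun ζ => le_of_sq_le_sq ?_ (by positivity)⟩
  refine norm_sq_le_of_ip (E := E) (by positivity) fun x => ?_
  rw [ip_toL2L, sliceIntegral, mul_pow, mul_pow, Real.sq_sqrt hC0]
  calc _ ≤ ∫ g, f (𝒢.tgt g) ^ 2 * (‖ξ‖ ^ 2 * ‖ζ.1‖ ^ 2) ∂(lam.rmeas x) := by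
        refine norm_integral_le_of_norm_le ((hC x).1.mul_const _) ?_
        filter_upwards [lam.ae_src_eq x] with g hg
        rw [FellBundle.extend, dif_pos hg, ccKernel]
        refine (E.norm_mul_le _ _ _).trans ?_
        rw [norm_star_eq, ← sq, pairingSection_apply, norm_smul, Complex.norm_real, mul_pow,
          Real.norm_eq_abs, sq_abs]
        refine mul_le_mul_of_nonneg_left ?_ (sq_nonneg _)
        rw [← mul_pow]
        refine pow_le_pow_left₀ (norm_nonneg _) ?_ 2
        exact (α.norm_pairing_le _ _ _ _).trans
          (mul_le_mul (norm_val_le _ _) (norm_val_le _ _) (norm_nonneg _) (norm_nonneg _))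
    _ ≤ C * (‖ξ‖ ^ 2 * ‖ζ.1‖ ^ 2) := by
        rw [integral_mul_const]
        gcongr
        exact (hC x).2
    _ = _ := by rw [_root_.mul_assoc]; rfl

/-- Pointwise, ⟨ζ, ξ(t(g)) η(g)⟩ = ⟨ξ(t(g)), ζ⟩* η(g), and the real factor f(t(g)) can stand on
either side; integration gives the adjoint formula. -/
theorem ip_conv (ζ : compactlySupported E X) (η : E.Cc) (x : M) :
    E.ip x ζ.1 (α.conv lam ξ (ccFunMul (fun g => f (𝒢.tgt g))
      (f.continuous.comp 𝒢.continuous_tgt) η))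
      = E.ip x (toL2L E lam (α.pairingSection h𝒢 f hf ξ ζ)) (toL2L E lam η) := by
  rw [← fibInner_val, val_conv, ← fibInnerL_apply,
    ← ContinuousLinearMap.integral_comp_comm _ (α.integrable_conv lam ξ _ x), ip_toL2L,
    sliceIntegral]
  refine integral_congr_ae ?_
  filter_upwards [lam.ae_src_eq x] with g hg
  subst hg
  rw [extendFib_of_eq _ rfl, FellBundle.extend, dif_pos rfl, fibInnerL_apply, ← star_ccKernel,
    ← star_fibInner]
  congr 1
  rw [ccKernel, pairingSection_apply, E.mul_smul, star_mul_pairing]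
  change E.fibInner _ (α.act rfl rfl _ ((f (𝒢.tgt g) : ℂ) • η.1 g)) _ = _
  rw [map_smul, map_smulₛₗ, Complex.conj_ofReal, LinearMap.smul_apply]

include h𝒢 hf in
/-- The operator `η ↦ ∫ f(t(g)) ξ(t(g)) η(g) dλ` extends to an equivariant adjointable operator
`L²(Γ; E) → X`. -/
theorem exists_convOperator : ∃ (S : E.L2 lam →L[ℂ] X) (R : X →L[ℂ] E.L2 lam),
    IsEquivariantAdjoint (E.l2Structure lam) α S R ∧ ∀ η : E.Cc, S (toL2L E lam η)
      = α.conv lam ξ (ccFunMul (fun g => f (𝒢.tgt g)) (f.continuous.comp 𝒢.continuous_tgt) η) := by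
  set φ : Γ → ℝ := fun g => f (𝒢.tgt g) with hφ
  have hφc : Continuous φ := f.continuous.comp 𝒢.continuous_tgt
  obtain ⟨C, hC⟩ := α.exists_norm_pairingSection_le h𝒢 f hf ξ lam
  have hd : DenseRange (compactlySupported E X).subtype := by
    rw [DenseRange]
    have : range (compactlySupported E X).subtype = (compactlySupported E X : Set X) :=
      Subtype.range_coe
    rw [this]
    exact dense_compactlySupported
  -- The adjoint comes first: it has an explicit norm bound on a dense subspace, from which the
  -- bound for the integral operator follows by duality.
  set R : X →L[ℂ] E.L2 lam := ((toL2L E lam).comp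
    (α.pairingSection h𝒢 f hf ξ)).extendOfNorm (compactlySupported E X).subtype with hR
  have hRζ : ∀ ζ : compactlySupported E X, R ζ.1 = toL2L E lam (α.pairingSection h𝒢 f hf ξ ζ) :=
    fun ζ => LinearMap.extendOfNorm_eq hd ⟨C, hC⟩ ζ
  let S₀ : E.Cc →ₗ[ℂ] X := (α.conv lam ξ).comp
    ({ toFun := ccFunMul φ hφc
       map_add' := fun η η' => Subtype.ext (funext fun g => smul_add _ _ _)
       map_smul' := fun c η => Subtype.ext (funext fun g => smul_comm _ _ _) } : E.Cc →ₗ[ℂ] E.Cc)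
  have hadj : ∀ x (ζ : X) (η : E.Cc), E.ip x ζ (S₀ η) = E.ip x (R ζ) (toL2L E lam η) := by
    intro x ζ η
    refine hd.induction_on (p := fun ζ => E.ip x ζ (S₀ η) = E.ip x (R ζ) (toL2L E lam η)) ζ
      (isClosed_eq ?_ ?_) fun ζ => ?_
    · exact ((fibInnerL E X x).flip (E.val x (S₀ η))).continuous.comp (valL E X x).continuous
    · exact ((fibInnerL E (E.L2 lam) x).flip (E.val x (toL2L E lam η))).continuous.comp
        ((valL E (E.L2 lam) x).continuous.comp R.continuous)
    · exact (α.ip_conv h𝒢 f hf ξ lam ζ η x).trans (by rw [← hRζ]; rfl)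
  -- ‖S₀ η‖² is the norm of ⟨S₀ η, S₀ η⟩ = ⟨R S₀ η, η⟩, so the bound for R passes to S₀.
  have hbound : ∀ η : E.Cc, ‖S₀ η‖ ≤ ‖R‖ * ‖toL2L E lam η‖ := by
    intro η
    set w := S₀ η with hw
    have h1 : ‖w‖ ^ 2 ≤ ‖R‖ * ‖w‖ * ‖toL2L E lam η‖ := by
      refine norm_sq_le_of_ip (E := E) (by positivity) fun x => ?_
      rw [hadj x w η]
      refine (norm_ip_le _ _ _).trans ?_
      gcongr
      exact R.le_opNorm w
    rcases eq_or_ne ‖w‖ 0 with h0 | h0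
    · rw [h0]
      positivity
    · refine le_of_mul_le_mul_left ?_ (lt_of_le_of_ne (norm_nonneg _) h0.symm)
      rw [← sq]
      exact h1.trans_eq (by ring)
  have hdl := denseRange_toL2L (E := E) lam
  set S : E.L2 lam →L[ℂ] X := S₀.extendOfNorm (toL2L E lam) with hS
  have hSη : ∀ η : E.Cc, S (toL2L E lam η) = S₀ η := fun η =>
    LinearMap.extendOfNorm_eq hdl ⟨_, hbound⟩ η
  have hip : ∀ x (ζ : X) (η : E.L2 lam), E.ip x ζ (S η) = E.ip x (R ζ) η := by
    intro x ζ η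
    refine hdl.induction_on (p := fun η => E.ip x ζ (S η) = E.ip x (R ζ) η) η
      (isClosed_eq ?_ ?_) fun η => ?_
    · exact (fibInnerL E X x (E.val x ζ)).continuous.comp
        ((valL E X x).continuous.comp S.continuous)
    · exact (fibInnerL E (E.L2 lam) x (E.val x (R ζ))).continuous.comp
        (valL E (E.L2 lam) x).continuous
    · rw [hSη, hadj]
  refine ⟨S, R, ⟨fun η ζ => ?_, fun {g x y} ht hs e η η' h => ?_⟩, hSη⟩
  · exact unop_injective (A_ext fun x => hip x ζ η)
  · rw [← sub_eq_zero]
    refine eq_zero_of_fibInner fun z => ?_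
    obtain ⟨ζ, rfl⟩ := E.val_surjective x z
    rw [map_sub, sub_eq_zero, fibInner_val, hip, ← fibInner_val, ← h]
    refine hdl.induction_on (p := fun η => E.fibInner x (E.val x ζ) (α.act ht hs (E.val y (S η)) e)
      = E.fibInner x (E.val x (R ζ)) ((E.l2Structure lam).act ht hs (E.val y η) e)) η
      (isClosed_eq ?_ ?_) fun η => ?_
    · exact (fibInnerL E X x (E.val x ζ)).continuous.comp ((α.actL ht hs e).continuous.comp
        ((valL E X y).continuous.comp S.continuous))
    · exact (fibInnerL E (E.L2 lam) x (E.val x (R ζ))).continuous.comp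
        (((E.l2Structure lam).actL ht hs e).continuous.comp (valL E (E.L2 lam) y).continuous)
    · rw [l2Structure_act, fibInner_val, ← hip, hSη, hSη, ← fibInner_val]
      congr 1
      refine α.act_conv lam ξ _ ht hs e fun {h k} c => ?_
      have hk : 𝒢.tgt k = 𝒢.tgt h := by rw [← c.2, 𝒢.tgt_mul _ _ c.1]
      change (f (𝒢.tgt k) : ℂ) • (translate η e).1 k = E.mul c ((f (𝒢.tgt h) : ℂ) • η.1 h) e
      rw [translate_apply _ _ c, E.smul_mul, hk]

end EquivariantStructure

/-! ### Approximation of ξ a by integrals concentrated near the units -/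

namespace HaarSystem

variable {Γ M : Type*} [TopologicalSpace Γ] [TopologicalSpace M] {𝒢 : TopGroupoid Γ M}
  [T2Space Γ] [LocallyCompactSpace Γ] [SecondCountableTopology Γ] [MeasurableSpace Γ]
  [BorelSpace Γ] (lam : HaarSystem 𝒢)

/-- The unit at x lies in the support Γ^x of λ^x and is fixed by inversion, so the open set where χ
≠ 0 has positive measure. -/
theorem integral_rmeas_pos {χ : Γ → ℝ} (hχ : Continuous χ) (hχc : HasCompactSupport χ)
    (hχ0 : ∀ g, 0 ≤ χ g) {x : M} (hx : 0 < χ (𝒢.unit x)) : 0 < ∫ g, χ g ∂(lam.rmeas x) := by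
  rw [integral_pos_iff_support_of_nonneg hχ0 (lam.integrable_rmeas hχ hχc x), rmeas,
    Measure.map_apply 𝒢.continuous_inv.measurable hχ.isOpen_support.measurableSet]
  have h1 : 𝒢.unit x ∈ (lam.meas x).support := by
    rw [lam.support_eq]
    exact 𝒢.tgt_unit x
  refine (Measure.mem_support_iff_forall _).1 h1 _
    ((hχ.isOpen_support.preimage 𝒢.continuous_inv).mem_nhds ?_)
  change χ (𝒢.inv (𝒢.unit x)) ≠ 0
  rw [𝒢.inv_unit]
  exact hx.ne'

/-- Bump functions near the units with integrals equal to `1`. -/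
theorem exists_normalized_bump {L : Set M} (hL : IsCompact L) {U : Set Γ} (hU : IsOpen U)
    (hLU : ∀ x ∈ L, 𝒢.unit x ∈ U) : ∃ φ : Γ → ℝ, Continuous φ ∧ HasCompactSupport φ ∧
      (∀ g, 0 ≤ φ g) ∧ (∀ g ∉ U, φ g = 0) ∧ (∀ x, ∫ g, φ g ∂(lam.rmeas x) ≤ 1) ∧
      ∀ x ∈ L, ∫ g, φ g ∂(lam.rmeas x) = 1 := by
  have hLU' : 𝒢.unit '' L ⊆ U := by
    rintro _ ⟨x, hx, rfl⟩
    exact hLU x hx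
  obtain ⟨χ, hχ1, hχ0, hχc, hχ01⟩ := exists_continuous_one_zero_of_isCompact
    (hL.image 𝒢.continuous_unit) hU.isClosed_compl (disjoint_compl_right_iff_subset.2 hLU')
  set c : M → ℝ := fun x => ∫ g, χ g ∂(lam.rmeas x) with hc
  have hcc : Continuous c := lam.continuous_integral_rmeas χ.continuous hχc
  have hpos : ∀ x ∈ L, 0 < c x := fun x hx =>
    lam.integral_rmeas_pos χ.continuous hχc (fun g => (hχ01 g).1)
      (by rw [hχ1 ⟨x, hx, rfl⟩]; exact one_pos)
  -- δ bounds the integrals c(x) of χ from below on L. Division of χ by max(c ∘ s, δ) is continuous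
  -- even where c vanishes, and the new integral c / max(c, δ) is at most 1 and equals 1 on L.
  obtain ⟨δ, hδ, hδc⟩ := hL.exists_forall_le' hcc.continuousOn hpos
  have hmax : ∀ x, 0 < max (c x) δ := fun x => lt_max_of_lt_right hδ
  have hint : ∀ x, ∫ g, χ g * (max (c (𝒢.src g)) δ)⁻¹ ∂(lam.rmeas x) = c x * (max (c x) δ)⁻¹ := by
    intro x
    rw [hc, ← integral_mul_const]
    refine integral_congr_ae ?_
    filter_upwards [lam.ae_src_eq x] with g hg
    rw [hg]
  refine ⟨fun g => χ g * (max (c (𝒢.src g)) δ)⁻¹, ?_, hχc.mul_right, fun g => ?_, fun g hg => ?_,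
    fun x => ?_, fun x hx => ?_⟩
  · exact χ.continuous.mul (((hcc.comp 𝒢.continuous_src).max continuous_const).inv₀
      fun g => (hmax _).ne')
  · exact mul_nonneg (hχ01 g).1 (inv_nonneg.2 (hmax _).le)
  · simp [show χ g = 0 from hχ0 hg]
  · rw [hint, ← div_eq_mul_inv]
    exact div_le_one_of_le₀ (le_max_left _ _) (hmax x).le
  · rw [hint, max_eq_left (hδc x hx), mul_inv_cancel₀ (hpos x hx).ne']

end HaarSystem

namespace FellBundle

variable {Γ M : Type*} [TopologicalSpace Γ] [TopologicalSpace M] {𝒢 : TopGroupoid Γ M}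
  [T2Space Γ] [LocallyCompactSpace Γ] {E : FellBundle 𝒢}

/-- Elements of `A` with compact support extend to compactly supported sections over `Γ`. -/
theorem exists_Cc_extension_unit (a : E.A) {K : Set M} (hK : IsCompact K)
    (ha : ∀ x ∉ K, a x = 0) : ∃ σ : E.Cc, ∀ x, σ.1 (𝒢.unit x) = a x := by
  set C : Set Γ := range 𝒢.unit
  have hC : ∀ g : C, 𝒢.unit (𝒢.src g.1) = g.1 := by
    rintro ⟨_, x, rfl⟩
    rw [𝒢.src_unit]
  have key : ∀ (g g' : Γ) (h : g = g') (e : E.fiber g), (⟨g', h ▸ e⟩ : E.Tot) = ⟨g, e⟩ := by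
    rintro g _ rfl e
    rfl
  have key0 : ∀ (g g' : Γ) (h : g = g') (e : E.fiber g), e = 0 → h ▸ e = (0 : E.fiber g') := by
    rintro g _ rfl e rfl
    rfl
  -- The closed set of units carries a itself as a section, once its values over unit (s(g)) are
  -- transported to the equal fibre over g.
  obtain ⟨σ, hσ⟩ := exists_Cc_extension (E := E) (C := C) (φ := fun g => hC g ▸ a (𝒢.src g.1))
    𝒢.isClosedEmbedding_unit.isClosed_range (hK.image 𝒢.continuous_unit)
    (by
      have e : (fun g : C => (⟨g.1, hC g ▸ a (𝒢.src g.1)⟩ : E.Tot))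
          = fun g : C => ⟨𝒢.unit (𝒢.src g.1), a (𝒢.src g.1)⟩ := funext fun g => key _ _ (hC g) _
      rw [e]
      exact (A_continuous a).comp (𝒢.continuous_src.comp continuous_subtype_val))
    (fun g hg => key0 _ _ _ _ (ha _ fun h => hg ⟨_, h, hC g⟩))
  refine ⟨σ, fun x => ?_⟩
  rw [hσ ⟨𝒢.unit x, x, rfl⟩]
  have key' : ∀ y (_ : y = x) (h : 𝒢.unit y = 𝒢.unit x),
      (h ▸ (show E.fiber (𝒢.unit y) from a y) : E.fiber (𝒢.unit x)) = a x := by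
    rintro _ rfl h
    rfl
  exact key' _ (𝒢.src_unit x) _

end FellBundle

namespace EquivariantStructure

open FellBundle

variable {Γ M : Type*} [TopologicalSpace Γ] [TopologicalSpace M] {𝒢 : TopGroupoid Γ M}
  [T2Space Γ] [LocallyCompactSpace Γ] {E : FellBundle 𝒢} {X : Type*} [NormedAddCommGroup X]
  [NormedSpace ℂ X] [SMul E.Aop X] [CStarModule E.Aop X] [CompleteSpace X]
  (α : EquivariantStructure E X)

theorem fibInner_val_act {x : M} (u : E.Fib X x) (a : E.A) (ξ : X) :
    E.fibInner x u (E.val x (op a • ξ)) = E.fibInner x u (E.val x ξ) * a x := by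
  obtain ⟨ζ, rfl⟩ := E.val_surjective x u
  exact ip_act_right x ζ ξ a

/-- That unit fibres act through the module structure is not an axiom but follows from the others.
The vectors z e are total, (z e) a = z (e a), and the inner products ⟨z' e', z e⟩ = e'* ⟨z', z⟩ e
show that this is z e multiplied by a. -/
theorem fibInner_act_unit {x : M} (u w : E.Fib X x) (a : E.A) :
    E.fibInner x u (α.act (𝒢.tgt_unit x) (𝒢.src_unit x) w (a x)) = E.fibInner x u w * a x := by
  refine (α.denseRange_tensorAct (𝒢.tgt_unit x) (𝒢.src_unit x)).induction_on (p := fun w =>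
    E.fibInner x u (α.act (𝒢.tgt_unit x) (𝒢.src_unit x) w (a x)) = E.fibInner x u w * a x) w
    (isClosed_eq ?_ ?_) fun v => ?_
  · exact (fibInnerL E X x u).continuous.comp (α.actL _ _ (a x)).continuous
  · exact (fibInnerL E X x u).continuous.mul continuous_const
  induction v using TensorProduct.induction_on with
  | zero => simp only [map_zero, LinearMap.zero_apply, zero_mul]
  | add v v' h h' => rw [map_add, map_add, LinearMap.add_apply, map_add, map_add, h, h',
      _root_.add_mul]
  | tmul z e =>
    change E.fibInner x u (α.act _ _ (α.act _ _ z e) (a x))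
      = E.fibInner x u (α.act _ _ z e) * a x
    obtain ⟨ω, hω⟩ := E.val_surjective x (α.act (𝒢.tgt_unit x) (𝒢.src_unit x) z e)
    rw [← hω, ← fibInner_val_act, hω]
    congr 1
    refine α.eq_of_fibInner_act (𝒢.tgt_unit x) (𝒢.src_unit x) fun z' e' => ?_
    have c := TopGroupoid.comp_unit_unit (𝒢 := 𝒢) x
    have key : ∀ {g : Γ} (cg : 𝒢.Comp g (𝒢.unit x) (𝒢.unit x)) (p : E.fiber g)
        (b e d : E.unitFiber x), E.mul cg p (E.mul c b (E.mul c e d))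
        = E.mul c (E.mul cg p (E.mul c b e)) d := fun {g} cg p b e d => by
      rw [E.mul_assoc cg c c cg, E.mul_assoc c c c c]
    rw [fibInner_val_act, hω, α.act_act c _ _ _ _ (𝒢.tgt_unit x) (𝒢.src_unit x), α.inner_act,
      α.inner_act, unitFiber_mul_def]
    exact key _ _ _ _ _

theorem act_unit {x : M} (ξ : X) (a : E.A) :
    α.act (𝒢.tgt_unit x) (𝒢.src_unit x) (E.val x ξ) (a x) = E.val x (op a • ξ) := by
  rw [← sub_eq_zero]
  refine eq_zero_of_fibInner fun u => ?_
  rw [map_sub, fibInner_act_unit, fibInner_val_act, sub_self]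

theorem act_val_tgt {g : Γ} {x y : M} (ht : 𝒢.tgt g = y) (hs : 𝒢.src g = x) (ξ : X)
    (e : E.fiber g) : α.act rfl hs (E.val (𝒢.tgt g) ξ) e = α.act ht hs (E.val y ξ) e := by
  subst ht
  rfl

/-- At the unit over x both sections have the value (ξ a)(x). Some ζ ∈ X is close to the first
section near this unit; then ζ is close to ξ a at x, and hence nearby by upper semicontinuity. -/
theorem eventually_act_near (ξ : X) {a : E.A} {σ : E.Cc} (hσ : ∀ x, σ.1 (𝒢.unit x) = a x) {ε : ℝ}
    (hε : 0 < ε) (x : M) : ∀ᶠ g in 𝓝 (𝒢.unit x), ‖α.act rfl rfl (E.val (𝒢.tgt g) ξ) (σ.1 g)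
      - E.val (𝒢.src g) (op a • ξ)‖ < ε := by
  obtain ⟨ζ, hζ⟩ := α.continuous_act ξ σ.1 (Cc_continuous σ) (Cc_vanish σ) (𝒢.unit x) (ε / 2)
    (half_pos hε)
  have h0 : ∀ y (hy : 𝒢.src (𝒢.unit x) = y), α.act rfl hy (E.val (𝒢.tgt (𝒢.unit x)) ξ)
      (σ.1 (𝒢.unit x)) = E.val y (op a • ξ) := by
    intro y hy
    obtain rfl : y = x := hy.symm.trans (𝒢.src_unit x)
    rw [α.act_val_tgt (𝒢.tgt_unit y), hσ, act_unit]
  have h1 : ‖E.val (𝒢.src (𝒢.unit x)) (op a • ξ - ζ)‖ < ε / 2 := by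
    rw [map_sub, ← h0 _ rfl]
    exact hζ.self_of_nhds
  have h2 : ∀ᶠ g in 𝓝 (𝒢.unit x), ‖E.val (𝒢.src g) (op a • ξ - ζ)‖ < ε / 2 :=
    𝒢.continuous_src.continuousAt.eventually (upperSemicontinuous_fibNorm (E := E) _ _ _ h1)
  filter_upwards [hζ, h2] with g h3 h4
  have e : α.act rfl rfl (E.val (𝒢.tgt g) ξ) (σ.1 g) - E.val (𝒢.src g) (op a • ξ)
      = (α.act rfl rfl (E.val (𝒢.tgt g) ξ) (σ.1 g) - E.val (𝒢.src g) ζ)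
        - E.val (𝒢.src g) (op a • ξ - ζ) := by rw [map_sub]; abel
  rw [e]
  have h3' : ‖α.act rfl rfl (E.val (𝒢.tgt g) ξ) (σ.1 g) - E.val (𝒢.src g) ζ‖ < ε / 2 := h3
  exact (norm_sub_le _ _).trans_lt (by linarith)

variable [SecondCountableTopology Γ] [MeasurableSpace Γ] [BorelSpace Γ] (lam : HaarSystem 𝒢)

/-- The element `ξ a` is a limit of integrals `∫ ξ(t(g)) η(g) dλ`. -/
theorem exists_conv_near (ξ : X) {a : E.A} {K : Set M} (hK : IsCompact K) (ha : ∀ x ∉ K, a x = 0)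
    {ε : ℝ} (hε : 0 < ε) : ∃ η : E.Cc, ‖α.conv lam ξ η - op a • ξ‖ ≤ ε := by
  obtain ⟨σ, hσ⟩ := exists_Cc_extension_unit a hK ha
  set U := interior {g | ‖α.act rfl rfl (E.val (𝒢.tgt g) ξ) (σ.1 g)
      - E.val (𝒢.src g) (op a • ξ)‖ < ε} with hU
  obtain ⟨φ, hφ, hφc, hφ0, hφU, hφ1, hφK⟩ := lam.exists_normalized_bump hK isOpen_interior
    (U := U) fun x _ => mem_interior_iff_mem_nhds.2 (α.eventually_act_near ξ hσ hε x)
  refine ⟨ccFunMul φ hφ σ, norm_le_of_fibNorm (E := E) hε.le fun x => ?_⟩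
  -- Off K the vector (ξ a)(x) is zero, so the integral of φ has to be 1 only on K.
  have hu : E.val x (op a • ξ) = ((∫ g, φ g ∂(lam.rmeas x) : ℝ) : ℂ) • E.val x (op a • ξ) := by
    by_cases hx : x ∈ K
    · rw [hφK x hx, Complex.ofReal_one, one_smul]
    · have := norm_val_act_le x a ξ
      rw [ha x hx, norm_zero, mul_zero] at this
      rw [norm_le_zero_iff.1 this, smul_zero]
  have hi : Integrable (fun g => (φ g : ℂ)) (lam.rmeas x) :=
    (lam.integrable_rmeas hφ hφc x).ofReal
  have hu' : E.val x (op a • ξ) = ∫ g, (φ g : ℂ) • E.val x (op a • ξ) ∂(lam.rmeas x) := by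
    rw [integral_smul_const]
    conv_lhs => rw [hu]
    congr 1
    exact (integral_ofReal (𝕜 := ℂ)).symm
  rw [map_sub, val_conv, hu', ← integral_sub (α.integrable_conv lam ξ _ x) (hi.smul_const _),
    ← fib_norm_def]
  refine (norm_integral_le_of_norm_le ((lam.integrable_rmeas hφ hφc x).const_mul ε) ?_).trans ?_
  · filter_upwards [lam.ae_src_eq x] with g hg
    subst hg
    rw [extendFib_of_eq _ rfl]
    change ‖α.act rfl rfl (E.val (𝒢.tgt g) ξ) ((φ g : ℂ) • σ.1 g) - _‖ ≤ _
    rw [map_smul, ← smul_sub, norm_smul, Complex.norm_real, Real.norm_of_nonneg (hφ0 g), mul_comm]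
    by_cases hg : g ∈ U
    · have := interior_subset hg
      exact mul_le_mul_of_nonneg_right (le_of_lt this) (hφ0 g)
    · rw [hφU g hg, mul_zero, mul_zero]
  · rw [integral_const_mul]
    exact mul_le_of_le_one_right hε.le (hφ1 x)

end EquivariantStructure

/-! ### Absorption -/

namespace EquivariantStructure

open FellBundle

variable {Γ M : Type*} [TopologicalSpace Γ] [TopologicalSpace M] {𝒢 : TopGroupoid Γ M}
  [T2Space Γ] [LocallyCompactSpace Γ] {E : FellBundle 𝒢}
  {X Y : Type*} [NormedAddCommGroup X] [NormedSpace ℂ X] [CompleteSpace X] [SMul E.Aop X]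
  [CStarModule E.Aop X] [NormedAddCommGroup Y] [NormedSpace ℂ Y] [CompleteSpace Y]
  [SMul E.Aop Y] [CStarModule E.Aop Y]

theorem norm_sumInr (ξ : Y) : ‖sumInr E X Y ξ‖ = ‖ξ‖ := by
  rw [CStarModule.norm_eq_sqrt_norm_inner_self (A := E.Aop) ξ,
    CStarModule.norm_eq_sqrt_norm_inner_self (A := E.Aop)]
  simp [WithCStarModule.prod_inner, sumInr]

variable (E X Y) in
/-- The first inclusion as a continuous linear map. -/
noncomputable def sumInlL : X →L[ℂ] E.Sum X Y :=
  (sumInl E X Y).mkContinuous 1 fun ξ => by rw [norm_sumInl, one_mul]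

variable (E X Y) in
/-- The second inclusion as a continuous linear map. -/
noncomputable def sumInrL : Y →L[ℂ] E.Sum X Y :=
  (sumInr E X Y).mkContinuous 1 fun ξ => by rw [norm_sumInr, one_mul]

variable (E X Y) in
/-- The first projection as a continuous linear map. -/
noncomputable def sumFstL : E.Sum X Y →L[ℂ] X :=
  (sumFst E X Y).mkContinuous 1 fun w => by
    rw [one_mul]
    exact (le_max_left _ _).trans (WithCStarModule.max_le_prod_norm w)

variable (E X Y) in
/-- The second projection as a continuous linear map. -/
noncomputable def sumSndL : E.Sum X Y →L[ℂ] Y :=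
  (sumSnd E X Y).mkContinuous 1 fun w => by
    rw [one_mul]
    exact (le_max_right _ _).trans (WithCStarModule.max_le_prod_norm w)

theorem sumInlL_add_sumInrL (w : E.Sum X Y) :
    sumInlL E X Y (sumFstL E X Y w) + sumInrL E X Y (sumSndL E X Y w) = w := by
  apply (WithCStarModule.equiv E.Aop (X × Y)).injective
  exact Prod.ext (add_zero _) (zero_add _)

theorem isEquivariantAdjoint_sumInl (α : EquivariantStructure E X) (β : EquivariantStructure E Y) :
    IsEquivariantAdjoint α (α.sum β) (sumInlL E X Y) (sumFstL E X Y) where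
  adj ξ w := by
    change inner E.Aop w (sumInl E X Y ξ) = inner E.Aop (sumFst E X Y w) ξ
    simp [WithCStarModule.prod_inner, sumInl, sumFst]
  equivariant {g x y} ht hs e ξ ξ' h := by
    change α.sumAct β ht hs (fibInl E X Y y (E.val y ξ)) e = fibInl E X Y x (E.val x ξ')
    rw [sumAct_apply, fibFst_inl, fibSnd_inl, h, map_zero, LinearMap.zero_apply, map_zero, add_zero]

theorem isEquivariantAdjoint_sumInr (α : EquivariantStructure E X) (β : EquivariantStructure E Y) :
    IsEquivariantAdjoint β (α.sum β) (sumInrL E X Y) (sumSndL E X Y) where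
  adj ξ w := by
    change inner E.Aop w (sumInr E X Y ξ) = inner E.Aop (sumSnd E X Y w) ξ
    simp [WithCStarModule.prod_inner, sumInr, sumSnd]
  equivariant {g x y} ht hs e ξ ξ' h := by
    change α.sumAct β ht hs (fibInr E X Y y (E.val y ξ)) e = fibInr E X Y x (E.val x ξ')
    rw [sumAct_apply, fibFst_inr, fibSnd_inr, h, map_zero, LinearMap.zero_apply, map_zero, zero_add]

theorem tensorProj_tensorIncl (m n : ℕ) (ξ : X) :
    tensorProj E.Aop X m (tensorIncl E.Aop X n ξ) = if m = n then ξ else 0 := by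
  refine (tensorProj_toTensorH m (Finsupp.single n ξ)).trans ?_
  rw [Finsupp.single_apply]
  simp only [eq_comm]

theorem mem_of_tensorIncl_mem {P : Submodule ℂ (TensorH E.Aop X)} (hP : IsClosed (P : Set (TensorH E.Aop X)))
    (h : ∀ n ξ, tensorIncl E.Aop X n ξ ∈ P) (w : TensorH E.Aop X) : w ∈ P := by
  refine denseRange_toTensorH.induction_on (p := fun w => w ∈ P) w hP fun v => ?_
  induction v using Finsupp.induction_linear with
  | zero => rw [map_zero]; exact P.zero_mem
  | add v v' hv hv' => rw [map_add]; exact P.add_mem hv hv'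
  | single n ξ => exact h n ξ

theorem tsum_clm_apply {V W : Type*} [NormedAddCommGroup V] [NormedSpace ℂ V]
    [NormedAddCommGroup W] [NormedSpace ℂ W] [CompleteSpace W] {T : ℕ → V →L[ℂ] W}
    (hT : Summable fun n => ‖T n‖) (v : V) (n : ℕ) (h : ∀ m ≠ n, T m v = 0) :
    (∑' m, T m) v = T n v := by
  have := (ContinuousLinearMap.apply ℂ W v).map_tsum hT.of_norm
  exact this.trans (tsum_eq_single n h)

/-- If the ranges of equivariant adjointable operators `Y → X` span a dense subspace of `X`, then
`Y ⊗ H` absorbs `X`. -/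
theorem nonempty_absorption (α : EquivariantStructure E X) (β : EquivariantStructure E Y)
    {S : ℕ → Y →L[ℂ] X} {R : ℕ → X →L[ℂ] Y} (h : ∀ n, IsEquivariantAdjoint β α (S n) (R n))
    (hS : ∀ P : Submodule ℂ X, IsClosed (P : Set X) → (∀ n η, S n η ∈ P) → P = ⊤) :
    Nonempty (EquivariantIso (α.sum β.amp) β.amp) := by
  set Z := TensorH E.Aop Y with hZ
  -- This index takes every value k infinitely often, at n = `Nat.pair k j`.
  let m : ℕ → ℕ := fun n => (Nat.unpair n).1
  -- The weight c_n gives c_n ‖S_{m(n)}‖ ≤ 2^{-n}, which is summable. The smaller d_n = 4^{-n} is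
  -- chosen so that d_n / c_n = 2^{-n} (‖S_k‖ + 1) tends to 0 along m(n) = k.
  let c : ℕ → ℝ := fun n => (1 / 2) ^ n / (‖S (m n)‖ + 1)
  let d : ℕ → ℝ := fun n => (1 / 4) ^ n
  have hc : ∀ n, 0 < c n := fun n => by positivity
  have hd : ∀ n, 0 < d n := fun n => by positivity
  let ι : ℕ → Y →L[ℂ] Z := tensorIncl E.Aop Y
  let π : ℕ → Z →L[ℂ] Y := tensorProj E.Aop Y
  let T₁ : ℕ → Y →L[ℂ] E.Sum X Z := fun n => (c n : ℂ) • (sumInlL E X Z).comp (S (m n))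
    + (d n : ℂ) • (sumInrL E X Z).comp (ι n)
  let Q₁ : ℕ → E.Sum X Z →L[ℂ] Y := fun n =>
    (starRingEnd ℂ (c n)) • (R (m n)).comp (sumFstL E X Z)
    + (starRingEnd ℂ (d n)) • (π n).comp (sumSndL E X Z)
  let T : ℕ → Z →L[ℂ] E.Sum X Z := fun n => (T₁ n).comp (π n)
  let Q : ℕ → E.Sum X Z →L[ℂ] Z := fun n => (ι n).comp (Q₁ n)
  have hTQ : ∀ n, IsEquivariantAdjoint β.amp (α.sum β.amp) (T n) (Q n) := fun n =>
    (IsEquivariantAdjoint.add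
      (((α.isEquivariantAdjoint_sumInl β.amp).comp (h (m n))).smul (c n))
      (((α.isEquivariantAdjoint_sumInr β.amp).comp
        (β.isEquivariantAdjoint_tensorIncl n)).smul (d n))).comp
      (β.isEquivariantAdjoint_tensorIncl n).symm
  have hT₁ : ∀ n η, T₁ n η = (c n : ℂ) • sumInlL E X Z (S (m n) η)
      + (d n : ℂ) • sumInrL E X Z (ι n η) := fun n η => rfl
  have hcle : ∀ n, c n * ‖S (m n)‖ ≤ (1 / 2) ^ n := fun n => by
    change (1 / 2) ^ n / (‖S (m n)‖ + 1) * ‖S (m n)‖ ≤ _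
    rw [div_mul_eq_mul_div, div_le_iff₀ (by positivity)]
    gcongr
    linarith
  have hdle : ∀ n, d n ≤ (1 / 2) ^ n := fun n =>
    pow_le_pow_left₀ (by norm_num) (by norm_num) n
  have hTn : ∀ n, ‖T n‖ ≤ 2 * (1 / 2) ^ n := fun n => by
    have h1 : ‖T₁ n‖ ≤ 2 * (1 / 2) ^ n := by
      refine ContinuousLinearMap.opNorm_le_bound _ (by positivity) fun η => ?_
      rw [hT₁]
      refine (norm_add_le _ _).trans ?_
      rw [norm_smul, norm_smul, Complex.norm_real, Complex.norm_real,
        Real.norm_of_nonneg (hc n).le, Real.norm_of_nonneg (hd n).le]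
      have e1 : ‖sumInlL E X Z (S (m n) η)‖ ≤ ‖S (m n)‖ * ‖η‖ :=
        (norm_sumInl _).trans_le ((S (m n)).le_opNorm η)
      have e2 : ‖sumInrL E X Z (ι n η)‖ ≤ ‖η‖ := (norm_sumInr _).trans_le
        (((ι n).le_of_opNorm_le (norm_tensorIncl_le n) η).trans_eq (one_mul _))
      have e3 := mul_le_mul_of_nonneg_left e1 (hc n).le
      have e4 := mul_le_mul_of_nonneg_left e2 (hd n).le
      have e5 := mul_le_mul_of_nonneg_right (hcle n) (norm_nonneg η)
      have e6 := mul_le_mul_of_nonneg_right (hdle n) (norm_nonneg η)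
      rw [_root_.mul_assoc] at e5
      linarith
    calc ‖T n‖ ≤ ‖T₁ n‖ * ‖π n‖ := ContinuousLinearMap.opNorm_comp_le _ _
      _ ≤ 2 * (1 / 2) ^ n * 1 := mul_le_mul h1 (norm_tensorProj_le n) (norm_nonneg _)
        (by positivity)
      _ = _ := mul_one _
  have hsum : Summable fun n => ‖T n‖ := Summable.of_nonneg_of_le (fun n => (T n).opNorm_nonneg) hTn
    ((summable_geometric_of_lt_one (by norm_num) (by norm_num)).mul_left 2)
  have hsumQ : Summable fun n => ‖Q n‖ := by simpa only [(hTQ _).norm_eq] using hsum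
  have hπι : ∀ k n η, π k (ι n η) = if k = n then η else 0 := tensorProj_tensorIncl
  have hTι : ∀ n η, (∑' n, T n) (ι n η) = T₁ n η := fun n η => by
    rw [tsum_clm_apply hsum (ι n η) n fun k hk => ?_]
    · change T₁ n (π n (ι n η)) = _
      rw [hπι, if_pos rfl]
    · change T₁ k (π k (ι n η)) = _
      rw [hπι, if_neg hk, map_zero]
  have hQ₁ : ∀ k n η, Q₁ k (sumInrL E X Z (ι n η)) = if k = n then (d n : ℂ) • η else 0 :=
    fun k n η => by
      change (starRingEnd ℂ (c k)) • R (m k) 0 + (starRingEnd ℂ (d k)) • π k (ι n η) = _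
      rw [map_zero, smul_zero, zero_add, hπι, Complex.conj_ofReal]
      split_ifs with hk
      · rw [hk]
      · rw [smul_zero]
  have hQι : ∀ n η, (∑' n, Q n) (sumInrL E X Z (ι n η)) = (d n : ℂ) • ι n η := fun n η => by
    rw [tsum_clm_apply hsumQ _ n fun k hk => ?_]
    · change ι n (Q₁ n _) = _
      rw [hQ₁, if_pos rfl, map_smul]
    · change ι k (Q₁ k _) = _
      rw [hQ₁, if_neg hk, map_zero]
  -- Polar decomposition is applied to the adjoint of T, from X ⊕ (Y ⊗ H) to Y ⊗ H. The range of
  -- this adjoint contains every η ⊗ δ_n, the image of (0, d_n⁻¹ η ⊗ δ_n).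
  refine (IsEquivariantAdjoint.tsum hTQ hsum).symm.nonempty_equivariantIso ?_ ?_
  · refine fun w => mem_of_tensorIncl_mem
      (P := (LinearMap.range (∑' n, Q n).toLinearMap).topologicalClosure)
      (Submodule.isClosed_topologicalClosure _) (fun n η => ?_) w
    refine Submodule.le_topologicalClosure _ ⟨((d n : ℂ)⁻¹) • sumInrL E X Z (ι n η), ?_⟩
    refine (map_smul (∑' n, Q n) _ _).trans ?_
    rw [hQι, smul_smul, inv_mul_cancel₀ (by exact_mod_cast (hd n).ne'), one_smul]
  · set P := (LinearMap.range (∑' n, T n).toLinearMap).topologicalClosure with hP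
    suffices hPw : ∀ w, w ∈ P from fun w => hPw w
    have hPc : IsClosed (P : Set (E.Sum X Z)) := Submodule.isClosed_topologicalClosure _
    have hTP : ∀ n η, T₁ n η ∈ P := fun n η =>
      Submodule.le_topologicalClosure _ ⟨ι n η, hTι n η⟩
    -- Dividing T(η ⊗ δ_n) by c_n leaves (S_k η, 0) up to an error of at most (d_n / c_n) ‖η‖. It is
    -- small for n = `Nat.pair k j` with j large, since n ≥ j.
    have hinl : ∀ k η, sumInlL E X Z (S k η) ∈ P := by
      intro k η
      refine hPc.closure_subset ?_
      rw [Metric.mem_closure_iff]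
      intro ε hε
      obtain ⟨j, hj⟩ := exists_pow_lt_of_lt_one
        (show 0 < ε / ((‖S k‖ + 1) * (‖η‖ + 1)) by positivity) (show (1 / 2 : ℝ) < 1 by norm_num)
      set n := Nat.pair k j with hn
      have hmn : m n = k := by simp [m, hn]
      refine ⟨((c n : ℂ)⁻¹) • T₁ n η, P.smul_mem _ (hTP n η), ?_⟩
      have hcn : (c n : ℂ) ≠ 0 := by exact_mod_cast (hc n).ne'
      rw [dist_eq_norm, hT₁, smul_add, smul_smul, inv_mul_cancel₀ hcn, one_smul, hmn,
        sub_add_cancel_left, norm_neg, smul_smul, norm_smul, ← Complex.ofReal_inv,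
        ← Complex.ofReal_mul, Complex.norm_real,
        Real.norm_of_nonneg (mul_nonneg (inv_nonneg.2 (hc n).le) (hd n).le)]
      have e2 : ‖sumInrL E X Z (ι n η)‖ ≤ ‖η‖ := (norm_sumInr _).trans_le
        (((ι n).le_of_opNorm_le (norm_tensorIncl_le n) η).trans_eq (one_mul _))
      have e3 : (c n)⁻¹ * d n = (1 / 2) ^ n * (‖S k‖ + 1) := by
        change ((1 / 2) ^ n / (‖S (m n)‖ + 1))⁻¹ * (1 / 4) ^ n = _
        rw [hmn, show (1 / 4 : ℝ) ^ n = (1 / 2) ^ n * (1 / 2) ^ n by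
          rw [← mul_pow]; norm_num]
        field_simp
      have e4 : (1 / 2 : ℝ) ^ n ≤ (1 / 2) ^ j :=
        pow_le_pow_of_le_one (by norm_num) (by norm_num) (Nat.right_le_pair k j)
      rw [lt_div_iff₀ (by positivity)] at hj
      rw [e3]
      calc _ ≤ (1 / 2) ^ j * (‖S k‖ + 1) * (‖η‖ + 1) := by
            gcongr
            exact e2.trans (by linarith)
        _ < ε := by rwa [_root_.mul_assoc]
    have hX : ∀ ξ : X, sumInlL E X Z ξ ∈ P := by
      have := hS (P.comap (sumInlL E X Z).toLinearMap)
        (hPc.preimage (sumInlL E X Z).continuous) hinl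
      intro ξ
      have hξ : ξ ∈ P.comap (sumInlL E X Z).toLinearMap := by rw [this]; trivial
      exact hξ
    -- Now that X ⊕ 0 lies in P, the first component of T(η ⊗ δ_n) can be subtracted; what remains
    -- is a nonzero multiple of (0, η ⊗ δ_n).
    have hZ : ∀ w : Z, sumInrL E X Z w ∈ P := by
      refine mem_of_tensorIncl_mem (P := P.comap (sumInrL E X Z).toLinearMap)
        (hPc.preimage (sumInrL E X Z).continuous) fun n η => ?_
      have h1 : (d n : ℂ) • sumInrL E X Z (ι n η) ∈ P := by
        have := P.sub_mem (hTP n η) (P.smul_mem (c n : ℂ) (hX (S (m n) η)))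
        rwa [hT₁, add_sub_cancel_left] at this
      have h2 := P.smul_mem ((d n : ℂ)⁻¹) h1
      rwa [smul_smul, inv_mul_cancel₀ (by exact_mod_cast (hd n).ne'), one_smul] at h2
    intro w
    rw [← sumInlL_add_sumInrL w]
    exact P.add_mem (hX _) (hZ _)

variable [SecondCountableTopology Γ] [MeasurableSpace Γ] [BorelSpace Γ] (lam : HaarSystem 𝒢)

/-- A countably generated equivariant module is generated by the ranges of countably many
equivariant adjointable operators on `L²(Γ; E)`. -/
theorem exists_operators (h𝒢 : 𝒢.Proper) (α : EquivariantStructure E X)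
    (hX : E.CountablyGenerated X) : ∃ (S : ℕ → E.L2 lam →L[ℂ] X) (R : ℕ → X →L[ℂ] E.L2 lam),
      (∀ n, IsEquivariantAdjoint (E.l2Structure lam) α (S n) (R n)) ∧
      ∀ P : Submodule ℂ X, IsClosed (P : Set X) → (∀ n η, S n η ∈ P) → P = ⊤ := by
  have := 𝒢.t2Space_base
  have := 𝒢.locallyCompactSpace_base
  have := 𝒢.secondCountableTopology_base
  obtain ⟨G, hG, hGd⟩ := hX
  obtain ⟨ξ, hξ⟩ := Set.countable_iff_exists_subset_range.1 hG
  let K : CompactExhaustion M := default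
  choose f hf1 _ hfc _ using fun k => 𝒢.exists_bump (K.isCompact k) isOpen_univ (subset_univ _)
  -- There is one operator for each generator ξ_i and each cutoff f_k, equal to 1 on the k-th set of
  -- the exhaustion. The cutoff supplies the compact support on which the boundedness of the
  -- operator rests.
  choose S R hSR hS using fun n : ℕ =>
    α.exists_convOperator h𝒢 (f (Nat.unpair n).2) (hfc _) (ξ (Nat.unpair n).1) lam
  refine ⟨S, R, hSR, fun P hP hSP => ?_⟩
  have hconv : ∀ i (η : E.Cc), α.conv lam (ξ i) η ∈ P := by
    intro i η
    obtain ⟨L, hL, hηL⟩ := η.2.2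
    -- For k large enough f_k is 1 on t(supp η), and the k-th operator gives the integral without
    -- cutoff.
    obtain ⟨k, hk⟩ := K.exists_superset_of_isCompact (hL.image 𝒢.continuous_tgt)
    have h1 := hSP (Nat.pair i k) (toL2L E lam η)
    rw [hS] at h1
    simp only [Nat.unpair_pair] at h1
    convert h1
    refine Subtype.ext (funext fun g => ?_)
    change η.1 g = (f k (𝒢.tgt g) : ℂ) • η.1 g
    by_cases hg : g ∈ L
    · rw [hf1 k (hk ⟨g, hg, rfl⟩), Pi.one_apply, Complex.ofReal_one, one_smul]
    · rw [hηL g hg, smul_zero]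
  have hact : ∀ i (a : E.Aop), a • ξ i ∈ P := by
    intro i a
    refine hP.closure_subset ?_
    rw [Metric.mem_closure_iff]
    intro ε hε
    -- Two approximations with error ε/2 each: a by an element b of compact support, then ξ_i b by
    -- an integral concentrated near the units.
    obtain ⟨b, ⟨L, hL, hb⟩, hab⟩ := exists_compactSupport_approx a.unop
      (show 0 < ε / (2 * (‖ξ i‖ + 1)) by positivity)
    obtain ⟨η, hη⟩ := α.exists_conv_near lam (ξ i) hL hb (show 0 < ε / 2 by positivity)
    refine ⟨_, hconv i η, ?_⟩
    have h1 := norm_act_sub_le (by positivity) hab (ξ i)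
    rw [MulOpposite.op_unop] at h1
    have h2 : ‖ξ i‖ * (ε / (2 * (‖ξ i‖ + 1))) < ε / 2 := by
      rw [mul_div_assoc', div_lt_div_iff₀ (by positivity) (by norm_num)]
      nlinarith [norm_nonneg (ξ i)]
    rw [dist_eq_norm]
    have e : a • ξ i - α.conv lam (ξ i) η = (a • ξ i - op b • ξ i)
        - (α.conv lam (ξ i) η - op b • ξ i) := by abel
    rw [e]
    exact (norm_sub_le _ _).trans_lt (by linarith)
  rw [eq_top_iff]
  intro v _
  have hle : Submodule.span ℂ {v | ∃ a : E.Aop, ∃ ξ ∈ G, v = a • ξ} ≤ P := by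
    refine Submodule.span_le.2 ?_
    rintro _ ⟨a, z, hz, rfl⟩
    obtain ⟨i, rfl⟩ := hξ hz
    exact hact i a
  exact hP.closure_subset_iff.2 hle (hGd v)

end EquivariantStructure

/-- The witness ρ is the amplified right translation, which does not depend on `X`. The absorption
argument applies to it with the integral operators as the total family. -/
theorem mainTheorem12 {Γ M : Type*} [TopologicalSpace Γ] [T2Space Γ] [LocallyCompactSpace Γ]
    [SecondCountableTopology Γ] [MeasurableSpace Γ] [BorelSpace Γ] [TopologicalSpace M]
    (𝒢 : TopGroupoid Γ M) (h𝒢 : 𝒢.Proper) (lam : HaarSystem 𝒢) (E : FellBundle 𝒢)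
    {X : Type*} [NormedAddCommGroup X] [NormedSpace ℂ X] [CompleteSpace X] [SMul E.Aop X]
    [CStarModule E.Aop X] (α : EquivariantStructure E X) (hX : E.CountablyGenerated X) :
    ∃ ρ : EquivariantStructure E (E.L2H lam), ρ.IsTranslation ∧
      Nonempty (EquivariantIso (α.sum ρ) ρ) := by
  obtain ⟨S, R, hSR, hS⟩ := EquivariantStructure.exists_operators lam h𝒢 α hX
  exact ⟨(E.l2Structure lam).amp, FellBundle.isTranslation_amp lam,
    EquivariantStructure.nonempty_absorption α (E.l2Structure lam) hSR hS⟩
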